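/- Write $\sigma(z)=\bar z$, $\Sigma(W)=\overline W$ and $T_c(W)=W+c$. Let $f(z)=a_1\bar z+a_2\bar z^2+\cdots$ be an antiholomorphic parabolic germ at $0\in\mathbb C$: a germ of antiholomorphic map fixing $0$ with $|a_1|=1$ and $0$ an isolated fixed point. Such an $f$ is formally conjugate to a series $\bar w+\sum_{n\ge 2}A_n\bar w^n$ with real coefficients, and its codimension $k\ge 1$ is defined by $A_{k+1}\neq 0$ and $A_n=0$ for $2\le n\le k$. When $k$ is even, assume that $f$ is of positive type, i.e. $A_{k+1}>0$. Let $b$ be the formal invariant of $f$: $f\circ f$ is analytically conjugate to $z+z^{k+1}+\left(\frac{k+1}{2}-b\right)z^{2k+1}+o(z^{2k+1})$. The formal symmetry axis of $f$ has as tangent at $0$ the real line $\{v\in\mathbb C: a_1\bar v=v\}$. Modulus. In a suitable analytic coordinate, $f$ is prenormalized: $f(z)=\bar z+\frac12\bar z^{k+1}+\left(\frac{k+1}{8}-\frac b2\right)\bar z^{2k+1}+o(\bar z^{2k+1})$. In such a coordinate, for $-k\le j\le k$, let $S_j$ be the Fatou petals of $f\circ f$ around the directions $e^{ij\pi/k}$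 (repelling for $j$ even, attracting for $j$ odd, $S_{-k}=S_k$), with the time charts $Z_j(z)=-\frac1{kz^k}+b\log z-\frac{ji\pi b}{k}$, in each of which the image of $S_j$ contains a left half-plane ($j$ even) or a right half-plane ($j$ odd), as well as an upper and a lower half-plane. Fatou coordinates of $f$ are injective holomorphic functions $\varphi_j:S_j\to\mathbb C$ with $\varphi_{-k}=\varphi_k$ and $\varphi_{-j}\circ f=\Sigma\circ T_{1/2}\circ\varphi_j$ wherever this is defined. The transition functions are, for $1\le j\le k$, $\Psi_j=\varphi_j\circ\varphi_{j-1}^{-1}$ ($j$ odd; defined on an upper half-plane) and $\Psi_j=\varphi_{j-1}\circ\varphi_j^{-1}$ ($j$ even; defined on a lower half-plane), computed on the part of $S_{j-1}\cap S_j$ between the directions $e^{i(j-1)\pi/k}$ and $e^{ij\pi/k}$ and regarded as germs at $+i\infty$, respectively $-i\infty$. They are normalized if the constant term of the Fourier series of $\Psi_j(W)-W$ is $(-1)^j\frac{i\pi b}{k}$ for $1\le j\le k$. Put $\Psi_{-j}=\Sigma\circ T_{1/2}\circ\Psi_j\circ\Sigma\circ T_{-1/2}$. The modulus of classification of $f$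 is $(k,b,[\Psi_1,\dots,\Psi_k])$, where $[\Psi_1,\ldots,\Psi_k]$ is the class of normalized transition functions of $f$ under the equivalence relation generated by $(\Psi_j)_j\sim(T_C\circ\Psi_j\circ T_{-C})_j$ for $C\in\mathbb R$ and, when $k$ is even, by $(\Psi_j)_j\cong(\Psi_{-(k-j+1)})_j$. The elements of this class are called its representatives. Theorem. The following four statements are equivalent. 1. $f$ preserves a germ of (regular) real analytic curve $\Gamma$ through the origin which, when $k$ is even, is tangent to the formal symmetry axis of $f$. 2. $f$ is analytically conjugate, by a germ of biholomorphism fixing $0$, to a germ $\sum_{n\ge1}A_n\bar z^n$ with real coefficients $A_n$ and, when $k$ is even, with $A_1=1$. 3. Each representative $(\Psi_1,\dots,\Psi_k)$ of the modulus satisfies $\Psi_j\circ T_{1/2}=T_{1/2}\circ\Psi_j$ for $1\le j\le k$. 4. Each representative $(\Psi_1,\dots,\Psi_k)$ of the modulus satisfies $\Psi_j\circ\Sigma=\Sigma\circ\Psi_{-j}$ for $1\le j\le k$. -/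

import Mathlib

open Filter Topology Asymptotics
open scoped ComplexConjugate Real

namespace AntiParabolic

noncomputable section

/-! Germs at the origin are represented by total functions `ℂ → ℂ`; every notion below only depends
on the values near `0`. -/

/-- A germ of antiholomorphic map fixing the origin: `z ↦ f (conj z)` is holomorphic near `0`. -/
def IsAntiholomorphicGerm (f : ℂ → ℂ) : Prop :=
  f 0 = 0 ∧ AnalyticAt ℂ (fun z => f (conj z)) 0

/-- The Wirtinger derivative `∂f/∂z̄ (0)` of an antiholomorphic germ. -/
def dbar (f : ℂ → ℂ) : ℂ := deriv (fun z => f (conj z)) 0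

/-- An antiholomorphic parabolic germ: `0` is an isolated fixed point and `|∂f/∂z̄ (0)| = 1`. -/
structure IsParabolicGerm (f : ℂ → ℂ) : Prop where
  antiholomorphic : IsAntiholomorphicGerm f
  norm_dbar : ‖dbar f‖ = 1
  isolated : ∀ᶠ z in 𝓝[≠] (0 : ℂ), f z ≠ z

/-- A germ of biholomorphism fixing the origin (an analytic change of coordinate). -/
structure IsBiholomorphicGerm (h : ℂ → ℂ) : Prop where
  analytic : AnalyticAt ℂ h 0
  map_zero : h 0 = 0
  deriv_ne_zero : deriv h 0 ≠ 0

/-- `h` conjugates `f` to `p`, that is `p = h ∘ f ∘ h⁻¹` as germs at the origin. -/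
def Conjugates (h f p : ℂ → ℂ) : Prop :=
  IsBiholomorphicGerm h ∧ ∀ᶠ z in 𝓝 (0 : ℂ), h (f z) = p (h z)

/-! ### Codimension, type and formal invariant -/

/-- The power series `a₁ X + a₂ X² + ⋯` such that `f z = a₁ z̄ + a₂ z̄² + ⋯`. -/
def antiTaylor (f : ℂ → ℂ) : PowerSeries ℂ :=
  PowerSeries.mk fun n => iteratedDeriv n (fun z => f (conj z)) 0 / (n.factorial : ℂ)

/-- `f` is formally conjugate, by a formal change of coordinate `h`, to the series
`w̄ + A₂ w̄² + A₃ w̄³ + ⋯` with real coefficients. In terms of power series in `z̄`, the relation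
`h ∘ f = A ∘ h` reads `h (f̂ (X)) = A (h̄ (X))`, where `h̄` has the conjugate coefficients. -/
def IsRealFormalForm (f : ℂ → ℂ) (A : PowerSeries ℝ) : Prop :=
  PowerSeries.coeff 0 A = 0 ∧ PowerSeries.coeff 1 A = 1 ∧
  ∃ h : PowerSeries ℂ, PowerSeries.coeff 0 h = 0 ∧ PowerSeries.coeff 1 h ≠ 0 ∧
    PowerSeries.subst (antiTaylor f) h =
      PowerSeries.subst (PowerSeries.map (starRingEnd ℂ) h) (PowerSeries.map Complex.ofRealHom A)

/-- The first nonlinear term of a real formal form of `f` has order `k + 1`. -/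
def HasCodimension (f : ℂ → ℂ) (k : ℕ) : Prop :=
  1 ≤ k ∧ ∃ A : PowerSeries ℝ, IsRealFormalForm f A ∧
    (∀ n, 2 ≤ n → n ≤ k → PowerSeries.coeff n A = 0) ∧ PowerSeries.coeff (k + 1) A ≠ 0

/-- Positive type: the first nonlinear coefficient `A_{k+1}` of a real formal form is positive. -/
def IsPositiveType (f : ℂ → ℂ) (k : ℕ) : Prop :=
  ∃ A : PowerSeries ℝ, IsRealFormalForm f A ∧
    (∀ n, 2 ≤ n → n ≤ k → PowerSeries.coeff n A = 0) ∧ 0 < PowerSeries.coeff (k + 1) A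

/-- The holomorphic germ `g` is prenormalized, with codimension `k` and formal invariant `b`. -/
def IsHolPrenormalized (g : ℂ → ℂ) (k : ℕ) (b : ℂ) : Prop :=
  AnalyticAt ℂ g 0 ∧
  (fun z : ℂ => g z - (z + z ^ (k + 1) + (((k : ℂ) + 1) / 2 - b) * z ^ (2 * k + 1)))
    =o[𝓝 0] fun z : ℂ => z ^ (2 * k + 1)

/-- `b` is the formal invariant of `f`, i.e. that of the holomorphic parabolic germ `f ∘ f`. -/
def HasFormalInvariant (f : ℂ → ℂ) (k : ℕ) (b : ℂ) : Prop :=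
  ∃ h g : ℂ → ℂ, Conjugates h (f ∘ f) g ∧ IsHolPrenormalized g k b

/-- The antiholomorphic germ `f` is prenormalized, with codimension `k` and formal invariant `b`:
`f z = z̄ + z̄^(k+1) / 2 + ((k+1)/8 - b/2) z̄^(2k+1) + o(z̄^(2k+1))`. -/
def IsPrenormalized (f : ℂ → ℂ) (k : ℕ) (b : ℂ) : Prop :=
  IsAntiholomorphicGerm f ∧
  (fun z : ℂ => f z - (conj z + 1 / 2 * conj z ^ (k + 1)
      + (((k : ℂ) + 1) / 8 - b / 2) * conj z ^ (2 * k + 1)))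
    =o[𝓝 0] fun z : ℂ => z ^ (2 * k + 1)

/-! ### Time charts, petals and Fatou coordinates -/

/-- The rotation bringing the direction `e^{ijπ/k}` to the positive real axis. -/
def rot (k : ℕ) (j : ℤ) (z : ℂ) : ℂ := z * Complex.exp (-((j : ℂ) * π / k) * Complex.I)

/-- The time chart `Z_j z = -1/(k z^k) + b log z - jiπb/k`, where the branch of `log z - jiπ/k` is
the one which is real in the direction `e^{ijπ/k}`. The charts for `j = k` and `j = -k` agree. -/
def timeChart (k : ℕ) (b : ℂ) (j : ℤ) (z : ℂ) : ℂ :=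
  -1 / ((k : ℂ) * z ^ k) + b * Complex.log (rot k j z)

/-- The image `U_j` of a petal in the time chart: it contains a left (`j` even, repelling petal) or
right (`j` odd, attracting petal) half-plane, an upper half-plane and a lower half-plane. The
parameter `R` measures how small the petal is. -/
def timeDomain (R : ℝ) (j : ℤ) : Set ℂ :=
  {Z | R < |Z.im| ∨ (Even j ∧ Z.re < -R) ∨ (Odd j ∧ R < Z.re)}

/-- The petal `S_j`, around the direction `e^{ijπ/k}`, for `-k ≤ j ≤ k`. The petals `S_k` and
`S_{-k}` coincide. -/
def petal (k : ℕ) (b : ℂ) (R : ℝ) (j : ℤ) : Set ℂ :=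
  {z | z ≠ 0 ∧ ‖z‖ < 1 ∧ |Complex.arg (rot k j z)| < π / k ∧ timeChart k b j z ∈ timeDomain R j}

/-- Fatou coordinates of a prenormalized antiholomorphic germ `f`, written in the coordinate `z`
(that is, `φ j = Φ_j ∘ Z_j` on `S_j`): injective holomorphic functions on the petals, such that
`f : S_j → S_{-j}` becomes `Σ ∘ T_{1/2}`. -/
structure IsFatouCoordinates (f : ℂ → ℂ) (k : ℕ) (b : ℂ) (R : ℝ) (φ : ℤ → ℂ → ℂ) : Prop where
  holomorphic : ∀ j ∈ Set.Icc (-(k : ℤ)) k, DifferentiableOn ℂ (φ j) (petal k b R j)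
  injective : ∀ j ∈ Set.Icc (-(k : ℤ)) k, Set.InjOn (φ j) (petal k b R j)
  glue : Set.EqOn (φ (-(k : ℤ))) (φ k) (petal k b R k)
  conjugate : ∀ j ∈ Set.Icc (-(k : ℤ)) k, ∀ z ∈ petal k b R j, f z ∈ petal k b R (-j) →
    φ (-j) (f z) = conj (φ j z + 1 / 2)

/-! ### Transition functions -/

/-- The translation `T_c`. -/
def T (c : ℂ) (W : ℂ) : ℂ := W + c

/-- The complex conjugation `Σ`. -/
def Sig (W : ℂ) : ℂ := conj W

/-- The transition function `Ψ_j` is a germ at the end `+i∞` or `-i∞` of the plane: it is defined on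
an upper half-plane for `j > 0` odd and `j < 0` even, and on a lower half-plane otherwise. -/
def hornEnd (j : ℤ) : Filter ℂ :=
  if (Odd j ↔ 0 < j) then comap Complex.im atTop else comap Complex.im atBot

/-- For `j > 0`, the repelling one among the two consecutive petals `S_{j-1}` and `S_j`. -/
def source (j : ℤ) : ℤ := if Odd j then j - 1 else j

/-- For `j > 0`, the attracting one among the two consecutive petals `S_{j-1}` and `S_j`. -/
def target (j : ℤ) : ℤ := if Odd j then j else j - 1

/-- The component of `S_{j-1} ∩ S_j` lying between the directions `e^{i(j-1)π/k}` and
`e^{ijπ/k}`. -/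
def petalInter (k : ℕ) (b : ℂ) (R : ℝ) (j : ℤ) : Set ℂ :=
  petal k b R (j - 1) ∩ petal k b R j ∩
    {z | 0 < Complex.arg (rot k (j - 1) z) ∧ Complex.arg (rot k (j - 1) z) < π / k}

/-- `Ψ = φ_target ∘ φ_source⁻¹` as a germ at the end of index `j`, for `1 ≤ j ≤ k`. -/
def IsTransition (k : ℕ) (b : ℂ) (R : ℝ) (φ : ℤ → ℂ → ℂ) (j : ℤ) (Ψ : ℂ → ℂ) : Prop :=
  ∀ᶠ W in hornEnd j, ∃ z ∈ petalInter k b R j, φ (source j) z = W ∧ φ (target j) z = Ψ W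

/-- For `j > 0`: `Ψ W - W` is the sum of a Fourier series
`c + ∑_{n ≥ 1} a_n e^{2iπnW}` (`j` odd) or `c + ∑_{n ≥ 1} a_n e^{-2iπnW}` (`j` even). -/
def HasConstantTerm (j : ℤ) (Ψ : ℂ → ℂ) (c : ℂ) : Prop :=
  ∃ a : ℕ → ℂ, ∀ᶠ W in hornEnd j,
    HasSum (fun n : ℕ => a n * Complex.exp
      ((if Odd j then 1 else -1) * (2 * π * Complex.I * ((n : ℂ) + 1) * W))) (Ψ W - W - c)

/-- The constant terms `-iπb/k` (`j` odd) and `iπb/k` (`j` even) of normalized transition functions,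
for `1 ≤ j ≤ k`. -/
def normalConstant (k : ℕ) (b : ℂ) (j : ℤ) : ℂ :=
  (if Odd j then -1 else 1) * (Complex.I * π * b / k)

/-- `(Ψ_1, …, Ψ_k)` are normalized transition functions of `f`, computed in a coordinate in which
`f` is prenormalized. Only the indices `1 ≤ j ≤ k` of the family `Ψ` matter. -/
def IsNormalizedTransition (f : ℂ → ℂ) (k : ℕ) (b : ℂ) (Ψ : ℤ → ℂ → ℂ) : Prop :=
  ∃ h p : ℂ → ℂ, Conjugates h f p ∧ IsPrenormalized p k b ∧
    ∃ (R : ℝ) (φ : ℤ → ℂ → ℂ), 0 < R ∧ IsFatouCoordinates p k b R φ ∧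
      ∀ j ∈ Set.Icc (1 : ℤ) k,
        IsTransition k b R φ j (Ψ j) ∧ HasConstantTerm j (Ψ j) (normalConstant k b j)

/-- The function `Ψ_{-j} = Σ ∘ T_{1/2} ∘ Ψ_j ∘ Σ ∘ T_{-1/2}` determined by `Ψ_j`. -/
def opposite (Ψ : ℂ → ℂ) : ℂ → ℂ := Sig ∘ T (1 / 2) ∘ Ψ ∘ Sig ∘ T (-(1 / 2))

/-- Equivalence by a common real translation. -/
def TranslationRel (k : ℕ) (Ψ Ψ' : ℤ → ℂ → ℂ) : Prop :=
  ∃ C : ℝ, ∀ j ∈ Set.Icc (1 : ℤ) k, Ψ j =ᶠ[hornEnd j] T C ∘ Ψ' j ∘ T (-(C : ℂ))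

/-- The additional identification in even codimension, coming from `z ↦ -z`. -/
def RotationRel (k : ℕ) (Ψ Ψ' : ℤ → ℂ → ℂ) : Prop :=
  ∀ j ∈ Set.Icc (1 : ℤ) k, Ψ' j =ᶠ[hornEnd j] opposite (Ψ (k - j + 1))

/-- The analytic invariant `[Ψ_1, …, Ψ_k]` of `f`: the set of all representatives. -/
def analyticInvariant (f : ℂ → ℂ) (k : ℕ) (b : ℂ) : Set (ℤ → ℂ → ℂ) :=
  {Ψ | ∃ Ψ₀, IsNormalizedTransition f k b Ψ₀ ∧
    Relation.EqvGen (fun Φ Φ' => TranslationRel k Φ Φ' ∨ (Even k ∧ RotationRel k Φ Φ')) Ψ₀ Ψ}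

/-! ### Real analytic curves and real coefficients -/

/-- A regular germ of real analytic (parametrized) curve at the origin. -/
structure IsRealAnalyticCurve (γ : ℝ → ℂ) : Prop where
  analytic : AnalyticAt ℝ γ 0
  map_zero : γ 0 = 0
  deriv_ne_zero : deriv γ 0 ≠ 0

/-- `f` preserves the germ of the curve `γ`. The filter `map γ (𝓝 0)` is generated by the images of
the neighbourhoods of `0`, so the equation says `f (Γ) = Γ` for the germ `Γ` of the image of `γ`. -/
def PreservesCurve (f : ℂ → ℂ) (γ : ℝ → ℂ) : Prop :=
  map f (map γ (𝓝 0)) = map γ (𝓝 0)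

/-- `γ` is tangent to the formal symmetry axis of `f`, the line fixed by the linear part
`v ↦ a₁ v̄` of `f`. -/
def TangentToSymmetryAxis (f : ℂ → ℂ) (γ : ℝ → ℂ) : Prop :=
  dbar f * conj (deriv γ 0) = deriv γ 0

/-- `p z = A₁ z̄ + A₂ z̄² + ⋯` is a convergent series in `z̄` with the real coefficients `A`. -/
def HasRealExpansion (p : ℂ → ℂ) (A : ℕ → ℝ) : Prop :=
  A 0 = 0 ∧ ∀ᶠ z in 𝓝 (0 : ℂ), HasSum (fun n : ℕ => (A n : ℂ) * conj z ^ n) (p z)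

end

end AntiParabolic

open Filter Topology Asymptotics
open scoped ComplexConjugate Real

namespace AntiParabolic
section

/-! ### Orders of vanishing at the origin -/

/-! All four statements express that `f` commutes with an antiholomorphic involution with the
correct linear part.

Statements 1 and 2. The complexified parametrization of an invariant curve is a coordinate in which
the curve is the real axis; there the germ is real on the axis, so its coefficients are real by the
identity theorem (`exists_realExpansion_of_curve`). Conversely a germ with real coefficients
preserves the real axis (`exists_curve_of_realExpansion`). Tangency to the symmetry axis corresponds
to `A 1 = 1`.

From 2 to 3. Pulled back to a coordinate where the germ is a prenormalized `p`, the conjugation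
becomes an antiholomorphic involution `τ` commuting with `p`. Comparison of jets shows that `τ`
agrees with the conjugation up to order `k` (`exists_symmetry`), hence exchanges `S_j` and `S_{-j}`.
Fatou coordinates are unique up to translation (`IsStandardFatou.exists_eq_add_const`), which forces
`τ` to act as `Σ` in them (`exists_symmetric`). Then `p ∘ τ` preserves every petal and acts as
`T_{1/2}` in every Fatou coordinate, so each `Ψ_j` commutes with `T_{1/2}`. This commutation is
invariant under the equivalence defining the modulus.

From 3 to 2. In each petal take the map which is `T_{-1/2}` in the Fatou coordinate. Commutation of
the `Ψ_j` makes these maps agree on intersections of petals, so they glue to a holomorphic germ `μ`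
commuting with `p`, with `μ ∘ μ` inverse to `p ∘ p` (`IsStandardFatou.exists_half_inverse`). Then `σ
= p ∘ μ` is an antiholomorphic involution commuting with `p`, and averaging the identity with `conj
∘ σ` gives a coordinate where `σ` is the conjugation and the germ is real.

Statements 3 and 4 are one equation evaluated at different points (`commutesWithHalf_iff_sig`).

The step from 3 to 2 needs a representative of the modulus to exist. This accounts for most of the
length: prenormalization by an analytic change of coordinate, which also shows that `b` is real
(`exists_prenormalization`), and Fatou coordinates asymptotic to the time charts, obtained as limits
of orbits (`exists_fatou_limit`, `exists_isStandardFatou`). The asymptotics make their transition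
functions normalized. -/

/-- `e z = O(z ^ n)` at the origin. -/
def OrderGE (n : ℕ) (e : ℂ → ℂ) : Prop := e =O[𝓝 (0 : ℂ)] fun z => z ^ n

namespace OrderGE

variable {n m l : ℕ} {e e' x y r : ℂ → ℂ}

theorem mono (h : OrderGE n e) (hmn : m ≤ n) : OrderGE m e := by
  refine IsBigO.trans h ?_
  obtain ⟨d, rfl⟩ := Nat.exists_eq_add_of_le hmn
  have h1 : (fun z : ℂ => z ^ d) =O[𝓝 (0 : ℂ)] fun _ => (1 : ℂ) := by
    have : ContinuousAt (fun z : ℂ => z ^ d) 0 := by fun_prop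
    exact this.isBigO_one ℂ
  simpa [pow_add] using (isBigO_refl (fun z : ℂ => z ^ m) (𝓝 0)).mul h1

theorem add (h : OrderGE n e) (h' : OrderGE n e') : OrderGE n fun z => e z + e' z := IsBigO.add h h'

theorem sub (h : OrderGE n e) (h' : OrderGE n e') : OrderGE n fun z => e z - e' z := IsBigO.sub h h'

theorem neg (h : OrderGE n e) : OrderGE n fun z => -e z := IsBigO.neg_left h

theorem mul (h : OrderGE n e) (h' : OrderGE m e') : OrderGE (n + m) fun z => e z * e' z := by
  simpa [OrderGE, pow_add] using IsBigO.mul h h'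

theorem const_mul (c : ℂ) (h : OrderGE n e) : OrderGE n fun z => c * e z := IsBigO.const_mul_left h c

theorem congr (h : OrderGE n e) (he : ∀ z, e z = e' z) : OrderGE n e' := by
  rwa [show e' = e from funext fun z => (he z).symm]

theorem congr_ev (h : OrderGE n e) (he : ∀ᶠ z in 𝓝 0, e z = e' z) : OrderGE n e' :=
  IsBigO.congr' h he .rfl

theorem pow_self (n : ℕ) : OrderGE n fun z => z ^ n := isBigO_refl _ _

theorem self : OrderGE 1 fun z => z := by simpa using pow_self 1

theorem zero_fun (n : ℕ) : OrderGE n fun _ => 0 := isBigO_zero _ _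

theorem pow (h : OrderGE n e) (m : ℕ) : OrderGE (n * m) fun z => e z ^ m := by
  simpa [OrderGE, pow_mul] using IsBigO.pow h m

theorem tendsto (h : OrderGE n e) (hn : 1 ≤ n) : Tendsto e (𝓝 0) (𝓝 0) := by
  have h1 : OrderGE 1 e := h.mono hn
  refine IsBigO.trans_tendsto h1 ?_
  have : ContinuousAt (fun z : ℂ => z ^ 1) 0 := by fun_prop
  simpa [ContinuousAt] using this

theorem eq_zero (h : OrderGE n e) (hn : 1 ≤ n) : e 0 = 0 := by
  have h1 : OrderGE 1 e := h.mono hn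
  exact IsBigO.eq_zero_imp h1 |>.self_of_nhds (by simp)

theorem comp (h : OrderGE n e) (hx : OrderGE 1 x) : OrderGE n fun z => e (x z) := by
  refine (IsBigO.comp_tendsto h (hx.tendsto le_rfl)).trans ?_
  simpa [Function.comp_def] using IsBigO.pow hx n

theorem star (h : OrderGE n e) : OrderGE n fun z => (starRingEnd ℂ) (e z) := by
  refine IsBigO.trans ?_ h
  exact IsBigO.of_bound 1 (by simp)

theorem comp_conj (h : OrderGE n e) : OrderGE n fun z => e (conj z) :=
  h.comp self.star

theorem of_analyticAt (h : AnalyticAt ℂ e 0) (h0 : e 0 = 0) : OrderGE 1 e := by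
  have := h.differentiableAt.isBigO_sub
  simpa [OrderGE, h0] using this

/-- Factorization of an analytic function by the power of `z` bounding it. -/
theorem exists_factor (hr : AnalyticAt ℂ r 0) (h : OrderGE n r) :
    ∃ g : ℂ → ℂ, AnalyticAt ℂ g 0 ∧ ∀ᶠ z in 𝓝 0, r z = z ^ n * g z := by
  induction n with
  | zero => exact ⟨r, hr, by simp⟩
  | succ n ih =>
    obtain ⟨g, hg, hrg⟩ := ih (h.mono (Nat.le_succ n))
    have hg0 : g 0 = 0 := by
      have h1 : g =O[𝓝[≠] (0 : ℂ)] fun z => z := by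
        have h2 : r =O[𝓝[≠] (0 : ℂ)] fun z => z ^ (n + 1) := IsBigO.mono h nhdsWithin_le_nhds
        have h3 : (fun z => (z ^ n)⁻¹ * r z) =O[𝓝[≠] (0 : ℂ)]
            fun z => (z ^ n)⁻¹ * z ^ (n + 1) := (isBigO_refl _ _).mul h2
        refine h3.congr' ?_ ?_
        · filter_upwards [hrg.filter_mono nhdsWithin_le_nhds, self_mem_nhdsWithin] with z hz hz0
          have : z ^ n ≠ 0 := pow_ne_zero _ hz0
          rw [hz]; field_simp
        · filter_upwards [self_mem_nhdsWithin] with z hz0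
          have : z ^ n ≠ 0 := pow_ne_zero _ hz0
          rw [pow_succ, inv_mul_cancel_left₀ this]
      have h2 : Tendsto g (𝓝[≠] 0) (𝓝 0) :=
        h1.trans_tendsto (tendsto_id.mono_left nhdsWithin_le_nhds)
      exact tendsto_nhds_unique (hg.continuousAt.tendsto.mono_left nhdsWithin_le_nhds) h2
    obtain ⟨p, hp⟩ := hg
    refine ⟨dslope g 0, ⟨_, hp.has_fpower_series_dslope_fslope⟩, ?_⟩
    filter_upwards [hrg] with z hz
    have := sub_smul_dslope g 0 z
    simp only [sub_zero, smul_eq_mul, hg0] at this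
    rw [hz, ← this]; ring

/-- The coefficient is the value at `0` of the quotient by `z ^ n`. With `monomial_eq_zero` this
drives the inductions on jets: one unknown coefficient appears in each degree, and an equation kills
it. -/
theorem exists_coeff (hr : AnalyticAt ℂ r 0) (h : OrderGE n r) :
    ∃ c : ℂ, OrderGE (n + 1) fun z => r z - c * z ^ n := by
  obtain ⟨g, hg, hrg⟩ := h.exists_factor hr
  refine ⟨g 0, ?_⟩
  have h1 : OrderGE 1 fun z => g z - g 0 :=
    of_analyticAt (hg.sub analyticAt_const) (by simp)
  refine ((pow_self n).mul h1).congr_ev ?_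
  filter_upwards [hrg] with z hz
  rw [hz]; ring

/-- The power cancels only away from the origin; the identity theorem restores the factorization at
`0`. -/
theorem of_mul_pow (hr : AnalyticAt ℂ r 0) (h : OrderGE (n + m) fun z => z ^ n * r z) :
    OrderGE m r := by
  obtain ⟨g, hg, hrg⟩ := h.exists_factor ((analyticAt_id.pow n).mul hr)
  have h1 : ∀ᶠ z in 𝓝[≠] 0, r z = z ^ m * g z := by
    filter_upwards [hrg.filter_mono nhdsWithin_le_nhds, self_mem_nhdsWithin] with z hz hz0
    have : z ^ n ≠ 0 := pow_ne_zero _ hz0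
    rw [pow_add, mul_assoc] at hz
    exact mul_left_cancel₀ this hz
  have h2 : ∀ᶠ z in 𝓝 0, r z = z ^ m * g z :=
    (hr.frequently_eq_iff_eventually_eq ((analyticAt_id.pow m).mul hg)).1 h1.frequently
  have h3 : OrderGE 0 g := by simpa [OrderGE] using hg.continuousAt.isBigO_one ℂ
  refine ((pow_self m).mul h3).congr_ev ?_
  filter_upwards [h2] with z hz using hz.symm

theorem monomial_eq_zero {c : ℂ} (h : OrderGE (n + 1) fun z => c * z ^ n) : c = 0 := by
  have : OrderGE 1 fun _ => c := by
    refine of_mul_pow (n := n) analyticAt_const (h.congr fun z => by ring)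
  exact this.eq_zero le_rfl

/-- An analytic function of order `n` is Lipschitz with a constant of order `n - 1`. -/
theorem comp_sub_comp (hr : AnalyticAt ℂ r 0) (h : OrderGE (n + 1) r) (hx : OrderGE 1 x)
    (hy : OrderGE 1 y) (hxy : OrderGE l fun z => x z - y z) :
    OrderGE (n + l) fun z => r (x z) - r (y z) := by
  obtain ⟨g, hg, hrg⟩ := h.exists_factor hr
  have hpow : ∀ m, OrderGE (m + l) fun z => x z ^ (m + 1) - y z ^ (m + 1) := by
    intro m
    induction m with
    | zero => simpa using hxy
    | succ m ih =>
      have h1 : OrderGE (1 + (m + l)) fun z => x z * (x z ^ (m + 1) - y z ^ (m + 1)) := hx.mul ih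
      have h2 : OrderGE (l + 1 * (m + 1)) fun z => (x z - y z) * y z ^ (m + 1) :=
        hxy.mul (hy.pow (m + 1))
      refine ((h1.mono (by omega)).add (h2.mono (by omega))).congr fun z => by ring
  have hgb : OrderGE 0 fun z => g (y z) := by
    have : Tendsto (fun z => g (y z)) (𝓝 0) (𝓝 (g 0)) := hg.continuousAt.tendsto.comp (hy.tendsto le_rfl)
    simpa [OrderGE] using this.isBigO_one ℂ
  have hgd : OrderGE l fun z => g (x z) - g (y z) := by
    have h1 := hg.hasStrictDerivAt.hasStrictFDerivAt.isBigO_sub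
    have h2 : Tendsto (fun z => (x z, y z)) (𝓝 0) (𝓝 (0, 0)) :=
      (hx.tendsto le_rfl).prodMk_nhds (hy.tendsto le_rfl)
    exact (h1.comp_tendsto h2).trans hxy
  have h1 := (hx.pow (n + 1)).mul hgd
  have h2 := (hpow n).mul hgb
  refine ((h1.mono (by omega)).add (h2.mono (by omega))).congr_ev ?_
  filter_upwards [(hx.tendsto le_rfl).eventually hrg, (hy.tendsto le_rfl).eventually hrg] with z h1 h2
  rw [h1, h2]; ring

/-- The binomial remainder is quadratic in `e`, of order `m - 2 + 2 * l`, and `2 ≤ l` makes this at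
least `m + l`. The truncated exponent at `m = 0` is harmless because its factor `m` vanishes. -/
theorem add_pow_sub (he : OrderGE l e) (hl : 2 ≤ l) (m : ℕ) :
    OrderGE (m + l) fun z => (z + e z) ^ m - z ^ m - m * z ^ (m - 1) * e z := by
  induction m with
  | zero => simpa using zero_fun _
  | succ m ih =>
    have h1 := self.mul ih
    have h2 := he.mul ih
    have h3 : OrderGE (m + 1 + l) fun z => (m : ℂ) * z ^ (m - 1) * (e z * e z) := by
      rcases m with _ | m
      · simpa using zero_fun _
      · have := ((pow_self m).mul (he.mul he)).const_mul ((m + 1 : ℕ) : ℂ)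
        refine (this.mono (by omega)).congr fun z => by simp; ring
    have h4 := (((h1.mono (show m + 1 + l ≤ _ by omega)).add (h2.mono (by omega))).add h3)
    refine h4.congr fun z => ?_
    rcases m with _ | m
    · simp
    · simp only [Nat.cast_add, Nat.cast_one, Nat.add_sub_cancel]; ring

/-- Variant of `add_pow_sub` for the difference only. -/
theorem add_pow_sub_pow (he : OrderGE l e) (hl : 2 ≤ l) (m : ℕ) :
    OrderGE (m + l) fun z => (z + e z) ^ (m + 1) - z ^ (m + 1) := by
  have h1 := add_pow_sub he hl (m + 1)
  have h2 := ((pow_self m).mul he).const_mul ((m + 1 : ℕ) : ℂ)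
  refine ((h1.mono (by omega)).add h2).congr fun z => ?_
  simp only [Nat.add_sub_cancel]; ring

end OrderGE

/-! ### Jets of conjugated parabolic germs -/

section Jets

variable {k m : ℕ} {c γ₁ γ₂ γ : ℂ} {r t g g₁ g₂ P : ℂ → ℂ}

/-- Failure of commutation of `z + c z^m + ⋯` with prenormalized germs, to first order. -/
theorem orderGE_conjugation_defect (hm : 2 ≤ m) (hmk : m ≤ k + 1)
    (hr : AnalyticAt ℂ r 0) (hrc : OrderGE (m + 1) fun z => r z - c * z ^ m)
    (hg : OrderGE (2 * k + 2) fun z => g z - (z + z ^ (k + 1) + γ₁ * z ^ (2 * k + 1))) :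
    OrderGE (m + k + 1) fun z => (g z + r (g z)) -
      ((z + r z) + (z + r z) ^ (k + 1) + γ₂ * (z + r z) ^ (2 * k + 1))
      - (c * ((m : ℂ) - (k + 1)) * z ^ (m + k) + (γ₁ - γ₂) * z ^ (2 * k + 1)) := by
  have hrm : OrderGE m r := ((hrc.mono (Nat.le_succ m)).add
    ((OrderGE.pow_self m).const_mul c)).congr fun z => by ring
  have hq : OrderGE (k + 1) fun z => g z - z := by
    refine (((hg.mono (by omega)).add (OrderGE.pow_self (k + 1))).add
      (((OrderGE.pow_self (2 * k + 1)).const_mul γ₁).mono (by omega))).congr fun z => by ring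
  have hq' : OrderGE (2 * k + 1) fun z => g z - z - z ^ (k + 1) := by
    refine ((hg.mono (by omega)).add
      (((OrderGE.pow_self (2 * k + 1)).const_mul γ₁).mono (by omega))).congr fun z => by ring
  have hg1 : OrderGE 1 g := ((hq.mono (by omega)).add OrderGE.self).congr fun z => by ring
  -- the term `r (g z)`
  have hr2 : AnalyticAt ℂ (fun z => r z - c * z ^ m) 0 :=
    hr.sub (analyticAt_const.mul (analyticAt_id.pow m))
  have e1 : OrderGE (m + (k + 1)) fun z => (r (g z) - c * g z ^ m) - (r z - c * z ^ m) :=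
    OrderGE.comp_sub_comp hr2 hrc hg1 OrderGE.self hq
  have hk1 : k = 0 ∨ 1 ≤ k := by omega
  have hk : 1 ≤ k := by omega
  have e2 : OrderGE (m + (k + 1)) fun z => g z ^ m - z ^ m - m * z ^ (m - 1) * (g z - z) := by
    refine (OrderGE.add_pow_sub hq (by omega) m).congr fun z => by ring
  have e3 : OrderGE (m + k + 1) fun z => z ^ (m - 1) * (g z - z) - z ^ (m + k) := by
    refine (((OrderGE.pow_self (m - 1)).mul hq').mono (by omega)).congr fun z => ?_
    obtain ⟨m, rfl⟩ : ∃ m', m = m' + 1 := ⟨m - 1, by omega⟩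
    simp only [Nat.add_sub_cancel]; ring
  -- the powers of `z + r z`
  have e4 : OrderGE (k + 1 + m) fun z => (z + r z) ^ (k + 1) - z ^ (k + 1)
      - ((k + 1 : ℕ) : ℂ) * z ^ k * r z := by
    simpa using OrderGE.add_pow_sub hrm hm (k + 1)
  have e5 : OrderGE (k + (m + 1)) fun z => z ^ k * (r z - c * z ^ m) :=
    (OrderGE.pow_self k).mul hrc
  have e6 : OrderGE (2 * k + m) fun z => (z + r z) ^ (2 * k + 1) - z ^ (2 * k + 1) :=
    OrderGE.add_pow_sub_pow hrm hm (2 * k)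
  -- In degree `m + k` the factor `m` comes from moving `c z ^ m` by `z ^ (k + 1)`, and the factor
  -- `k + 1` from moving `z ^ (k + 1)` by `c z ^ m`; they cancel exactly when `m = k + 1`.
  have := (((((hg.mono (show m + k + 1 ≤ _ by omega)).add (e1.mono (by omega))).add
    ((e2.const_mul c).mono (by omega))).add (e3.const_mul (c * m))).sub
    (((e4.mono (by omega)).add ((e5.const_mul (k + 1)).mono (by omega))).add
      ((e6.const_mul γ₂).mono (by omega))))
  refine this.congr fun z => ?_
  push_cast
  ring

theorem OrderGE.analyticAt_sub_id (ht : AnalyticAt ℂ t 0) : AnalyticAt ℂ (fun z => t z - z) 0 :=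
  ht.sub analyticAt_id

/-- A germ tangent to the identity which conjugates two prenormalized germs agrees with the
identity up to order `k`, and the formal invariants agree. -/
theorem conjugation_of_prenormalized (hk : 1 ≤ k) (ht : AnalyticAt ℂ t 0)
    (ht1 : OrderGE 2 fun z => t z - z)
    (hg₁ : OrderGE (2 * k + 2) fun z => g₁ z - (z + z ^ (k + 1) + γ₁ * z ^ (2 * k + 1)))
    (hg₂ : OrderGE (2 * k + 2) fun z => g₂ z - (z + z ^ (k + 1) + γ₂ * z ^ (2 * k + 1)))
    (h : OrderGE (2 * k + 2) fun z => t (g₁ z) - g₂ (t z)) :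
    OrderGE (k + 1) (fun z => t z - z) ∧ γ₁ = γ₂ := by
  have hr := OrderGE.analyticAt_sub_id ht
  have ht0 : OrderGE 1 t := ((ht1.mono (by omega)).add OrderGE.self).congr fun z => by ring
  have key : ∀ m, 2 ≤ m → m ≤ k + 1 → ∀ c, OrderGE (m + 1) (fun z => t z - z - c * z ^ m) →
      OrderGE (m + k + 1) fun z =>
        (c * ((m : ℂ) - (k + 1)) * z ^ (m + k) + (γ₁ - γ₂) * z ^ (2 * k + 1)) := by
    intro m hm hmk c hc
    have h1 := orderGE_conjugation_defect (γ₂ := γ₂) hm hmk hr hc hg₁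
    have h2 := hg₂.comp ht0
    refine (((h.mono (by omega)).add (h2.mono (by omega))).sub h1).congr fun z => ?_
    ring
  have step : ∀ m, m + 2 ≤ k + 1 → OrderGE (m + 2) (fun z => t z - z) := by
    intro m
    induction m with
    | zero => intro _; exact ht1
    | succ m ih =>
      intro hm
      obtain ⟨c, hc⟩ := (ih (by omega)).exists_coeff hr
      have h1 := key (m + 2) (by omega) (by omega) c hc
      have h2 : OrderGE (m + 2 + k + 1) fun z => (c * (((m + 2 : ℕ) : ℂ) - (k + 1))) * z ^ (m + 2 + k) := by
        refine (h1.sub (((OrderGE.pow_self (2 * k + 1)).const_mul (γ₁ - γ₂)).mono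
          (by omega))).congr fun z => by ring
      have h3 := h2.monomial_eq_zero
      have h4 : ((m + 2 : ℕ) : ℂ) - (k + 1) ≠ 0 := by
        rw [sub_ne_zero]; norm_cast; omega
      obtain rfl : c = 0 := (mul_eq_zero.1 h3).resolve_right h4
      exact hc.congr fun z => by ring
  have hfin : OrderGE (k + 1) (fun z => t z - z) := by
    simpa [show k - 1 + 2 = k + 1 by omega] using step (k - 1) (by omega)
  refine ⟨hfin, ?_⟩
  -- At `m = k + 1` the factor in front of `c` vanishes: this coefficient stays free, and what is
  -- left in degree `2 * k + 1` is the difference of the invariants.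
  obtain ⟨c, hc⟩ := hfin.exists_coeff hr
  have h1 := key (k + 1) (by omega) le_rfl c hc
  have h2 : OrderGE (2 * k + 1 + 1) fun z => (γ₁ - γ₂) * z ^ (2 * k + 1) :=
    (h1.mono (by omega)).congr fun z => by push_cast; ring
  exact sub_eq_zero.1 h2.monomial_eq_zero

/-- Conjugation by a germ equal to the identity up to order `k` preserves prenormalized jets. -/
theorem prenormalized_of_conjugation (hk : 1 ≤ k) (ht : AnalyticAt ℂ t 0)
    (ht1 : OrderGE (k + 1) fun z => t z - z)
    (hg : OrderGE (2 * k + 2) fun z => g z - (z + z ^ (k + 1) + γ * z ^ (2 * k + 1))) :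
    OrderGE (2 * k + 2) fun z => t (g z) - (t z + t z ^ (k + 1) + γ * t z ^ (2 * k + 1)) := by
  have hr := OrderGE.analyticAt_sub_id ht
  obtain ⟨c, hc⟩ := ht1.exists_coeff hr
  have := orderGE_conjugation_defect (γ₂ := γ) (by omega) le_rfl hr hc hg
  refine (this.mono (by omega)).congr fun z => ?_
  push_cast
  ring

/-- Comparison of the terms of degree `k + 1` on both sides of the conjugacy equation. It determines
the `k`-th power of the multiplier of a normalizing coordinate, and later forces `A 1 = 1` in odd
codimension. -/
theorem leading_coeff_of_conjugation {lam a₁ a₂ : ℂ} (hk : 1 ≤ k) (ht : AnalyticAt ℂ t 0)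
    (ht1 : OrderGE 2 fun z => t z - lam * z)
    (hg₁ : OrderGE (k + 2) fun z => g₁ z - (z + a₁ * z ^ (k + 1)))
    (hg₂ : OrderGE (k + 2) fun z => g₂ z - (z + a₂ * z ^ (k + 1)))
    (h : OrderGE (k + 2) fun z => t (g₁ z) - g₂ (t z)) :
    lam * a₁ = a₂ * lam ^ (k + 1) := by
  have hr : AnalyticAt ℂ (fun z => t z - lam * z) 0 := ht.sub (analyticAt_const.mul analyticAt_id)
  have hq : OrderGE (k + 1) fun z => g₁ z - z :=
    ((hg₁.mono (by omega)).add ((OrderGE.pow_self (k + 1)).const_mul a₁)).congr fun z => by ring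
  have hg1 : OrderGE 1 g₁ := ((hq.mono (by omega)).add OrderGE.self).congr fun z => by ring
  have ht0 : OrderGE 1 t := ((ht1.mono (by omega)).add (OrderGE.self.const_mul lam)).congr
    fun z => by ring
  have e1 := OrderGE.comp_sub_comp (n := 1) hr ht1 hg1 OrderGE.self hq
  have e2 := hg₂.comp ht0
  have hpw : AnalyticAt ℂ (fun z : ℂ => z ^ (k + 1)) 0 := analyticAt_id.pow (k + 1)
  have e3 := OrderGE.comp_sub_comp (n := k) hpw (OrderGE.pow_self (k + 1)) ht0
    (OrderGE.self.const_mul lam) ht1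
  have : OrderGE (k + 1 + 1) fun z => (lam * a₁ - a₂ * lam ^ (k + 1)) * z ^ (k + 1) := by
    refine (((h.mono (by omega)).sub ((hg₁.const_mul lam).add ((e1.mono (by omega)).sub
      (e2.add (e3.const_mul a₂)))))).congr fun z => ?_
    ring
  exact sub_eq_zero.1 this.monomial_eq_zero

/-- The polynomial `z + z^(k+1)/2 + ((k+1)/8 - b/2) z^(2k+1)`. -/
noncomputable def normalJet (k : ℕ) (b : ℂ) (z : ℂ) : ℂ :=
  z + 1 / 2 * z ^ (k + 1) + (((k : ℂ) + 1) / 8 - b / 2) * z ^ (2 * k + 1)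

theorem analyticAt_normalJet (k : ℕ) (b : ℂ) (z : ℂ) : AnalyticAt ℂ (normalJet k b) z := by
  unfold normalJet; fun_prop

theorem orderGE_normalJet_sub_id (k : ℕ) (b : ℂ) :
    OrderGE (k + 1) fun z => normalJet k b z - z := by
  refine (((OrderGE.pow_self (k + 1)).const_mul (1 / 2)).add (((OrderGE.pow_self (2 * k + 1)).const_mul
    (((k : ℂ) + 1) / 8 - b / 2)).mono (by omega))).congr fun z => by simp only [normalJet]; ring

/-- In degree `2 * k + 1` the coefficient `(k+1)/8 - b/2` counts twice, and the cross term of `z ^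
(k + 1) / 2` with itself adds `(k+1)/4`. -/
theorem normalJet_comp_self (hk : 1 ≤ k) (b : ℂ) :
    OrderGE (2 * k + 2) fun z => normalJet k b (normalJet k b z) -
      (z + z ^ (k + 1) + (((k : ℂ) + 1) / 2 - b) * z ^ (2 * k + 1)) := by
  have hq := orderGE_normalJet_sub_id k b
  have hq' : OrderGE (2 * k + 1) fun z => normalJet k b z - z - 1 / 2 * z ^ (k + 1) :=
    ((OrderGE.pow_self (2 * k + 1)).const_mul (((k : ℂ) + 1) / 8 - b / 2)).congr fun z => by
      simp only [normalJet]; ring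
  have e1 := OrderGE.add_pow_sub hq (by omega) (k + 1)
  have e2 := OrderGE.add_pow_sub_pow hq (by omega) (2 * k)
  have e3 := (OrderGE.pow_self k).mul hq'
  refine ((((e1.mono (show 2 * k + 2 ≤ _ by omega)).const_mul (1 / 2)).add
    ((e2.mono (by omega)).const_mul (((k : ℂ) + 1) / 8 - b / 2))).add
    ((e3.mono (by omega)).const_mul (((k : ℂ) + 1) / 2))).congr fun z => ?_
  have h : z + (normalJet k b z - z) = normalJet k b z := by ring
  simp only [h, Nat.add_sub_cancel]
  conv_rhs => rw [show normalJet k b (normalJet k b z) = normalJet k b z +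
    1 / 2 * normalJet k b z ^ (k + 1) + (((k : ℂ) + 1) / 8 - b / 2) *
    normalJet k b z ^ (2 * k + 1) from rfl]
  generalize normalJet k b z ^ (k + 1) = A
  generalize normalJet k b z ^ (2 * k + 1) = B
  simp only [normalJet]
  push_cast
  ring

/-- The square root of a prenormalized germ is determined up to order `2k+1`. -/
theorem jet_of_square (hk : 1 ≤ k) (b : ℂ) (hP : AnalyticAt ℂ P 0)
    (hP1 : OrderGE 2 fun z => P z - z)
    (hPP : OrderGE (2 * k + 2) fun z => P (P z) -
      (z + z ^ (k + 1) + (((k : ℂ) + 1) / 2 - b) * z ^ (2 * k + 1))) :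
    OrderGE (2 * k + 2) fun z => P z - normalJet k b z := by
  have hN := orderGE_normalJet_sub_id k b
  have hNa := (analyticAt_normalJet k b 0).sub analyticAt_id
  have hN1 : OrderGE 1 (normalJet k b) :=
    ((hN.mono (by omega)).add OrderGE.self).congr fun z => by ring
  have hP0 : OrderGE 1 P := ((hP1.mono (by omega)).add OrderGE.self).congr fun z => by ring
  have ha : AnalyticAt ℂ (fun z => P z - normalJet k b z) 0 := hP.sub (analyticAt_normalJet k b 0)
  have step : ∀ m, m + 2 ≤ 2 * k + 2 → OrderGE (m + 2) fun z => P z - normalJet k b z := by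
    intro m
    induction m with
    | zero =>
      intro _
      exact (hP1.sub (hN.mono (by omega))).congr fun z => by ring
    | succ m ih =>
      intro hm
      have h0 := ih (by omega)
      obtain ⟨c, hc⟩ := h0.exists_coeff ha
      -- `P (P z) = N (P z) + e (P z)`
      have e1 := OrderGE.comp_sub_comp (n := m + 1) ha h0 hP0 OrderGE.self hP1
      have e2 := OrderGE.comp_sub_comp (n := k) hNa hN hP0 hN1 h0
      have e3 := normalJet_comp_self hk b
      -- The defect `c z ^ (m + 2)` enters `P ∘ P` once through the outer and once through the inner
      -- factor, so it is seen doubled and must vanish.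
      have : OrderGE (m + 2 + 1) fun z => (2 * c) * z ^ (m + 2) := by
        refine ((((hPP.mono (by omega)).sub (e3.mono (by omega))).sub ((e1.mono (by omega)).add
          (e2.mono (by omega)))).sub (hc.const_mul 2)).congr fun z => ?_
        simp only [Pi.sub_apply, id_eq]
        ring
      obtain rfl : c = 0 := by simpa using this.monomial_eq_zero
      exact hc.congr fun z => by ring
  simpa using step (2 * k) le_rfl

end Jets

end
end AntiParabolic

namespace AntiParabolic
section

/-! ### Germs and their inverses -/

variable {f h p e t F : ℂ → ℂ} {n : ℕ} {c : ℂ}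

/-- For an analytic germ the order is an integer, so `o` of one power is `O` of the next. This turns
the prenormal forms into statements about `OrderGE (2 * k + 2)`. -/
theorem OrderGE.of_isLittleO (he : AnalyticAt ℂ e 0) (h : e =o[𝓝 0] fun z => z ^ n) :
    OrderGE (n + 1) e := by
  obtain ⟨c, hc⟩ := OrderGE.exists_coeff he (show OrderGE n e from h.isBigO)
  have h1 : (fun z : ℂ => c * z ^ n) =o[𝓝 0] fun z => z ^ n := by
    have h2 : (fun z => e z - c * z ^ n) =o[𝓝 0] fun z => z ^ n := by
      refine IsBigO.trans_isLittleO hc ?_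
      simp only [pow_succ]
      simpa using (isBigO_refl (fun z : ℂ => z ^ n) (𝓝 0)).mul_isLittleO
        ((isLittleO_one_iff ℂ).2 (tendsto_id (α := ℂ) (x := 𝓝 0)))
    simpa using h.sub h2
  have h0 : c = 0 := by
    by_contra hc0
    have h2 : (fun z : ℂ => z ^ n) =o[𝓝[≠] (0 : ℂ)] fun z => z ^ n :=
      ((isLittleO_const_mul_left_iff hc0).1 h1).mono nhdsWithin_le_nhds
    refine isLittleO_irrefl ?_ h2
    refine Eventually.frequently ?_
    filter_upwards [self_mem_nhdsWithin] with z hz using pow_ne_zero _ hz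
  simpa [h0] using hc

theorem OrderGE.isLittleO (h : OrderGE (n + 1) e) : e =o[𝓝 0] fun z => z ^ n := by
  refine IsBigO.trans_isLittleO h ?_
  simp only [pow_succ]
  simpa using (isBigO_refl (fun z : ℂ => z ^ n) (𝓝 0)).mul_isLittleO
    ((isLittleO_one_iff ℂ).2 (tendsto_id (α := ℂ) (x := 𝓝 0)))

theorem OrderGE.of_hasDerivAt (ht : AnalyticAt ℂ t 0) (h0 : t 0 = 0) (hd : HasDerivAt t c 0) :
    OrderGE 2 fun z => t z - c * z := by
  refine OrderGE.of_isLittleO (n := 1) (ht.sub (analyticAt_const.mul analyticAt_id)) ?_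
  have := hasDerivAt_iff_isLittleO.1 hd
  simpa [h0, mul_comm] using this

theorem OrderGE.hasDerivAt (h : OrderGE 2 fun z => t z - c * z) : HasDerivAt t c 0 := by
  have h0 : t 0 = 0 := by simpa using h.eq_zero (by norm_num)
  have := OrderGE.isLittleO (n := 1) h
  rw [hasDerivAt_iff_isLittleO]
  simpa [h0, mul_comm] using this

/-- The germ with conjugate coefficients. -/
def conjGerm (F : ℂ → ℂ) (z : ℂ) : ℂ := conj (F (conj z))

theorem tendsto_conj_zero : Tendsto (fun z : ℂ => conj z) (𝓝 0) (𝓝 0) := by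
  simpa using Complex.continuous_conj.tendsto 0

theorem eventually_conj {q : ℂ → Prop} (hq : ∀ᶠ z in 𝓝 0, q z) : ∀ᶠ z in 𝓝 0, q (conj z) :=
  tendsto_conj_zero.eventually hq

theorem analyticAt_conjGerm (hF : AnalyticAt ℂ F 0) : AnalyticAt ℂ (conjGerm F) 0 := by
  rw [Complex.analyticAt_iff_eventually_differentiableAt] at hF ⊢
  filter_upwards [eventually_conj hF] with z hz
  have := hz.conj_conj
  simpa [conjGerm, Function.comp_def] using! this

theorem hasDerivAt_conjGerm (hF : HasDerivAt F c 0) : HasDerivAt (conjGerm F) (conj c) 0 := by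
  have := HasDerivAt.conj_conj (x := (0 : ℂ)) (f := F) (f' := c) (by simpa using hF)
  simpa [conjGerm, Function.comp_def] using! this

theorem OrderGE.conjGerm (h : OrderGE n e) : OrderGE n (conjGerm e) := h.comp_conj.star

namespace IsBiholomorphicGerm

theorem orderGE (hh : IsBiholomorphicGerm h) : OrderGE 1 h :=
  OrderGE.of_analyticAt hh.analytic hh.map_zero

theorem tendsto (hh : IsBiholomorphicGerm h) : Tendsto h (𝓝 0) (𝓝 0) := hh.orderGE.tendsto le_rfl

theorem hasDerivAt (hh : IsBiholomorphicGerm h) : HasDerivAt h (deriv h 0) 0 :=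
  hh.analytic.differentiableAt.hasDerivAt

theorem of_hasDerivAt (ha : AnalyticAt ℂ h 0) (h0 : h 0 = 0) (hd : HasDerivAt h c 0) (hc : c ≠ 0) :
    IsBiholomorphicGerm h := ⟨ha, h0, by rwa [hd.deriv]⟩

theorem exists_inverse (hh : IsBiholomorphicGerm h) :
    ∃ h' : ℂ → ℂ, IsBiholomorphicGerm h' ∧ HasDerivAt h' (deriv h 0)⁻¹ 0 ∧
      (∀ᶠ z in 𝓝 0, h' (h z) = z) ∧ ∀ᶠ z in 𝓝 0, h (h' z) = z := by
  have hs := hh.analytic.hasStrictDerivAt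
  have h1 := hh.analytic.analyticAt_localInverse hh.deriv_ne_zero
  have h2 := hs.eventually_left_inverse hh.deriv_ne_zero
  have h3 := hs.eventually_right_inverse hh.deriv_ne_zero
  have h4 := (hs.to_localInverse hh.deriv_ne_zero).hasDerivAt
  rw [hh.map_zero] at h1 h3 h4
  refine ⟨_, of_hasDerivAt h1 ?_ h4 (inv_ne_zero hh.deriv_ne_zero), h4, h2, h3⟩
  have := h2.self_of_nhds
  rwa [hh.map_zero] at this

theorem comp (hh : IsBiholomorphicGerm h) (ht : IsBiholomorphicGerm t) :
    IsBiholomorphicGerm fun z => h (t z) := by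
  have h0 : HasDerivAt h (deriv h 0) (t 0) := by rw [ht.map_zero]; exact hh.hasDerivAt
  refine of_hasDerivAt (AnalyticAt.fun_comp (by rw [ht.map_zero]; exact hh.analytic) ht.analytic)
    (by rw [ht.map_zero, hh.map_zero]) (h0.comp 0 ht.hasDerivAt)
    (mul_ne_zero hh.deriv_ne_zero ht.deriv_ne_zero)

end IsBiholomorphicGerm

theorem analyticAt_comp_zero (hF : AnalyticAt ℂ F 0) (ht : AnalyticAt ℂ t 0) (h0 : t 0 = 0) :
    AnalyticAt ℂ (fun z => F (t z)) 0 := AnalyticAt.fun_comp (by rwa [h0]) ht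

theorem hasDerivAt_comp_zero {d : ℂ} (hF : HasDerivAt F c 0) (ht : HasDerivAt t d 0) (h0 : t 0 = 0) :
    HasDerivAt (fun z => F (t z)) (c * d) 0 := by
  have hF' : HasDerivAt F c (t 0) := by rwa [h0]
  exact hF'.comp 0 ht

namespace IsAntiholomorphicGerm

theorem orderGE (hf : IsAntiholomorphicGerm f) : OrderGE 1 f := by
  have : OrderGE 1 fun z => f (conj z) := OrderGE.of_analyticAt hf.2 (by simp [hf.1])
  simpa using this.comp_conj

theorem tendsto (hf : IsAntiholomorphicGerm f) : Tendsto f (𝓝 0) (𝓝 0) := hf.orderGE.tendsto le_rfl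

theorem hasDerivAt (hf : IsAntiholomorphicGerm f) : HasDerivAt (fun z => f (conj z)) (dbar f) 0 :=
  hf.2.differentiableAt.hasDerivAt

theorem comp_holomorphic (hf : IsAntiholomorphicGerm f) (ht : AnalyticAt ℂ t 0) (h0 : t 0 = 0) :
    IsAntiholomorphicGerm fun z => f (t z) := by
  refine ⟨by simp [h0, hf.1], ?_⟩
  have := analyticAt_comp_zero hf.2 (analyticAt_conjGerm ht) (by simp [conjGerm, h0])
  simpa [conjGerm] using this

theorem holomorphic_comp (hf : IsAntiholomorphicGerm f) (ht : AnalyticAt ℂ t 0) (h0 : t 0 = 0) :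
    IsAntiholomorphicGerm fun z => t (f z) :=
  ⟨by simp [hf.1, h0], analyticAt_comp_zero ht hf.2 (by simp [hf.1])⟩

theorem comp (hf : IsAntiholomorphicGerm f) (hp : IsAntiholomorphicGerm p) :
    AnalyticAt ℂ (fun z => f (p z)) 0 := by
  have := analyticAt_comp_zero hf.2 (analyticAt_conjGerm hp.2) (by simp [conjGerm, hp.1])
  simpa [conjGerm] using this

/-- The holomorphic germ `conj ∘ f`. -/
theorem analyticAt_conj (hf : IsAntiholomorphicGerm f) : AnalyticAt ℂ (fun z => conj (f z)) 0 := by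
  have := analyticAt_conjGerm hf.2
  unfold conjGerm at this
  simpa using this

end IsAntiholomorphicGerm

theorem isAntiholomorphicGerm_conj : IsAntiholomorphicGerm fun z => conj z :=
  ⟨by simp, by simpa using! analyticAt_id⟩

theorem Conjugates.trans {h₁ h₂ f₁ f₂ f₃ : ℂ → ℂ} (H₁ : Conjugates h₁ f₁ f₂)
    (H₂ : Conjugates h₂ f₂ f₃) : Conjugates (fun z => h₂ (h₁ z)) f₁ f₃ := by
  refine ⟨H₂.1.comp H₁.1, ?_⟩
  filter_upwards [H₁.2, H₁.1.tendsto.eventually H₂.2] with z h1 h2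
  rw [h1, h2]

theorem Conjugates.symm_of_inverse {h' : ℂ → ℂ} (H : Conjugates h f p)
    (hf : Tendsto f (𝓝 0) (𝓝 0)) (hh' : IsBiholomorphicGerm h')
    (hl : ∀ᶠ z in 𝓝 0, h' (h z) = z) (hr : ∀ᶠ z in 𝓝 0, h (h' z) = z) : Conjugates h' p f := by
  refine ⟨hh', ?_⟩
  filter_upwards [hh'.tendsto.eventually H.2, hr,
    (hf.comp hh'.tendsto).eventually hl] with z h1 h2 h3
  rw [h2] at h1
  rw [← h1]
  exact h3

theorem Conjugates.of_inverse {h' : ℂ → ℂ} (hh : IsBiholomorphicGerm h)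
    (hl : ∀ᶠ z in 𝓝 0, h' (h z) = z) : Conjugates h f fun z => h (f (h' z)) :=
  ⟨hh, by filter_upwards [hl] with z hz; rw [hz]⟩

theorem eventually_of_comp {h' : ℂ → ℂ} {q : ℂ → Prop} (hh' : IsBiholomorphicGerm h')
    (hr : ∀ᶠ z in 𝓝 0, h (h' z) = z) (hq : ∀ᶠ z in 𝓝 0, q (h z)) : ∀ᶠ z in 𝓝 0, q z := by
  filter_upwards [hh'.tendsto.eventually hq, hr] with z h1 h2
  rwa [h2] at h1

theorem OrderGE.of_comp {h' : ℂ → ℂ} (hh' : IsBiholomorphicGerm h')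
    (hr : ∀ᶠ z in 𝓝 0, h (h' z) = z) (hq : OrderGE n fun z => e (h z)) : OrderGE n e :=
  (hq.comp hh'.orderGE).congr_ev (by filter_upwards [hr] with z hz; rw [hz])

theorem isPrenormalized_iff {k : ℕ} {b : ℂ} : IsPrenormalized p k b ↔ IsAntiholomorphicGerm p ∧
    OrderGE (2 * k + 2) fun z => p (conj z) - normalJet k b z := by
  refine and_congr_right fun hp => ⟨fun h => ?_, fun h => ?_⟩
  · refine OrderGE.of_isLittleO (n := 2 * k + 1) (hp.2.sub (analyticAt_normalJet k b 0)) ?_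
    have h1 := h.comp_tendsto tendsto_conj_zero
    refine IsLittleO.trans_isBigO (h1.congr_left fun z => ?_) (IsBigO.of_bound 1 (by simp))
    simp [normalJet]
  · have h1 := (OrderGE.isLittleO (n := 2 * k + 1) h).comp_tendsto tendsto_conj_zero
    refine IsLittleO.trans_isBigO (h1.congr_left fun z => ?_) (IsBigO.of_bound 1 (by simp))
    simp [normalJet]

theorem isHolPrenormalized_iff {k : ℕ} {b : ℂ} : IsHolPrenormalized p k b ↔ AnalyticAt ℂ p 0 ∧
    OrderGE (2 * k + 2) fun z =>
      p z - (z + z ^ (k + 1) + (((k : ℂ) + 1) / 2 - b) * z ^ (2 * k + 1)) := by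
  refine and_congr_right fun hp => ⟨fun h => ?_, fun h => ?_⟩
  · exact OrderGE.of_isLittleO (n := 2 * k + 1) (hp.sub (by fun_prop)) h
  · exact OrderGE.isLittleO (n := 2 * k + 1) h

/-! ### Jets of formal conjugations -/

open PowerSeries in
/-- `F` has the power series `G` as Taylor series up to order `N`. -/
def HasJet (N : ℕ) (F : ℂ → ℂ) (G : PowerSeries ℂ) : Prop :=
  ∃ P : Polynomial ℂ, (X : PowerSeries ℂ) ^ N ∣ (P : PowerSeries ℂ) - G ∧
    OrderGE N fun z => F z - P.eval z

theorem orderGE_eval_of_dvd {N : ℕ} {P : Polynomial ℂ}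
    (hP : (PowerSeries.X : PowerSeries ℂ) ^ N ∣ (P : PowerSeries ℂ)) :
    OrderGE N fun z => P.eval z := by
  rw [PowerSeries.X_pow_dvd_iff] at hP
  have : (Polynomial.X : Polynomial ℂ) ^ N ∣ P := by
    rw [Polynomial.X_pow_dvd_iff]
    intro d hd
    simpa using hP d hd
  obtain ⟨Q, rfl⟩ := this
  have hQ : OrderGE 0 fun z => Q.eval z := by
    simpa [OrderGE] using (Q.continuous.continuousAt (x := (0 : ℂ))).isBigO_one ℂ
  exact ((OrderGE.pow_self N).mul hQ).congr fun z => by simp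

namespace HasJet

variable {N : ℕ} {F₁ F₂ : ℂ → ℂ} {G₁ G₂ : PowerSeries ℂ}

theorem mul (h₁ : HasJet N F₁ G₁) (h₂ : HasJet N F₂ G₂) :
    HasJet N (fun z => F₁ z * F₂ z) (G₁ * G₂) := by
  obtain ⟨P₁, hd₁, ho₁⟩ := h₁
  obtain ⟨P₂, hd₂, ho₂⟩ := h₂
  refine ⟨P₁ * P₂, ?_, ?_⟩
  · have : ((P₁ * P₂ : Polynomial ℂ) : PowerSeries ℂ) - G₁ * G₂ =
        (P₁ - G₁ : PowerSeries ℂ) * P₂ + G₁ * (P₂ - G₂) := by push_cast; ring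
    rw [this]
    exact dvd_add (hd₁.mul_right _) (hd₂.mul_left _)
  · have hb : ∀ P : Polynomial ℂ, OrderGE 0 fun z => P.eval z := fun P => by
      simpa [OrderGE] using (P.continuous.continuousAt (x := (0 : ℂ))).isBigO_one ℂ
    have h1 := ho₁.mul (hb P₂)
    have h2 := ho₂.mul (hb P₁)
    have h3 := ho₁.mul ho₂
    refine (((h1.mono (by omega)).add (h2.mono (by omega))).add (h3.mono (by omega))).congr
      fun z => ?_
    simp only [Polynomial.eval_mul]; ring

theorem add (h₁ : HasJet N F₁ G₁) (h₂ : HasJet N F₂ G₂) :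
    HasJet N (fun z => F₁ z + F₂ z) (G₁ + G₂) := by
  obtain ⟨P₁, hd₁, ho₁⟩ := h₁
  obtain ⟨P₂, hd₂, ho₂⟩ := h₂
  refine ⟨P₁ + P₂, ?_, ?_⟩
  · have : ((P₁ + P₂ : Polynomial ℂ) : PowerSeries ℂ) - (G₁ + G₂) =
        (P₁ - G₁ : PowerSeries ℂ) + (P₂ - G₂) := by push_cast; ring
    rw [this]
    exact dvd_add hd₁ hd₂
  · exact (ho₁.add ho₂).congr fun z => by simp only [Polynomial.eval_add]; ring

theorem const (c : ℂ) : HasJet N (fun _ => c) (PowerSeries.C c) :=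
  ⟨Polynomial.C c, by simp, by simpa using OrderGE.zero_fun N⟩

theorem pow (h₁ : HasJet N F₁ G₁) (d : ℕ) : HasJet N (fun z => F₁ z ^ d) (G₁ ^ d) := by
  induction d with
  | zero => simpa using const (N := N) 1
  | succ d ih => simpa [pow_succ] using ih.mul h₁

theorem congr_dvd (h₁ : HasJet N F₁ G₁) (h : (PowerSeries.X : PowerSeries ℂ) ^ N ∣ G₁ - G₂) :
    HasJet N F₁ G₂ := by
  obtain ⟨P, hd, ho⟩ := h₁
  exact ⟨P, by simpa using dvd_add hd h, ho⟩

theorem polynomial_comp (h₁ : HasJet N F₁ G₁) (Q : Polynomial ℂ) :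
    HasJet N (fun z => Q.eval (F₁ z)) (Polynomial.aeval G₁ Q) := by
  induction Q using Polynomial.induction_on' with
  | add P Q hP hQ => simpa using hP.add hQ
  | monomial d a =>
    have := (const (N := N) a).mul (h₁.pow d)
    simpa [Polynomial.aeval_monomial, PowerSeries.algebraMap_apply] using this

/-- Passage from a formal identity to an analytic estimate: the formal side enters only through
congruences modulo `X ^ N`. -/
theorem orderGE_sub (h₁ : HasJet N F₁ G₁) (h₂ : HasJet N F₂ G₁) :
    OrderGE N fun z => F₁ z - F₂ z := by
  obtain ⟨P₁, hd₁, ho₁⟩ := h₁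
  obtain ⟨P₂, hd₂, ho₂⟩ := h₂
  have h3 := orderGE_eval_of_dvd (N := N) (P := P₁ - P₂) (by
    have := dvd_sub hd₁ hd₂
    simpa using this)
  exact ((ho₁.sub ho₂).add h3).congr fun z => by simp only [Polynomial.eval_sub]; ring

/-- The truncation of a power series at order `N` may replace it in compositions. -/
theorem comp_trunc (h₁ : HasJet N F₁ G₁) (h0 : PowerSeries.constantCoeff G₁ = 0)
    (H : PowerSeries ℂ) :
    HasJet N (fun z => (PowerSeries.trunc N H).eval (F₁ z)) (PowerSeries.subst G₁ H) := by
  have hs : PowerSeries.HasSubst G₁ := PowerSeries.HasSubst.of_constantCoeff_zero' h0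
  refine (h₁.polynomial_comp _).congr_dvd ?_
  rw [← PowerSeries.subst_coe hs, ← PowerSeries.subst_sub hs]
  have h1 : (PowerSeries.X : PowerSeries ℂ) ^ N ∣
      ((PowerSeries.trunc N H : Polynomial ℂ) : PowerSeries ℂ) - H := by
    rw [PowerSeries.X_pow_dvd_iff]
    intro m hm
    simp [PowerSeries.coeff_trunc, hm]
  -- The truncation error is a multiple of `X ^ N`; since `X` divides `G₁`, it stays a multiple of
  -- `X ^ N` after substitution.
  obtain ⟨K, hK⟩ := h1
  rw [hK, PowerSeries.subst_mul hs, PowerSeries.subst_pow hs, PowerSeries.subst_X hs]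
  refine Dvd.dvd.mul_right (pow_dvd_pow_of_dvd ?_ N) _
  exact PowerSeries.X_dvd_iff.2 h0

end HasJet

theorem hasJet_antiTaylor (hf : IsAntiholomorphicGerm f) (N : ℕ) :
    HasJet N (fun z => f (conj z)) (antiTaylor f) := by
  refine ⟨PowerSeries.trunc N (antiTaylor f), ?_, ?_⟩
  · rw [PowerSeries.X_pow_dvd_iff]
    intro m hm
    simp [PowerSeries.coeff_trunc, hm]
  · have h1 := hf.2.hasFPowerSeriesAt.isBigO_sub_partialSum_pow N
    have h2 : (fun z : ℂ => ‖z‖ ^ N) =O[𝓝 0] fun z : ℂ => z ^ N :=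
      IsBigO.of_bound 1 (by simp)
    refine (h1.trans h2).congr_left fun z => ?_
    simp only [zero_add, FormalMultilinearSeries.partialSum]
    congr 1
    rw [← Polynomial.eval₂_id, PowerSeries.eval₂_trunc_eq_sum_range]
    refine Finset.sum_congr rfl fun i _ => ?_
    simp [antiTaylor, FormalMultilinearSeries.ofScalars, mul_comm]

end
end AntiParabolic

namespace AntiParabolic
section

/-! ### Prenormalization -/

variable {f h p e t F G : ℂ → ℂ} {n k : ℕ} {c b : ℂ}

/-- A formal real form gives an analytic change of coordinate making the jets real. -/
theorem exists_real_jets (hf : IsAntiholomorphicGerm f) (hk : HasCodimension f k)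
    (hpos : Even k → IsPositiveType f k) :
    ∃ (h p : ℂ → ℂ) (a : ℝ), Conjugates h f p ∧ IsAntiholomorphicGerm p ∧ a ≠ 0 ∧
      (Even k → 0 < a) ∧ OrderGE (k + 2) (fun z => p (conj z) - (z + a * z ^ (k + 1))) ∧
      OrderGE (2 * k + 2) fun z => p (conj z) - conj (p z) := by
  -- The positive type and the codimension each provide their own formal form; for `k` even the one
  -- of positive type is chosen, so that a single series carries all the information.
  obtain ⟨A, hA, hA0, ha, hpa⟩ : ∃ A : PowerSeries ℝ, IsRealFormalForm f A ∧
      (∀ n, 2 ≤ n → n ≤ k → PowerSeries.coeff n A = 0) ∧ PowerSeries.coeff (k + 1) A ≠ 0 ∧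
      (Even k → 0 < PowerSeries.coeff (k + 1) A) := by
    by_cases hev : Even k
    · obtain ⟨A, h1, h2, h3⟩ := hpos hev
      exact ⟨A, h1, h2, h3.ne', fun _ => h3⟩
    · obtain ⟨_, A, h1, h2, h3⟩ := hk
      exact ⟨A, h1, h2, h3, fun h => absurd h hev⟩
  have hk1 := hk.1
  obtain ⟨hc0, hc1, H, hH0, hH1, hsub⟩ := hA
  -- Only coefficients of degree at most `2 * k + 1` enter the prenormal form, so the possibly
  -- divergent formal conjugacy may be truncated to a polynomial.
  set N := 2 * k + 2 with hN
  have hj1 := hasJet_antiTaylor hf N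
  have hat0 : PowerSeries.constantCoeff (antiTaylor f) = 0 := by
    simp [antiTaylor, hf.1, ← PowerSeries.coeff_zero_eq_constantCoeff_apply]
  have hj2 := hj1.comp_trunc hat0 H
  set Hp := PowerSeries.trunc N H with hHp
  set Ap := PowerSeries.trunc N (PowerSeries.map Complex.ofRealHom A) with hAp
  have hstar : ∀ z : ℂ, (PowerSeries.trunc N (PowerSeries.map (starRingEnd ℂ) H)).eval z =
      conj (Hp.eval (conj z)) := by
    intro z
    rw [PowerSeries.trunc_map, hHp, Polynomial.eval_map, Polynomial.eval₂_eq_sum_range,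
      Polynomial.eval_eq_sum_range, map_sum]
    simp
  have hj3 : HasJet N (fun z => conj (Hp.eval (conj z))) (PowerSeries.map (starRingEnd ℂ) H) := by
    refine ⟨PowerSeries.trunc N (PowerSeries.map (starRingEnd ℂ) H), ?_, ?_⟩
    · rw [PowerSeries.X_pow_dvd_iff]
      intro m hm
      simp [PowerSeries.coeff_trunc, hm]
    · exact (OrderGE.zero_fun N).congr fun z => by rw [hstar]; simp
  have hj4 := hj3.comp_trunc (by
    rw [← PowerSeries.coeff_zero_eq_constantCoeff_apply]; simp [hH0])
    (PowerSeries.map Complex.ofRealHom A)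
  rw [← hsub, ← hAp] at hj4
  have hrel := hj2.orderGE_sub hj4
  have hHa : ∀ z, AnalyticAt ℂ (fun z => Hp.eval z) z := fun z => by
    have := (Polynomial.differentiable Hp).analyticAt (z := z)
    exact this
  have hHb : IsBiholomorphicGerm fun z => Hp.eval z := by
    refine IsBiholomorphicGerm.of_hasDerivAt (hHa 0) ?_ (Hp.hasDerivAt 0) ?_
    · rw [← Polynomial.coeff_zero_eq_eval_zero, hHp, PowerSeries.coeff_trunc]
      simp [hH0]
    · rw [← Polynomial.coeff_zero_eq_eval_zero, Polynomial.coeff_derivative, hHp,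
        PowerSeries.coeff_trunc]
      simpa [hN] using hH1
  obtain ⟨H', hH'b, -, hl, hr⟩ := hHb.exists_inverse
  set p : ℂ → ℂ := fun z => Hp.eval (f (H' z)) with hp
  have hpa : IsAntiholomorphicGerm p :=
    (hf.comp_holomorphic hH'b.analytic hH'b.map_zero).holomorphic_comp hHb.analytic hHb.map_zero
  -- The truncated relation is precomposed with the conjugate of `H'`, the inverse of the inner
  -- polynomial on its right-hand side.
  have hpA : OrderGE N fun z => p (conj z) - Ap.eval z := by
    have h1 : OrderGE 1 (conjGerm H') := hH'b.orderGE.conjGerm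
    refine (hrel.comp h1).congr_ev ?_
    filter_upwards [eventually_conj hr] with z hz
    simp [conjGerm, hp, hz]
  have hAreal : ∀ z : ℂ, conj (Ap.eval z) = Ap.eval (conj z) := by
    intro z
    rw [hAp, PowerSeries.trunc_map, Polynomial.eval_map, Polynomial.eval_map,
      Polynomial.eval₂_eq_sum_range, Polynomial.eval₂_eq_sum_range, map_sum]
    simp
  refine ⟨_, p, PowerSeries.coeff (k + 1) A, Conjugates.of_inverse hHb hl, hpa, ha, ‹_›, ?_, ?_⟩
  · have h1 : OrderGE (k + 2) fun z =>
        Ap.eval z - (z + ((PowerSeries.coeff (k + 1) A : ℝ) : ℂ) * z ^ (k + 1)) := by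
      have h2 : (PowerSeries.X : PowerSeries ℂ) ^ (k + 2) ∣
          ((Ap - (Polynomial.X + Polynomial.C ((PowerSeries.coeff (k + 1) A : ℝ) : ℂ) *
            Polynomial.X ^ (k + 1)) : Polynomial ℂ) : PowerSeries ℂ) := by
        rw [PowerSeries.X_pow_dvd_iff]
        intro m hm
        rw [Polynomial.coeff_coe, Polynomial.coeff_sub, hAp, PowerSeries.coeff_trunc,
          if_pos (by omega), Polynomial.coeff_add, Polynomial.coeff_C_mul, Polynomial.coeff_X,
          Polynomial.coeff_X_pow, PowerSeries.coeff_map]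
        rcases Nat.lt_or_ge m 2 with h | h
        · interval_cases m
          · simp [hc0]
          · simp [hc1, show ¬ k = 0 by omega]
        · rcases Nat.lt_or_ge k m with h' | h'
          · obtain rfl : m = k + 1 := by omega
            simp [show ¬ k = 0 by omega]
          · rw [hA0 m h h', if_neg (by omega), if_neg (by omega)]
            simp
      exact (orderGE_eval_of_dvd h2).congr fun z => by simp
    exact ((hpA.mono (by omega)).add h1).congr fun z => by ring
  · have h2 := hpA.comp_conj.star
    refine (hpA.sub h2).congr fun z => ?_
    simp [hAreal]

/-- With `F z = f (conj z)`, the two terms are `F` applied to `conj (f z)` and to `F z`, and these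
arguments agree to order `N` when the jet of `F` is real. -/
theorem square_real_jet {N : ℕ} (hf : IsAntiholomorphicGerm f)
    (h : OrderGE N fun z => f (conj z) - conj (f z)) :
    OrderGE N (fun z => f (f z) - f (conj (f (conj z)))) := by
  have hF1 : OrderGE 1 (fun w => f (conj w)) := hf.orderGE.comp_conj
  have hF2 : OrderGE 1 (fun w => conj (f w)) := hf.orderGE.star
  have h1 := OrderGE.comp_sub_comp (n := 0) hf.2 hF1 hF2 hF1 (h.neg.congr fun z => by
    show _ = conj (f z) - f (conj z); ring)
  refine (h1.mono (by omega)).congr fun z => ?_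
  simp

/-- Prenormalization of a germ with real jets, by a change of coordinate with real coefficients. -/
theorem exists_prenormalization_of_real_jets {a : ℝ} {g h₁ : ℂ → ℂ} (hk : 1 ≤ k)
    (hf : IsAntiholomorphicGerm f) (ha : a ≠ 0) (hpos : Even k → 0 < a)
    (hfa : OrderGE (k + 2) (fun z => f (conj z) - (z + a * z ^ (k + 1))))
    (hfr : OrderGE (2 * k + 2) fun z => f (conj z) - conj (f z))
    (hg : IsHolPrenormalized g k b) (h₁b : Conjugates h₁ (f ∘ f) g) :
    b.im = 0 ∧ ∃ h p : ℂ → ℂ, Conjugates h f p ∧ IsPrenormalized p k b := by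
  obtain ⟨hga, hgj⟩ := isHolPrenormalized_iff.1 hg
  set γ : ℂ := ((k : ℂ) + 1) / 2 - b with hγ
  have hF1 : OrderGE 1 (fun w => f (conj w)) := hf.orderGE.comp_conj
  have hF2 : OrderGE 1 (fun w => conj (f w)) := hf.orderGE.star
  have hf2 : OrderGE 2 fun z => f (conj z) - 1 * z :=
    ((hfa.mono (by omega)).add (((OrderGE.pow_self (k + 1)).const_mul a).mono (by omega))).congr
      fun z => by ring
  -- the jets of `f ∘ f`
  have hG : OrderGE (k + 2) fun z => f (f z) - (z + (2 * a : ℂ) * z ^ (k + 1)) := by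
    have e1 := hfa.comp hF2
    have e2 : OrderGE (k + 2) fun z => conj (f z) - (z + a * z ^ (k + 1)) :=
      (hfa.comp_conj.star).congr fun z => by simp
    have hpw : AnalyticAt ℂ (fun z : ℂ => z ^ (k + 1)) 0 := analyticAt_id.pow (k + 1)
    have e4 : OrderGE 2 fun z => conj (f z) - z :=
      ((e2.mono (by omega)).add (((OrderGE.pow_self (k + 1)).const_mul a).mono (by omega))).congr
        fun z => by ring
    have e3 := OrderGE.comp_sub_comp (n := k) hpw (OrderGE.pow_self (k + 1)) hF2
      OrderGE.self e4
    refine ((e1.add e2).add (e3.const_mul a)).congr fun z => ?_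
    simp only [Complex.conj_conj]
    ring
  have hff : AnalyticAt ℂ (fun z => f (f z)) 0 := hf.comp hf
  have hff1 : OrderGE 1 fun z => f (f z) := OrderGE.of_analyticAt hff (by simp [hf.1])
  set μ := deriv h₁ 0 with hμ
  have hμ0 : μ ≠ 0 := h₁b.1.deriv_ne_zero
  have hμk : μ ^ k = 2 * a := by
    have h1 := leading_coeff_of_conjugation (k := k) (lam := μ) (a₁ := 2 * a) (a₂ := 1)
      (t := h₁) (g₁ := fun z => f (f z)) (g₂ := g) hk h₁b.1.analytic
      (OrderGE.of_hasDerivAt h₁b.1.analytic h₁b.1.map_zero h₁b.1.hasDerivAt) hG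
      (((hgj.mono (by omega)).add (((OrderGE.pow_self (2 * k + 1)).const_mul γ).mono
        (by omega))).congr fun z => by ring)
      ((OrderGE.zero_fun _).congr_ev (by
        filter_upwards [h₁b.2] with z hz
        simp only [Function.comp_apply] at hz
        rw [hz, sub_self]))
    have : μ * μ ^ k = μ * (2 * a) := by rw [h1]; ring
    exact mul_left_cancel₀ hμ0 this
  -- rotation making the derivative real
  obtain ⟨lam, ν, hlk, hlν, hν0⟩ : ∃ (lam : ℂ) (ν : ℝ), lam ^ k = 1 ∧ μ = lam * ν ∧ ν ≠ 0 := by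
    have hn : (‖μ‖ : ℂ) ≠ 0 := by simpa using hμ0
    have hnk : (‖μ‖ : ℝ) ^ k = 2 * |a| := by
      rw [← norm_pow, hμk]; simp
    -- Since `μ ^ k = 2 * a`, the `k`-th power of `μ / ‖μ‖` is the sign of `a`. A negative sign
    -- occurs only for odd `k`, where it is absorbed into `ν`.
    rcases lt_or_gt_of_ne ha with h | h
    · have hodd : Odd k := by
        rw [← Nat.not_even_iff_odd]; intro h'; exact absurd (hpos h') (by linarith)
      refine ⟨-(μ / ‖μ‖), -‖μ‖, ?_, ?_, by simpa using hμ0⟩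
      · rw [hodd.neg_pow, div_pow, hμk, ← Complex.ofReal_pow, hnk, abs_of_neg h]
        have : (a : ℂ) ≠ 0 := by exact_mod_cast ha
        push_cast; field_simp
      · push_cast; field_simp
    · refine ⟨μ / ‖μ‖, ‖μ‖, ?_, ?_, by simpa using hμ0⟩
      · rw [div_pow, hμk, ← Complex.ofReal_pow, hnk, abs_of_pos h]
        have : (a : ℂ) ≠ 0 := by exact_mod_cast ha
        push_cast; field_simp
      · field_simp
  have hl0 : lam ≠ 0 := by rintro rfl; simp [hlν] at hμ0
  have hνc : (ν : ℂ) ≠ 0 := by exact_mod_cast hν0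
  set g₂ : ℂ → ℂ := fun z => lam⁻¹ * g (lam * z) with hg₂
  have hg₂j : OrderGE (2 * k + 2) fun z => g₂ z - (z + z ^ (k + 1) + γ * z ^ (2 * k + 1)) := by
    refine ((hgj.comp (OrderGE.self.const_mul lam)).const_mul lam⁻¹).congr fun z => ?_
    have h1 : lam ^ (2 * k + 1) = lam := by rw [pow_succ, mul_comm 2 k, pow_mul, hlk]; simp
    simp only [hg₂, mul_pow, pow_succ lam k, hlk, h1]
    field_simp
  set h₂ : ℂ → ℂ := fun z => lam⁻¹ * h₁ z with hh₂
  have h₂d : HasDerivAt h₂ ν 0 := by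
    have := h₁b.1.hasDerivAt.const_mul lam⁻¹
    rwa [← hμ, hlν, inv_mul_cancel_left₀ hl0] at this
  have h₂b : IsBiholomorphicGerm h₂ := IsBiholomorphicGerm.of_hasDerivAt
    (analyticAt_const.mul h₁b.1.analytic) (by simp [hh₂, h₁b.1.map_zero]) h₂d hνc
  have h₂c : ∀ᶠ z in 𝓝 0, h₂ (f (f z)) = g₂ (h₂ z) := by
    filter_upwards [h₁b.2] with z hz
    simp only [Function.comp_apply] at hz
    simp [hh₂, hg₂, hz, hl0]
  obtain ⟨h₂', h₂'b, h₂'d, h₂l, h₂r⟩ := h₂b.exists_inverse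
  rw [h₂d.deriv] at h₂'d
  have hsa := analyticAt_conjGerm h₂b.analytic
  have hs0 : conjGerm h₂ 0 = 0 := by simp [conjGerm, h₂b.map_zero]
  have hsd : HasDerivAt (conjGerm h₂) ν 0 := by simpa using hasDerivAt_conjGerm h₂d
  -- The germ `t` measures how far `h₂` is from having real coefficients. Because the jets of `f`
  -- are real, it conjugates `g₂` to its conjugate germ up to order `2 * k + 1`; rigidity of
  -- prenormalized jets then gives both `t z = z + O(z ^ (k + 1))` and the reality of `b`.
  set t : ℂ → ℂ := fun z => conjGerm h₂ (h₂' z) with ht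
  have hta : AnalyticAt ℂ t 0 := analyticAt_comp_zero hsa h₂'b.analytic h₂'b.map_zero
  have ht2 : OrderGE 2 fun z => t z - z := by
    have h1 := hasDerivAt_comp_zero hsd h₂'d h₂'b.map_zero
    rw [mul_inv_cancel₀ hνc] at h1
    simpa using OrderGE.of_hasDerivAt hta (by simp [ht, h₂'b.map_zero, hs0]) h1
  have htc : OrderGE (2 * k + 2) fun z => t (g₂ z) - conjGerm g₂ (t z) := by
    refine OrderGE.of_comp (h := h₂) h₂'b h₂r ?_
    have h1 : OrderGE (2 * k + 2) fun z => f (f z) - conj (f (f (conj z))) := by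
      have e1 := square_real_jet hf hfr
      have e3 := hfr.comp hF1
      refine (e1.add e3).congr fun z => ?_
      ring
    have h2 := OrderGE.comp_sub_comp (n := 0) hsa
      (OrderGE.of_analyticAt hsa hs0) hff1 (hff1.comp_conj.star) h1
    refine (h2.mono (by omega)).congr_ev ?_
    have hc1 : ∀ᶠ z in 𝓝 0, h₂' (h₂ (f (f z))) = f (f z) := (hff1.tendsto le_rfl).eventually h₂l
    filter_upwards [h₂l, h₂c, eventually_conj h₂c, hc1] with z h1 h2 h3 h4
    simp only [ht]
    rw [h1, ← h2, h4]
    simp only [conjGerm, Complex.conj_conj] at *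
    rw [h3]
  have hg₂s : OrderGE (2 * k + 2) fun z => conjGerm g₂ z -
      (z + z ^ (k + 1) + conj γ * z ^ (2 * k + 1)) := by
    refine hg₂j.comp_conj.star.congr fun z => by simp [conjGerm]
  obtain ⟨htk, hγr⟩ := conjugation_of_prenormalized hk hta ht2 hg₂j hg₂s htc
  have hb : b.im = 0 := by
    have h1 := congrArg Complex.im hγr
    simp only [hγ, Complex.conj_im, Complex.sub_im] at h1
    have h2 : (((k : ℂ) + 1) / 2).im = 0 := by
      have : (((k : ℂ) + 1) / 2) = (((k : ℝ) + 1) / 2 : ℝ) := by push_cast; rfl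
      rw [this, Complex.ofReal_im]
    rw [h2] at h1; linarith
  refine ⟨hb, ?_⟩
  -- the real part of `h₂`
  set s : ℂ → ℂ := fun z => 1 / 2 * (z + t z) with hs
  have hsan : AnalyticAt ℂ s 0 := analyticAt_const.mul (analyticAt_id.add hta)
  have hsk : OrderGE (k + 1) fun z => s z - z :=
    (htk.const_mul (1 / 2)).congr fun z => by simp only [hs]; ring
  -- This germ has real coefficients and equals `s ∘ h₂`, where `s` is the identity up to order `k`.
  -- It therefore keeps the jets real without spoiling the prenormal form of the square.
  set h₄ : ℂ → ℂ := fun z => 1 / 2 * (h₂ z + conjGerm h₂ z) with hh₄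
  have h₄d : HasDerivAt h₄ ν 0 := by
    have := (h₂d.add hsd).const_mul (1 / 2 : ℂ)
    refine this.congr_deriv ?_
    ring
  have h₄b : IsBiholomorphicGerm h₄ := IsBiholomorphicGerm.of_hasDerivAt
    (analyticAt_const.mul (h₂b.analytic.add hsa)) (by simp [hh₄, h₂b.map_zero, hs0]) h₄d hνc
  have h₄s : ∀ z, h₄ (conj z) = conj (h₄ z) := by
    intro z; simp [hh₄, conjGerm, Complex.conj_ofNat]; ring
  have h₄e : ∀ᶠ z in 𝓝 0, h₄ z = s (h₂ z) := by
    filter_upwards [h₂l] with z hz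
    simp [hh₄, hs, ht, hz]
  obtain ⟨h₄', h₄'b, h₄'d, h₄l, h₄r⟩ := h₄b.exists_inverse
  rw [h₄d.deriv] at h₄'d
  have h₄'s : ∀ᶠ z in 𝓝 0, h₄' (conj z) = conj (h₄' z) := by
    have h1 : Tendsto (fun z => conj (h₄' z)) (𝓝 0) (𝓝 0) := tendsto_conj_zero.comp h₄'b.tendsto
    filter_upwards [h1.eventually h₄l, h₄r] with z h1 h2
    rw [h₄s, h2] at h1
    exact h1
  set p : ℂ → ℂ := fun z => h₄ (f (h₄' z)) with hp
  have hpa : IsAntiholomorphicGerm p :=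
    (hf.comp_holomorphic h₄'b.analytic h₄'b.map_zero).holomorphic_comp h₄b.analytic h₄b.map_zero
  refine ⟨h₄, p, Conjugates.of_inverse h₄b h₄l, isPrenormalized_iff.2 ⟨hpa, ?_⟩⟩
  have hpr : OrderGE (2 * k + 2) fun z => p (conj z) - conj (p z) := by
    have h1 := OrderGE.comp_sub_comp (n := 0) h₄b.analytic h₄b.orderGE hF1 hF2 hfr
    have h2 := h1.comp h₄'b.orderGE
    refine (h2.mono (by omega)).congr_ev ?_
    filter_upwards [h₄'s] with z hz
    simp [hp, hz, h₄s]
  have hp2 : OrderGE 2 fun z => p (conj z) - z := by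
    have h1 : HasDerivAt (fun z => f (conj z)) 1 0 := hf2.hasDerivAt
    have h2 := hasDerivAt_comp_zero h₄d (hasDerivAt_comp_zero h1 h₄'d h₄'b.map_zero)
      (by simp [h₄'b.map_zero, hf.1])
    rw [one_mul, mul_inv_cancel₀ hνc] at h2
    have h3 := OrderGE.of_hasDerivAt (analyticAt_comp_zero h₄b.analytic (analyticAt_comp_zero hf.2
      h₄'b.analytic h₄'b.map_zero) (by simp [h₄'b.map_zero, hf.1]))
      (by simp [h₄'b.map_zero, hf.1, h₄b.map_zero]) h2
    refine h3.congr_ev ?_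
    filter_upwards [h₄'s] with z hz
    simp [hp, hz]
  -- The square root lemma is about the holomorphic germ `z ↦ p (conj z)`. Its square agrees with `p
  -- ∘ p` to the required order because the jets of `p` are real.
  refine jet_of_square hk b hpa.2 hp2 ?_
  have hpp : OrderGE (2 * k + 2) fun z => p (p z) - (z + z ^ (k + 1) + γ * z ^ (2 * k + 1)) := by
    refine OrderGE.of_comp (h := h₄) h₄'b h₄r ?_
    have h1 := (prenormalized_of_conjugation hk hsan hsk hg₂j).comp h₂b.orderGE
    refine h1.congr_ev ?_
    filter_upwards [h₄l, h₄e, h₂c, (hf.tendsto).eventually h₄l,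
      (hff1.tendsto le_rfl).eventually h₄e] with z h1 h2 h3 h4 h5
    simp only [hp]
    rw [h1, h4, h2, h5, h3]
  refine (hpp.sub (square_real_jet hpa hpr)).congr fun z => ?_
  ring

theorem exists_prenormalization (hf : IsParabolicGerm f) (hk : HasCodimension f k)
    (hpos : Even k → IsPositiveType f k) (hb : HasFormalInvariant f k b) :
    b.im = 0 ∧ ∃ h p : ℂ → ℂ, Conjugates h f p ∧ IsPrenormalized p k b := by
  obtain ⟨h, q, a, hc, hq, ha, hpa, hq1, hq2⟩ := exists_real_jets hf.antiholomorphic hk hpos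
  obtain ⟨h₀, g, h₀c, hg⟩ := hb
  obtain ⟨h', h'b, -, hl, hr⟩ := hc.1.exists_inverse
  have hc' := hc.symm_of_inverse hf.antiholomorphic.tendsto h'b hl hr
  have h₁ : Conjugates (fun z => h₀ (h' z)) (q ∘ q) g := by
    refine Conjugates.trans ⟨h'b, ?_⟩ h₀c
    filter_upwards [hc'.2, hq.tendsto.eventually hc'.2] with z h1 h2
    simp only [Function.comp_apply]
    rw [h2, h1]
  obtain ⟨hb, h₂, p, h₂c, hp⟩ := exists_prenormalization_of_real_jets hk.1 hq ha hpa hq1 hq2 hg h₁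
  exact ⟨hb, _, p, hc.trans h₂c, hp⟩

end
end AntiParabolic

namespace AntiParabolic
section

/-! ### The chart `w - α log (κ w)` on the slit plane -/

/-- The model of attracting domains in time charts. -/
def attr (R : ℝ) : Set ℂ := {X | R < |X.im| ∨ R < X.re}

theorem isOpen_attr (R : ℝ) : IsOpen (attr R) :=
  (isOpen_lt continuous_const (Complex.continuous_im.abs)).union
    (isOpen_lt continuous_const Complex.continuous_re)

theorem attr_anti {R R' : ℝ} (h : R ≤ R') : attr R' ⊆ attr R := fun _ hX =>
  hX.imp (lt_of_le_of_lt h) (lt_of_le_of_lt h)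

theorem lt_norm_of_mem_attr {R : ℝ} {X : ℂ} (hX : X ∈ attr R) : R < ‖X‖ :=
  hX.elim (fun h => h.trans_le (Complex.abs_im_le_norm X))
    fun h => h.trans_le ((le_abs_self _).trans (Complex.abs_re_le_norm X))

theorem mem_attr_of_norm_sub_le {R r : ℝ} {X Y : ℂ} (hX : X ∈ attr R) (h : ‖Y - X‖ ≤ r) :
    Y ∈ attr (R - r) := by
  have h1 := (Complex.abs_im_le_norm (Y - X)).trans h
  have h2 := (Complex.abs_re_le_norm (Y - X)).trans h
  simp only [Complex.sub_im, Complex.sub_re] at h1 h2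
  rcases hX with hX | hX
  · left
    have := abs_sub_abs_le_abs_sub X.im Y.im
    rw [abs_sub_comm] at this
    linarith
  · right
    have := abs_le.1 h2
    linarith [this.1]

theorem mem_attr_of_norm_sub_lt {R r R' : ℝ} {X Y : ℂ} (hX : X ∈ attr R) (h : ‖Y - X‖ ≤ r)
    (hR : R' ≤ R - r) : Y ∈ attr R' := attr_anti hR (mem_attr_of_norm_sub_le hX h)

theorem attr_subset_slitPlane {R : ℝ} (hR : 0 ≤ R) : attr R ⊆ Complex.slitPlane := by
  intro X hX
  rw [Complex.mem_slitPlane_iff]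
  rcases hX with hX | hX
  · right; intro h; rw [h] at hX; simp at hX; linarith
  · left; linarith

theorem conj_mem_attr {R : ℝ} {X : ℂ} : conj X ∈ attr R ↔ X ∈ attr R := by simp [attr]

/-- The time chart in the coordinate `w = 1 / (κ u ^ κ)`. -/
noncomputable def slitChart (κ α : ℝ) (w : ℂ) : ℂ := w - α * Complex.log (κ * w)

section SlitChart

variable {κ α : ℝ}

/-- The logarithm is dominated by any multiple of the modulus, and `δ` is the multiple leaving `1/8`
after multiplication by `|α| κ`. The bound `1 ≤ κ * ‖w‖` keeps the real part of the logarithm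
nonnegative. -/
theorem exists_norm_log_le (hκ : 1 ≤ κ) (α : ℝ) : ∃ C : ℝ, 0 ≤ C ∧ ∀ w : ℂ, 1 ≤ κ * ‖w‖ →
    ‖(α : ℂ) * Complex.log (κ * w)‖ ≤ ‖w‖ / 8 + C := by
  set δ : ℝ := 1 / (8 * (|α| + 1) * κ) with hδ
  have hδ0 : 0 < δ := by positivity
  refine ⟨|α| * (|Real.log δ| + π), by positivity, fun w hw => ?_⟩
  have hn : ‖(κ : ℂ) * w‖ = κ * ‖w‖ := by simp [abs_of_pos (by linarith : 0 < κ)]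
  have h1 : ‖Complex.log (κ * w)‖ ≤ Real.log (κ * ‖w‖) + π := by
    rw [← hn]
    refine (Complex.norm_le_abs_re_add_abs_im _).trans ?_
    rw [Complex.log_re, Complex.log_im, abs_of_nonneg (Real.log_nonneg (by rw [hn]; exact hw))]
    gcongr
    exact Complex.abs_arg_le_pi _
  have h2 : Real.log (κ * ‖w‖) ≤ δ * (κ * ‖w‖) + |Real.log δ| := by
    have h3 := Real.log_le_sub_one_of_pos (show 0 < δ * (κ * ‖w‖) by positivity)
    rw [Real.log_mul hδ0.ne' (by positivity)] at h3
    linarith [neg_abs_le (Real.log δ)]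
  have h4 : |α| * (δ * (κ * ‖w‖)) ≤ ‖w‖ / 8 := by
    rw [hδ]
    have : |α| * (1 / (8 * (|α| + 1) * κ) * (κ * ‖w‖)) = |α| / (|α| + 1) * (‖w‖ / 8) := by
      field_simp
    rw [this]
    exact mul_le_of_le_one_left (by positivity) ((div_le_one (by positivity)).2 (by linarith))
  rw [norm_mul, Complex.norm_real, Real.norm_eq_abs]
  calc |α| * ‖Complex.log (κ * w)‖ ≤ |α| * (δ * (κ * ‖w‖) + |Real.log δ| + π) := by
        gcongr; linarith
    _ ≤ _ := by linarith

theorem ofReal_mul_mem_slitPlane (hκ : 0 < κ) {w : ℂ} (hw : w ∈ Complex.slitPlane) :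
    (κ : ℂ) * w ∈ Complex.slitPlane := by
  rw [Complex.mem_slitPlane_iff] at hw ⊢
  simp only [Complex.re_ofReal_mul, Complex.im_ofReal_mul, mul_pos_iff_of_pos_left hκ]
  exact hw.imp id fun h => mul_ne_zero hκ.ne' h

theorem hasStrictDerivAt_log_mul (hκ : 0 < κ) {w : ℂ} (hw : w ∈ Complex.slitPlane) :
    HasStrictDerivAt (fun w : ℂ => Complex.log (κ * w)) (1 / w) w := by
  have h1 : HasStrictDerivAt (fun w : ℂ => (κ : ℂ) * w) κ w := by
    simpa using (hasStrictDerivAt_id w).const_mul (κ : ℂ)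
  have h2 := h1.clog (ofReal_mul_mem_slitPlane hκ hw)
  refine h2.congr_deriv ?_
  have : (κ : ℂ) ≠ 0 := by exact_mod_cast hκ.ne'
  have := Complex.slitPlane_ne_zero hw
  field_simp

theorem hasStrictDerivAt_slitChart (hκ : 0 < κ) {w : ℂ} (hw : w ∈ Complex.slitPlane) :
    HasStrictDerivAt (slitChart κ α) (1 - α / w) w := by
  have := (hasStrictDerivAt_id w).sub ((hasStrictDerivAt_log_mul hκ hw).const_mul (α : ℂ))
  refine this.congr_deriv ?_
  rw [mul_one_div]

theorem norm_log_sub_log_le (hκ : 0 < κ) {S : Set ℂ} (hS : Convex ℝ S) (hSs : S ⊆ Complex.slitPlane)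
    {r : ℝ} (hr : 0 < r) (hSr : ∀ w ∈ S, r ≤ ‖w‖) {w w' : ℂ} (hw : w ∈ S) (hw' : w' ∈ S) :
    ‖Complex.log (κ * w) - Complex.log (κ * w')‖ ≤ 1 / r * ‖w - w'‖ := by
  refine hS.norm_image_sub_le_of_norm_hasDerivWithin_le (f' := fun w => 1 / w)
    (fun x hx => (hasStrictDerivAt_log_mul hκ (hSs hx)).hasDerivAt.hasDerivWithinAt)
    (fun x hx => ?_) hw' hw
  rw [norm_div, norm_one]
  exact one_div_le_one_div_of_le hr (hSr x hx)

/-- For `ζ` in the right half-plane the closest point of the closed negative axis is `0`, at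
distance `‖ζ‖`. -/
theorem closedBall_subset_slitPlane {ζ : ℂ} (hζ : 0 < ζ.re) :
    Metric.closedBall ζ (‖ζ‖ / 2) ⊆ Complex.slitPlane := by
  intro w hw
  rw [Metric.mem_closedBall, dist_eq_norm] at hw
  rw [Complex.mem_slitPlane_iff]
  by_contra! h
  have h1 : ‖w - ζ‖ ^ 2 ≤ (‖ζ‖ / 2) ^ 2 := by gcongr
  have h2 : ‖w - ζ‖ ^ 2 = (w.re - ζ.re) ^ 2 + ζ.im ^ 2 := by
    rw [Complex.sq_norm, Complex.normSq_apply]; simp [h.2]; ring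
  have h3 : ‖ζ‖ ^ 2 = ζ.re ^ 2 + ζ.im ^ 2 := by
    rw [Complex.sq_norm, Complex.normSq_apply]; ring
  nlinarith [h.1, hζ, sq_nonneg ζ.im, mul_pos hζ hζ, mul_nonneg (neg_nonneg.2 h.1) hζ.le]

/-- The solutions of `slitChart κ α w = ζ` are fixed points of a contraction of a convex set. -/
theorem exists_slitChart_cell (hκ : 1 ≤ κ) (α : ℝ) : ∃ R₀ : ℝ, 4 ≤ R₀ ∧ 8 * |α| ≤ R₀ ∧
    ∀ R, R₀ ≤ R → ∀ ζ ∈ attr R, ∃ S : Set ℂ, IsClosed S ∧ Convex ℝ S ∧ S.Nonempty ∧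
      S ⊆ Complex.slitPlane ∧ (∀ w ∈ S, R / 2 ≤ ‖w‖) ∧
      Set.MapsTo (fun w => ζ + α * Complex.log (κ * w)) S S ∧
      ∀ w ∈ Complex.slitPlane, 1 ≤ κ * ‖w‖ → slitChart κ α w = ζ → w ∈ S ∧ w ∈ attr (R / 4) ∧
        ‖ζ‖ / 2 ≤ ‖w‖ ∧ ‖w‖ ≤ 2 * ‖ζ‖ := by
  obtain ⟨C, hC, hlog⟩ := exists_norm_log_le hκ α
  have hpi : 2 * |α| * π ≤ 8 * |α| := by nlinarith [Real.pi_le_four, abs_nonneg α]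
  -- The term `8 * |α|` bounds the imaginary part `|α| π` by `R / 2` and will give the contraction
  -- ratio; the term `4 * C` makes `C ≤ ‖ζ‖ / 4`.
  refine ⟨4 + 8 * |α| + 4 * C, by linarith [abs_nonneg α], ?_, fun R hR ζ hζ => ?_⟩
  · linarith [abs_nonneg α]
  have hα0 := abs_nonneg α
  have hζn := lt_norm_of_mem_attr hζ
  have hκ0 : 0 < κ := by linarith
  have him : ∀ w : ℂ, |((α : ℂ) * Complex.log (κ * w)).im| ≤ R / 2 := by
    intro w
    rw [Complex.im_ofReal_mul, Complex.log_im, abs_mul]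
    have := mul_le_mul_of_nonneg_left (Complex.abs_arg_le_pi (κ * w)) hα0
    nlinarith
  -- From `‖w - ζ‖ ≤ ‖w‖ / 8 + C` and `‖w‖ ≤ ‖ζ‖ + ‖w - ζ‖` one gets `7/8 ‖w - ζ‖ ≤ 3/8 ‖ζ‖`.
  have hnorm : ∀ w : ℂ, 1 ≤ κ * ‖w‖ → slitChart κ α w = ζ →
      ‖w - ζ‖ ≤ 3 / 7 * ‖ζ‖ ∧ ‖ζ‖ / 2 ≤ ‖w‖ ∧ ‖w‖ ≤ 2 * ‖ζ‖ := by
    intro w hw1 hw2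
    have h1 : w - ζ = α * Complex.log (κ * w) := by rw [← hw2, slitChart]; ring
    have h2 := hlog w hw1
    rw [← h1] at h2
    have h3 : ‖w‖ ≤ ‖ζ‖ + ‖w - ζ‖ := by simpa using norm_add_le ζ (w - ζ)
    have h4 : ‖ζ‖ ≤ ‖w‖ + ‖w - ζ‖ := by
      have := norm_sub_le w (w - ζ); simpa using this
    refine ⟨by linarith, by linarith, by linarith⟩
  -- High above or below the axis the cell is a half-plane, invariant because the imaginary part of
  -- the logarithm is bounded. Otherwise `ζ` is far to the right and a ball of radius `‖ζ‖ / 2` is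
  -- used. All these cells are convex and avoid the slit, so the mean value inequality applies to
  -- the logarithm.
  by_cases h1 : R < ζ.im
  · refine ⟨{w | R / 2 ≤ w.im}, isClosed_le continuous_const Complex.continuous_im,
      convex_halfSpace_im_ge _, ⟨ζ, by simp only [Set.mem_ofPred_eq]; linarith⟩, ?_, ?_, ?_, ?_⟩
    · intro w hw
      simp only [Set.mem_ofPred_eq] at hw
      exact Complex.mem_slitPlane_iff.2 (Or.inr (by intro h; rw [h] at hw; linarith))
    · intro w hw
      exact (show R / 2 ≤ w.im from hw).trans ((le_abs_self _).trans (Complex.abs_im_le_norm w))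
    · intro w _
      have := abs_le.1 (him w)
      simp only [Set.mem_ofPred_eq, Complex.add_im]
      linarith [this.1]
    · intro w _ hw1 hw2
      have h2 : w.im = ζ.im + ((α : ℂ) * Complex.log (κ * w)).im := by
        rw [← hw2, slitChart, Complex.sub_im]; ring
      have := abs_le.1 (him w)
      have h3 : R / 2 ≤ w.im := by linarith [this.1]
      refine ⟨h3, Or.inl ?_, (hnorm w hw1 hw2).2⟩
      have := le_abs_self w.im
      linarith
  by_cases h1' : R < -ζ.im
  · refine ⟨{w | w.im ≤ -(R / 2)}, isClosed_le Complex.continuous_im continuous_const,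
      convex_halfSpace_im_le _, ⟨ζ, by simp only [Set.mem_ofPred_eq]; linarith⟩, ?_, ?_, ?_, ?_⟩
    · intro w hw
      simp only [Set.mem_ofPred_eq] at hw
      exact Complex.mem_slitPlane_iff.2 (Or.inr (by intro h; rw [h] at hw; linarith))
    · intro w hw
      simp only [Set.mem_ofPred_eq] at hw
      have := (neg_le_abs w.im).trans (Complex.abs_im_le_norm w)
      linarith
    · intro w _
      have := abs_le.1 (him w)
      simp only [Set.mem_ofPred_eq, Complex.add_im]
      linarith [this.2]
    · intro w _ hw1 hw2
      have h2 : w.im = ζ.im + ((α : ℂ) * Complex.log (κ * w)).im := by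
        rw [← hw2, slitChart, Complex.sub_im]; ring
      have := abs_le.1 (him w)
      have h3 : w.im ≤ -(R / 2) := by linarith [this.2]
      refine ⟨h3, Or.inl ?_, (hnorm w hw1 hw2).2⟩
      have := neg_le_abs w.im
      linarith
  · have h2 : R < ζ.re := by
      refine hζ.resolve_left fun h => ?_
      rcases lt_abs.1 h with h | h
      · exact h1 h
      · exact h1' h
    have h3 : 0 < ζ.re := by linarith
    refine ⟨Metric.closedBall ζ (‖ζ‖ / 2), Metric.isClosed_closedBall, convex_closedBall _ _,
      ⟨ζ, Metric.mem_closedBall_self (by positivity)⟩, closedBall_subset_slitPlane h3, ?_, ?_, ?_⟩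
    · intro w hw
      rw [Metric.mem_closedBall, dist_eq_norm] at hw
      have := norm_sub_le w (w - ζ)
      simp only [sub_sub_cancel] at this
      linarith
    · intro w hw
      rw [Metric.mem_closedBall, dist_eq_norm] at hw ⊢
      have h4 : ‖ζ‖ ≤ ‖w‖ + ‖w - ζ‖ := by
        have := norm_sub_le w (w - ζ); simpa using this
      have h5 : ‖w‖ ≤ ‖ζ‖ + ‖w - ζ‖ := by simpa using norm_add_le ζ (w - ζ)
      have h6 : 1 ≤ κ * ‖w‖ := by nlinarith
      have := hlog w h6
      simp only [add_sub_cancel_left]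
      linarith
    · intro w _ hw1 hw2
      obtain ⟨h4, h5⟩ := hnorm w hw1 hw2
      refine ⟨?_, ?_, h5⟩
      · rw [Metric.mem_closedBall, dist_eq_norm]; linarith [norm_nonneg ζ]
      · have h6 := (Complex.abs_re_le_norm (w - ζ)).trans h4
        have h7 := (Complex.abs_im_le_norm (w - ζ)).trans h4
        simp only [Complex.sub_re, Complex.sub_im] at h6 h7
        have h8 : ‖ζ‖ ^ 2 = ζ.re ^ 2 + ζ.im ^ 2 := by
          rw [Complex.sq_norm, Complex.normSq_apply]; ring
        -- The larger coordinate is at least `2/3 ‖ζ‖`; after a displacement of `3/7 ‖ζ‖` it keeps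
        -- `5/14 > 1/4` of itself.
        rcases le_total |ζ.im| ζ.re with h9 | h9
        · right
          have : ‖ζ‖ ≤ 3 / 2 * ζ.re := by
            refine abs_le_of_sq_le_sq' ?_ (by positivity) |>.2
            have := sq_le_sq' (by linarith [abs_nonneg ζ.im]) h9
            rw [sq_abs] at this
            nlinarith
          have := (abs_le.1 h6).1
          linarith
        · left
          have : ‖ζ‖ ≤ 3 / 2 * |ζ.im| := by
            refine abs_le_of_sq_le_sq' ?_ (by positivity) |>.2
            have := sq_le_sq' (by linarith [abs_nonneg ζ.im]) h9
            rw [sq_abs] at this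
            nlinarith [sq_abs ζ.im]
          have h10 := abs_sub_abs_le_abs_sub ζ.im w.im
          rw [abs_sub_comm] at h10
          linarith

/-- The inverse of the slit chart on an attracting domain. -/
theorem exists_slitChart_inverse (hκ : 1 ≤ κ) (α : ℝ) : ∃ R₀ : ℝ, 4 ≤ R₀ ∧ ∃ V : ℂ → ℂ,
    (∀ X ∈ attr R₀, V X ∈ Complex.slitPlane ∧ 1 < κ * ‖V X‖ ∧ slitChart κ α (V X) = X ∧
      HasDerivAt V (1 - α / V X)⁻¹ X ∧ ‖(1 - α / V X)⁻¹‖ ≤ 2 ∧ ‖X‖ / 2 ≤ ‖V X‖ ∧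
      ‖V X‖ ≤ 2 * ‖X‖) ∧
    (∀ R, R₀ ≤ R → ∀ X ∈ attr R, V X ∈ attr (R / 4)) ∧
    ∀ w ∈ Complex.slitPlane, 1 < κ * ‖w‖ → slitChart κ α w ∈ attr R₀ →
      V (slitChart κ α w) = w := by
  obtain ⟨R₀, hR4, hRα, hcell⟩ := exists_slitChart_cell hκ α
  have hκ0 : 0 < κ := by linarith
  have hα2 : 2 * |α| / R₀ ≤ 1 / 2 := by
    rw [div_le_iff₀ (by linarith)]; linarith [abs_nonneg α]
  have hcontr : ∀ (S : Set ℂ), Convex ℝ S → S ⊆ Complex.slitPlane → (∀ w ∈ S, R₀ / 2 ≤ ‖w‖) →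
      ∀ w ∈ S, ∀ w' ∈ S, ‖(α : ℂ) * Complex.log (κ * w) - α * Complex.log (κ * w')‖ ≤
        1 / 2 * ‖w - w'‖ := by
    intro S h1 h2 h3 w hw w' hw'
    have h4 := norm_log_sub_log_le hκ0 h1 h2 (by linarith) h3 hw hw'
    rw [← mul_sub, norm_mul, Complex.norm_real, Real.norm_eq_abs]
    calc |α| * _ ≤ |α| * (1 / (R₀ / 2) * ‖w - w'‖) := by gcongr
      _ = (2 * |α| / R₀) * ‖w - w'‖ := by field_simp
      _ ≤ _ := mul_le_mul_of_nonneg_right hα2 (norm_nonneg _)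
  have hex : ∀ X ∈ attr R₀, ∃ w ∈ Complex.slitPlane, 1 < κ * ‖w‖ ∧ slitChart κ α w = X := by
    intro X hX
    obtain ⟨S, hSc, hSv, ⟨x, hx⟩, hSs, hSr, hSm, -⟩ := hcell R₀ le_rfl X hX
    have hcw : ContractingWith (1 / 2) (hSm.restrict _ S S) := by
      refine ⟨by norm_num, LipschitzWith.of_dist_le_mul fun y y' => ?_⟩
      have := hcontr S hSv hSs hSr y y.2 y' y'.2
      simpa [Subtype.dist_eq, dist_eq_norm] using this
    obtain ⟨w, hw, hfix, -⟩ := hcw.exists_fixedPoint' hSc.isComplete hSm hx (edist_ne_top _ _)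
    have h1 := hSr w hw
    refine ⟨w, hSs hw, by nlinarith, ?_⟩
    have h2 : X + α * Complex.log (κ * w) = w := hfix
    rw [slitChart]
    linear_combination -h2
  -- All preimages of a point lie in the same cell, where the fixed point is unique.
  have hinj : ∀ w ∈ Complex.slitPlane, ∀ w' ∈ Complex.slitPlane, 1 < κ * ‖w‖ → 1 < κ * ‖w'‖ →
      slitChart κ α w ∈ attr R₀ → slitChart κ α w = slitChart κ α w' → w = w' := by
    intro w hw w' hw' h1 h1' hm he
    obtain ⟨S, -, hSv, -, hSs, hSr, -, hS⟩ := hcell R₀ le_rfl _ hm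
    have h2 := hcontr S hSv hSs hSr w (hS w hw h1.le rfl).1 w' (hS w' hw' h1'.le he.symm).1
    have h3 : w - w' = (α : ℂ) * Complex.log (κ * w) - α * Complex.log (κ * w') := by
      simp only [slitChart] at he; linear_combination he
    rw [← h3] at h2
    have : ‖w - w'‖ = 0 := by linarith [norm_nonneg (w - w')]
    exact sub_eq_zero.1 (norm_eq_zero.1 this)
  choose! V hV1 hV2 hV3 using hex
  have hVE : ∀ w ∈ Complex.slitPlane, 1 < κ * ‖w‖ → slitChart κ α w ∈ attr R₀ →
      V (slitChart κ α w) = w := fun w hw h1 hm =>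
    hinj _ (hV1 _ hm) w hw (hV2 _ hm) h1 (by rw [hV3 _ hm]; exact hm) (hV3 _ hm)
  have hloc : ∀ R, R₀ ≤ R → ∀ X ∈ attr R, V X ∈ attr (R / 4) ∧ ‖X‖ / 2 ≤ ‖V X‖ ∧
      ‖V X‖ ≤ 2 * ‖X‖ := by
    intro R hR X hX
    obtain ⟨S, -, -, -, -, -, -, hS⟩ := hcell R hR X hX
    have hX0 := attr_anti hR hX
    have := hS (V X) (hV1 X hX0) (hV2 X hX0).le (hV3 X hX0)
    exact ⟨this.2.1, this.2.2.1, this.2.2.2⟩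
  refine ⟨R₀, hR4, V, fun X hX => ?_, fun R hR X hX => (hloc R hR X hX).1, hVE⟩
  obtain ⟨hlow, hup⟩ := (hloc R₀ le_rfl X hX).2
  have hXn := lt_norm_of_mem_attr hX
  have hsmall : ‖(α : ℂ) / V X‖ ≤ 1 / 2 := by
    rw [norm_div, Complex.norm_real, Real.norm_eq_abs, div_le_iff₀ (by linarith)]
    linarith [abs_nonneg α]
  have hge : 1 / 2 ≤ ‖1 - (α : ℂ) / V X‖ := by
    have := norm_sub_norm_le (1 : ℂ) ((α : ℂ) / V X)
    rw [norm_one] at this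
    linarith
  have hne : 1 - (α : ℂ) / V X ≠ 0 := by
    intro h; rw [h, norm_zero] at hge; linarith
  refine ⟨hV1 X hX, hV2 X hX, hV3 X hX, ?_, ?_, hlow, hup⟩
  -- The inverse `V` comes from choice; it is differentiable because injectivity identifies it with
  -- the local inverse near each point.
  · have hs := hasStrictDerivAt_slitChart (α := α) hκ0 (hV1 X hX)
    have h1 := hs.eventually_right_inverse hne
    have h2 := (hs.to_localInverse hne).hasDerivAt
    have h3 : hs.localInverse _ _ _ hne (slitChart κ α (V X)) = V X :=
      HasStrictFDerivAt.localInverse_apply_image ..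
    rw [hV3 X hX] at h1 h2 h3
    refine h2.congr_of_eventuallyEq ?_
    have hcont := h2.continuousAt.tendsto
    rw [h3] at hcont
    have h4 := hcont.eventually (Complex.isOpen_slitPlane.mem_nhds (hV1 X hX))
    have h5 := (hcont.norm.const_mul κ).eventually (lt_mem_nhds (hV2 X hX))
    filter_upwards [h1, h4, h5, (isOpen_attr R₀).mem_nhds hX] with Y hY1 hY2 hY3 hY4
    conv_lhs => rw [← hY1]
    exact hVE _ hY2 hY3 (by rw [hY1]; exact hY4)
  · rw [norm_inv]
    exact inv_le_of_inv_le₀ (by norm_num) (by simpa using hge)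

end SlitChart

end
end AntiParabolic

namespace AntiParabolic
section

/-! ### Petals in normalized time charts -/

/-- The sign bringing the image of a petal in its time chart to an attracting domain. -/
noncomputable def sgn (j : ℤ) : ℝ := if Odd j then 1 else -1

theorem sgn_mul_self (j : ℤ) : sgn j * sgn j = 1 := by unfold sgn; split_ifs <;> norm_num

theorem sgn_mul_self' (j : ℤ) : (sgn j : ℂ) * sgn j = 1 := by exact_mod_cast sgn_mul_self j

theorem abs_sgn (j : ℤ) : |sgn j| = 1 := by unfold sgn; split_ifs <;> norm_num

theorem norm_sgn (j : ℤ) : ‖(sgn j : ℂ)‖ = 1 := by simp [abs_sgn]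

theorem sgn_neg (j : ℤ) : sgn (-j) = sgn j := by simp [sgn]

/-- The time chart normalized so that its image is an attracting domain. -/
noncomputable def normChart (k : ℕ) (b : ℝ) (j : ℤ) (z : ℂ) : ℂ := sgn j * timeChart k b j z

theorem timeChart_eq (k : ℕ) (b : ℝ) (j : ℤ) (z : ℂ) :
    timeChart k b j z = sgn j * normChart k b j z := by
  rw [normChart, ← mul_assoc, sgn_mul_self', one_mul]

theorem mem_timeDomain_iff {R : ℝ} {j : ℤ} {Z : ℂ} : Z ∈ timeDomain R j ↔ (sgn j : ℂ) * Z ∈ attr R := by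
  unfold timeDomain attr sgn
  by_cases hj : Odd j
  · have : ¬ Even j := Int.not_even_iff_odd.2 hj
    simp [hj, this]
  · have : Even j := Int.not_odd_iff_even.1 hj
    simp only [hj, this, Set.mem_ofPred_eq]
    simp [lt_neg]

variable {k : ℕ} {b : ℝ} {j : ℤ} {z : ℂ} {R : ℝ}

theorem mem_petal_iff : z ∈ petal k b R j ↔
    z ≠ 0 ∧ ‖z‖ < 1 ∧ |Complex.arg (rot k j z)| < π / k ∧ normChart k b j z ∈ attr R := by
  simp only [petal, Set.mem_ofPred_eq, mem_timeDomain_iff, normChart]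

theorem petal_anti {R R' : ℝ} (h : R ≤ R') : petal k b R' j ⊆ petal k b R j := by
  intro z hz
  rw [mem_petal_iff] at hz ⊢
  exact ⟨hz.1, hz.2.1, hz.2.2.1, attr_anti h hz.2.2.2⟩

theorem norm_rot (k : ℕ) (j : ℤ) (z : ℂ) : ‖rot k j z‖ = ‖z‖ := by
  have : -((j : ℂ) * π / k) * Complex.I = ((-(j * π / k) : ℝ) : ℂ) * Complex.I := by push_cast; ring
  rw [rot, norm_mul, this, Complex.norm_exp_ofReal_mul_I, mul_one]

theorem rot_ne_zero (hz : z ≠ 0) : rot k j z ≠ 0 := by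
  rw [← norm_ne_zero_iff, norm_rot]; simpa using hz

theorem exp_int_mul_pi (j : ℤ) : Complex.exp (-((j : ℂ) * π) * Complex.I) = -(sgn j : ℂ) := by
  unfold sgn
  split_ifs with hj
  · obtain ⟨m, rfl⟩ := hj
    have : -(((2 * m + 1 : ℤ) : ℂ) * π) * Complex.I = ((-m : ℤ) : ℂ) * (2 * π * Complex.I) - π * Complex.I := by
      push_cast; ring
    rw [this, Complex.exp_sub, Complex.exp_int_mul_two_pi_mul_I, Complex.exp_pi_mul_I]
    norm_num
  · obtain ⟨m, rfl⟩ := Int.not_odd_iff_even.1 hj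
    have : -(((m + m : ℤ) : ℂ) * π) * Complex.I = ((-m : ℤ) : ℂ) * (2 * π * Complex.I) := by
      push_cast; ring
    rw [this, Complex.exp_int_mul_two_pi_mul_I]
    norm_num

theorem rot_pow (hk : 1 ≤ k) (j : ℤ) (z : ℂ) : rot k j z ^ k = -(sgn j : ℂ) * z ^ k := by
  have hk0 : (k : ℂ) ≠ 0 := by exact_mod_cast (by omega : k ≠ 0)
  rw [rot, mul_pow, ← Complex.exp_nat_mul, ← exp_int_mul_pi, mul_comm]
  congr 2
  field_simp

/-- The sign of the normalized chart cancels the sign of `rot k j z ^ k / z ^ k`. All petals get the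
same leading term, and the parity of `j` only changes the sign of `b`. -/
theorem normChart_eq (hk : 1 ≤ k) (hz : z ≠ 0) :
    normChart k b j z = 1 / (k * rot k j z ^ k) + (sgn j * b : ℝ) * Complex.log (rot k j z) := by
  have hk0 : (k : ℂ) ≠ 0 := by exact_mod_cast (by omega : k ≠ 0)
  have hs : (sgn j : ℂ) ≠ 0 := by rw [← norm_ne_zero_iff, norm_sgn]; norm_num
  have hzk : z ^ k ≠ 0 := pow_ne_zero _ hz
  have h2 := sgn_mul_self' j
  rw [normChart, timeChart, rot_pow hk]
  push_cast
  field_simp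
  linear_combination (k * b * z ^ k * Complex.log (rot k j z) * sgn j - 1) * h2 - k * b * z ^ k * Complex.log (rot k j z) * sgn j * h2

/-- A point in the sector of a petal in the coordinate `w = 1 / (k u ^ k)`. -/
theorem slit_coordinate (hk : 1 ≤ k) (hz : z ≠ 0) (harg : |Complex.arg (rot k j z)| < π / k) :
    1 / ((k : ℂ) * rot k j z ^ k) ∈ Complex.slitPlane ∧
    Complex.log ((k : ℝ) * (1 / ((k : ℂ) * rot k j z ^ k))) = -k * Complex.log (rot k j z) ∧
    normChart k b j z = slitChart k (sgn j * b / k) (1 / ((k : ℂ) * rot k j z ^ k)) ∧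
    k * ‖1 / ((k : ℂ) * rot k j z ^ k)‖ = (‖z‖ ^ k)⁻¹ := by
  have hk0 : (k : ℂ) ≠ 0 := by exact_mod_cast (by omega : k ≠ 0)
  have hkr : (0 : ℝ) < k := by exact_mod_cast hk
  have hu := rot_ne_zero (k := k) (j := j) hz
  have huk : rot k j z ^ k ≠ 0 := pow_ne_zero _ hu
  have h1 : ((k : ℝ) : ℂ) * (1 / ((k : ℂ) * rot k j z ^ k)) =
      Complex.exp (-k * Complex.log (rot k j z)) := by
    rw [neg_mul, Complex.exp_neg, Complex.exp_nat_mul, Complex.exp_log hu]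
    push_cast
    field_simp
  have him : (-k * Complex.log (rot k j z)).im = -(k * Complex.arg (rot k j z)) := by
    have : (-(k : ℂ) * Complex.log (rot k j z)) = ((-k : ℝ) : ℂ) * Complex.log (rot k j z) := by
      push_cast; ring
    rw [this, Complex.im_ofReal_mul, Complex.log_im]; ring
  have hb : |k * Complex.arg (rot k j z)| < π := by
    rw [abs_mul, abs_of_pos hkr, mul_comm]
    exact (lt_div_iff₀ hkr).1 harg
  have hb' := abs_lt.1 hb
  -- The sector `|arg| < π / k` is exactly what keeps `-k * log` inside the principal strip.
  have h2 : Complex.log ((k : ℝ) * (1 / ((k : ℂ) * rot k j z ^ k))) =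
      -k * Complex.log (rot k j z) := by
    rw [h1, Complex.log_exp] <;> rw [him] <;> linarith [hb'.1, hb'.2]
  have h3 : 1 / ((k : ℂ) * rot k j z ^ k) ∈ Complex.slitPlane := by
    have h4 : ((k : ℝ) : ℂ) * (1 / ((k : ℂ) * rot k j z ^ k)) ∈ Complex.slitPlane := by
      rw [Complex.mem_slitPlane_iff_arg]
      refine ⟨?_, by rw [h1]; exact Complex.exp_ne_zero _⟩
      rw [← Complex.log_im, h2, him]
      linarith [hb'.1]
    have h5 := ofReal_mul_mem_slitPlane (inv_pos.2 hkr) h4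
    rwa [← mul_assoc, ← Complex.ofReal_mul, inv_mul_cancel₀ hkr.ne', Complex.ofReal_one, one_mul]
      at h5
  refine ⟨h3, h2, ?_, ?_⟩
  · rw [normChart_eq hk hz, slitChart, h2]
    push_cast
    field_simp
    ring
  · rw [norm_div, norm_mul, norm_pow, norm_rot]
    simp
    field_simp

theorem rot_neg_conj (k : ℕ) (j : ℤ) (z : ℂ) : rot k (-j) (conj z) = conj (rot k j z) := by
  rw [rot, rot, map_mul, ← Complex.exp_conj]
  congr 2
  simp only [map_mul, map_neg, map_div₀, map_intCast, map_natCast, Complex.conj_ofReal,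
    Complex.conj_I]
  push_cast
  ring

theorem abs_arg_conj_lt (hk : 1 ≤ k) {u : ℂ} (h : |Complex.arg u| < π / k) :
    Complex.log (conj u) = conj (Complex.log u) ∧ |Complex.arg (conj u)| < π / k := by
  have h1 : π / k ≤ π := div_le_self Real.pi_pos.le (by exact_mod_cast hk)
  have h2 : Complex.arg u ≠ π := by
    intro h'; rw [h', abs_of_pos Real.pi_pos] at h; linarith
  refine ⟨Complex.log_conj _ h2, ?_⟩
  rw [Complex.arg_conj, if_neg h2, abs_neg]
  exact h

theorem timeChart_conj (hk : 1 ≤ k) (h : |Complex.arg (rot k j z)| < π / k) :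
    timeChart k b (-j) (conj z) = conj (timeChart k b j z) := by
  rw [timeChart, timeChart, rot_neg_conj, (abs_arg_conj_lt hk h).1]
  simp

theorem conj_mem_petal (hk : 1 ≤ k) (h : z ∈ petal k b R j) : conj z ∈ petal k b R (-j) := by
  rw [mem_petal_iff] at h ⊢
  obtain ⟨h1, h2, h3, h4⟩ := h
  refine ⟨by simpa using h1, by simpa using h2, ?_, ?_⟩
  · rw [rot_neg_conj]; exact (abs_arg_conj_lt hk h3).2
  · rw [normChart, timeChart_conj hk h3, sgn_neg, ← Complex.conj_ofReal, ← map_mul, conj_mem_attr]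
    exact h4

theorem rot_glue (hk : 1 ≤ k) (z : ℂ) : rot k (-(k : ℤ)) z = rot k k z := by
  have hk0 : (k : ℂ) ≠ 0 := by exact_mod_cast (by omega : k ≠ 0)
  rw [rot, rot]
  congr 1
  have h1 : -(((-(k : ℤ) : ℤ) : ℂ) * π / k) * Complex.I = π * Complex.I := by
    push_cast; field_simp
  have h2 : -(((k : ℤ) : ℂ) * π / k) * Complex.I = -(π * Complex.I) := by
    push_cast; field_simp
  rw [h1, h2, Complex.exp_neg, Complex.exp_pi_mul_I]
  norm_num

theorem timeChart_glue (hk : 1 ≤ k) (z : ℂ) :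
    timeChart k b (-(k : ℤ)) z = timeChart k b k z := by
  rw [timeChart, timeChart, rot_glue hk]

theorem petal_glue (hk : 1 ≤ k) : petal k b R (-(k : ℤ)) = petal k b R k := by
  ext z
  rw [mem_petal_iff, mem_petal_iff, normChart, normChart, timeChart_glue hk, rot_glue hk, sgn_neg]

theorem rot_succ (k : ℕ) (j : ℤ) (z : ℂ) :
    rot k j z = rot k (j - 1) z * Complex.exp (-(π / k : ℝ) * Complex.I) := by
  rw [rot, rot, mul_assoc, ← Complex.exp_add]
  congr 2
  push_cast
  ring

/-- Passage from the chart of index `j - 1` to the chart of index `j`. -/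
theorem log_rot_succ (hk : 1 ≤ k) (hz : z ≠ 0) (h0 : 0 < Complex.arg (rot k (j - 1) z))
    (h1 : Complex.arg (rot k (j - 1) z) < π / k) :
    Complex.log (rot k j z) = Complex.log (rot k (j - 1) z) - (π / k : ℝ) * Complex.I := by
  have hu := rot_ne_zero (k := k) (j := j - 1) hz
  have h2 : π / k ≤ π := div_le_self Real.pi_pos.le (by exact_mod_cast hk)
  have h3 : rot k j z = Complex.exp (Complex.log (rot k (j - 1) z) - (π / k : ℝ) * Complex.I) := by
    rw [rot_succ, sub_eq_add_neg (Complex.log _), Complex.exp_add, Complex.exp_log hu, neg_mul]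
  rw [h3, Complex.log_exp] <;> simp only [Complex.sub_im, Complex.log_im, Complex.im_ofReal_mul,
    Complex.I_im, mul_one] <;> linarith

theorem log_rot_pred (hk : 1 ≤ k) (hz : z ≠ 0) (h0 : Complex.arg (rot k j z) < 0)
    (h1 : -(π / k) < Complex.arg (rot k j z)) :
    Complex.log (rot k (j - 1) z) = Complex.log (rot k j z) + (π / k : ℝ) * Complex.I := by
  have hu := rot_ne_zero (k := k) (j := j) hz
  have h2 : π / k ≤ π := div_le_self Real.pi_pos.le (by exact_mod_cast hk)
  have h3 : rot k (j - 1) z =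
      Complex.exp (Complex.log (rot k j z) + (π / k : ℝ) * Complex.I) := by
    rw [Complex.exp_add, Complex.exp_log hu, rot_succ k j, mul_assoc, ← Complex.exp_add]
    simp
  rw [h3, Complex.log_exp] <;> simp only [Complex.add_im, Complex.log_im, Complex.im_ofReal_mul,
    Complex.I_im, mul_one] <;> linarith

theorem timeChart_succ (hk : 1 ≤ k) (hz : z ≠ 0) (h0 : 0 < Complex.arg (rot k (j - 1) z))
    (h1 : Complex.arg (rot k (j - 1) z) < π / k) :
    timeChart k b j z = timeChart k b (j - 1) z - Complex.I * π * b / k ∧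
    |Complex.arg (rot k j z)| < π / k := by
  have h := log_rot_succ hk hz h0 h1
  constructor
  · rw [timeChart, timeChart, h]; push_cast; ring
  · rw [← Complex.log_im, h]
    simp only [Complex.sub_im, Complex.log_im, Complex.im_ofReal_mul, Complex.I_im, mul_one]
    rw [abs_lt]; constructor <;> linarith

/-- The sign of the argument on a petal, read in the time chart. -/
theorem arg_rot_sign (hk : 1 ≤ k) (hz : z ∈ petal k b R j) (hR : |b| * π ≤ R) :
    (R < (normChart k b j z).im → Complex.arg (rot k j z) < 0) ∧
    ((normChart k b j z).im < -R → 0 < Complex.arg (rot k j z)) := by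
  obtain ⟨hz0, -, harg, -⟩ := mem_petal_iff.1 hz
  obtain ⟨-, hlog, hX, -⟩ := slit_coordinate (b := b) hk hz0 harg
  have hkr : (1 : ℝ) ≤ k := by exact_mod_cast hk
  have hk0 : (0 : ℝ) < k := by linarith
  set w : ℂ := 1 / ((k : ℂ) * rot k j z ^ k) with hw
  have hwarg : Complex.arg ((k : ℝ) * w) = -(k * Complex.arg (rot k j z)) := by
    rw [← Complex.log_im, hlog]
    have : (-(k : ℂ) * Complex.log (rot k j z)) = ((-k : ℝ) : ℂ) * Complex.log (rot k j z) := by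
      push_cast; ring
    rw [this, Complex.im_ofReal_mul, Complex.log_im]; ring
  have him : (normChart k b j z).im = w.im + sgn j * b * Complex.arg (rot k j z) := by
    rw [hX, slitChart, Complex.sub_im, Complex.im_ofReal_mul, Complex.log_im, hwarg]
    field_simp
    ring
  -- The logarithmic term shifts the imaginary part by at most `|b| π`, so beyond this height the
  -- sign of the imaginary part is that of `w`, opposite to that of the argument.
  have hbd : |sgn j * b * Complex.arg (rot k j z)| ≤ |b| * π := by
    rw [abs_mul, abs_mul, abs_sgn, one_mul]
    gcongr
    exact Complex.abs_arg_le_pi _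
  have hbd' := abs_le.1 hbd
  have hwim : w.im = (1 / k) * ((k : ℝ) * w : ℂ).im := by
    rw [Complex.im_ofReal_mul]; field_simp
  constructor
  · intro h
    have h1 : 0 < w.im := by linarith [hbd'.2]
    have h2 : 0 < ((k : ℝ) * w : ℂ).im := by rw [Complex.im_ofReal_mul]; positivity
    have h3 : 0 ≤ Complex.arg ((k : ℝ) * w) := Complex.arg_nonneg_iff.2 h2.le
    rw [hwarg] at h3
    rcases lt_or_eq_of_le (by nlinarith : Complex.arg (rot k j z) ≤ 0) with h4 | h4
    · exact h4
    · rw [h4, mul_zero, neg_zero, Complex.arg_eq_zero_iff] at hwarg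
      linarith [hwarg.2]
  · intro h
    have h1 : w.im < 0 := by linarith [hbd'.1]
    have h2 : ((k : ℝ) * w : ℂ).im < 0 := by rw [Complex.im_ofReal_mul]; nlinarith
    have h3 : Complex.arg ((k : ℝ) * w) < 0 := Complex.arg_neg_iff.2 h2
    rw [hwarg] at h3
    by_contra h4
    nlinarith

end
end AntiParabolic

namespace AntiParabolic
section

/-! ### ### Inverse time charts and perturbations inside petals -/

variable {k : ℕ} {b : ℝ} {j : ℤ} {z : ℂ} {R : ℝ}

theorem norm_pow_le_of_orderGE {n : ℕ} {e : ℂ → ℂ} (h : OrderGE n e) :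
    ∃ C : ℝ, 0 ≤ C ∧ ∃ r : ℝ, 0 < r ∧ ∀ z, ‖z‖ < r → ‖e z‖ ≤ C * ‖z‖ ^ n := by
  obtain ⟨C, hC, hb⟩ := IsBigO.exists_nonneg h
  obtain ⟨r, hr, hb⟩ := Metric.eventually_nhds_iff.1 hb.bound
  exact ⟨C, hC, r, hr, fun z hz => by simpa using hb (by simpa using hz)⟩

/-- Holomorphic inverses of the normalized time charts. -/
theorem exists_petal_charts (hk : 1 ≤ k) (b : ℝ) : ∃ R₀ : ℝ, 8 ≤ R₀ ∧ |b| * π ≤ R₀ ∧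
    ∃ V : ℤ → ℂ → ℂ,
    (∀ j, ∀ X ∈ attr R₀, V j X ∈ petal k b R₀ j ∧ normChart k b j (V j X) = X) ∧
    (∀ j, ∀ z ∈ petal k b R₀ j, V j (normChart k b j z) = z) ∧
    (∀ j, DifferentiableOn ℂ (V j) (attr R₀)) ∧
    (∀ j, ∀ z ∈ petal k b R₀ j, ‖z‖ ^ k * ‖normChart k b j z‖ ≤ 2 ∧
      1 ≤ 2 * k * (‖z‖ ^ k * ‖normChart k b j z‖)) ∧
    (∀ j, ∀ R, R₀ ≤ R → ∀ z ∈ petal k b R j, 1 / ((k : ℂ) * rot k j z ^ k) ∈ attr (R / 4)) ∧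
    ∀ j, ∀ X ∈ attr (R₀ + 1), ∀ X', ‖X' - X‖ ≤ 1 →
      ‖V j X' - V j X‖ ≤ 16 / ‖X‖ * ‖V j X‖ := by
  have hkr : (1 : ℝ) ≤ k := by exact_mod_cast hk
  have hk0 : (0 : ℝ) < k := by linarith
  have hkc : (k : ℂ) ≠ 0 := by exact_mod_cast hk0.ne'
  obtain ⟨R₁, hR₁, V₁, hV₁⟩ := exists_slitChart_inverse hkr (b / k)
  obtain ⟨R₂, hR₂, V₂, hV₂⟩ := exists_slitChart_inverse hkr (-(b / k))
  set R₀ := max (max R₁ R₂) (max 8 (|b| * π)) with hR₀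
  have hR₁' : R₁ ≤ R₀ := (le_max_left _ _).trans (le_max_left _ _)
  have hR₂' : R₂ ≤ R₀ := (le_max_right _ _).trans (le_max_left _ _)
  have h8 : 8 ≤ R₀ := (le_max_left _ _).trans (le_max_right _ _)
  have hbR : |b| * π ≤ R₀ := (le_max_right _ _).trans (le_max_right _ _)
  -- Only the two values `±b / k` of the parameter occur, so one radius serves all indices.
  have hW : ∀ j : ℤ, ∃ W : ℂ → ℂ,
      (∀ X ∈ attr R₀, W X ∈ Complex.slitPlane ∧ 1 < k * ‖W X‖ ∧
        slitChart k (sgn j * b / k) (W X) = X ∧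
        HasDerivAt W (1 - (sgn j * b / k : ℝ) / W X)⁻¹ X ∧
        ‖(1 - (sgn j * b / k : ℝ) / W X)⁻¹‖ ≤ 2 ∧ ‖X‖ / 2 ≤ ‖W X‖ ∧ ‖W X‖ ≤ 2 * ‖X‖) ∧
      (∀ R, R₀ ≤ R → ∀ X ∈ attr R, W X ∈ attr (R / 4)) ∧
      ∀ w ∈ Complex.slitPlane, 1 < k * ‖w‖ → slitChart k (sgn j * b / k) w ∈ attr R₀ →
        W (slitChart k (sgn j * b / k) w) = w := by
    intro j
    by_cases hj : Odd j
    · have : sgn j * b / k = b / k := by simp [sgn, hj]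
      rw [this]
      exact ⟨V₁, fun X hX => hV₁.1 X (attr_anti hR₁' hX), fun R hR => hV₁.2.1 R (hR₁'.trans hR),
        fun w h1 h2 h3 => hV₁.2.2 w h1 h2 (attr_anti hR₁' h3)⟩
    · have : sgn j * b / k = -(b / k) := by simp [sgn, hj, neg_div]
      rw [this]
      exact ⟨V₂, fun X hX => hV₂.1 X (attr_anti hR₂' hX), fun R hR => hV₂.2.1 R (hR₂'.trans hR),
        fun w h1 h2 h3 => hV₂.2.2 w h1 h2 (attr_anti hR₂' h3)⟩
  choose W hWa hWb hWc using hW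
  -- Solve `w = 1 / (k u ^ k)` by the principal branch of `(k w) ^ (-1/k)`, then undo the rotation.
  set V : ℤ → ℂ → ℂ := fun j X => Complex.exp (-(Complex.log ((k : ℝ) * W j X) / k)) *
    Complex.exp ((j : ℂ) * π / k * Complex.I) with hV
  have hrot : ∀ j X, rot k j (V j X) = Complex.exp (-(Complex.log ((k : ℝ) * W j X) / k)) := by
    intro j X
    rw [rot, hV, mul_assoc, ← Complex.exp_add]
    ring_nf
    simp
  have hlogrot : ∀ j, ∀ X ∈ attr R₀, Complex.log (rot k j (V j X)) =
      -(Complex.log ((k : ℝ) * W j X) / k) ∧ |Complex.arg (rot k j (V j X))| < π / k := by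
    intro j X hX
    have h1 := Complex.mem_slitPlane_iff_arg.1 (ofReal_mul_mem_slitPlane hk0 (hWa j X hX).1)
    have him : (-(Complex.log ((k : ℝ) * W j X) / k)).im = -(Complex.arg ((k : ℝ) * W j X) / k) := by
      have : -(Complex.log ((k : ℝ) * W j X) / k) =
          ((-(1 / k) : ℝ) : ℂ) * Complex.log ((k : ℝ) * W j X) := by push_cast; ring
      rw [this, Complex.im_ofReal_mul, Complex.log_im]; ring
    have h2 : |Complex.arg ((k : ℝ) * W j X)| < π := by
      rw [abs_lt]
      exact ⟨Complex.neg_pi_lt_arg _, lt_of_le_of_ne (Complex.arg_le_pi _) h1.1⟩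
    have h3 : |Complex.arg ((k : ℝ) * W j X) / k| < π / k := by
      rw [abs_div, abs_of_pos hk0]; gcongr
    have h4 : π / k ≤ π := div_le_self Real.pi_pos.le hkr
    have h5 : Complex.log (rot k j (V j X)) = -(Complex.log ((k : ℝ) * W j X) / k) := by
      rw [hrot, Complex.log_exp] <;> rw [him] <;> linarith [(abs_lt.1 h3).1, (abs_lt.1 h3).2]
    refine ⟨h5, ?_⟩
    rw [← Complex.log_im, h5, him, abs_neg]
    exact h3
  have hw : ∀ j, ∀ X ∈ attr R₀, V j X ≠ 0 ∧ 1 / ((k : ℂ) * rot k j (V j X) ^ k) = W j X := by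
    intro j X hX
    refine ⟨mul_ne_zero (Complex.exp_ne_zero _) (Complex.exp_ne_zero _), ?_⟩
    have h0 : W j X ≠ 0 := Complex.slitPlane_ne_zero (hWa j X hX).1
    have h1 : (k : ℂ) * -(Complex.log ((k : ℝ) * W j X) / k) = -Complex.log ((k : ℝ) * W j X) := by
      field_simp
    rw [hrot, ← Complex.exp_nat_mul, h1, Complex.exp_neg, Complex.exp_log (by
      push_cast; exact mul_ne_zero hkc h0)]
    push_cast
    field_simp
  have hchart : ∀ j, ∀ X ∈ attr R₀, normChart k b j (V j X) = X := by
    intro j X hX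
    obtain ⟨h1, h2⟩ := hw j X hX
    rw [(slit_coordinate (b := b) hk h1 (hlogrot j X hX).2).2.2.1, h2, (hWa j X hX).2.2.1]
  have hinv : ∀ j, ∀ z ∈ petal k b R₀ j,
      W j (normChart k b j z) = 1 / ((k : ℂ) * rot k j z ^ k) := by
    intro j z hz
    obtain ⟨hz0, hz1, harg, hX⟩ := mem_petal_iff.1 hz
    obtain ⟨h1, h2, h3, h4⟩ := slit_coordinate (b := b) hk hz0 harg
    have h5 : 0 < ‖z‖ := norm_pos_iff.2 hz0
    rw [h3] at hX ⊢
    refine hWc j _ h1 ?_ hX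
    rw [h4]
    exact (one_lt_inv₀ (by positivity)).2 (pow_lt_one₀ h5.le hz1 (by omega))
  refine ⟨R₀, h8, hbR, V, fun j X hX => ⟨?_, hchart j X hX⟩, fun j z hz => ?_, fun j X hX => ?_,
    fun j z hz => ?_, fun j R hR z hz => ?_, fun j X hX X' hXX => ?_⟩
  · obtain ⟨h1, h2⟩ := hw j X hX
    refine mem_petal_iff.2 ⟨h1, ?_, (hlogrot j X hX).2, by rwa [hchart j X hX]⟩
    obtain ⟨-, -, -, h4⟩ := slit_coordinate (b := b) hk h1 (hlogrot j X hX).2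
    have h5 := (hWa j X hX).2.1
    rw [h2] at h4
    rw [h4] at h5
    have h6 : 0 < ‖V j X‖ := norm_pos_iff.2 h1
    by_contra h7
    exact absurd h5 (not_lt.2 (inv_le_one_of_one_le₀ (one_le_pow₀ (not_lt.1 h7))))
  · obtain ⟨hz0, hz1, harg, hX⟩ := mem_petal_iff.1 hz
    obtain ⟨h1, h2, h3, h4⟩ := slit_coordinate (b := b) hk hz0 harg
    have h5 : rot k j (V j (normChart k b j z)) = rot k j z := by
      rw [hrot, hinv j z hz, h2]
      have : -(-(k : ℂ) * Complex.log (rot k j z) / k) = Complex.log (rot k j z) := by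
        field_simp
      rw [this, Complex.exp_log (rot_ne_zero hz0)]
    exact mul_right_cancel₀ (Complex.exp_ne_zero _) h5
  · have h1 := hWa j X hX
    have h2 : DifferentiableAt ℂ (fun X => Complex.log ((k : ℝ) * W j X)) X :=
      ((h1.2.2.2.1.differentiableAt.const_mul _).clog (ofReal_mul_mem_slitPlane hk0 h1.1))
    exact (((h2.div_const _).neg.cexp).mul_const _).differentiableWithinAt
  · have h0 := (mem_petal_iff.1 hz).1
    have hX := (mem_petal_iff.1 hz).2.2.2
    obtain ⟨-, -, -, h4⟩ := slit_coordinate (b := b) hk h0 (mem_petal_iff.1 hz).2.2.1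
    obtain ⟨-, -, -, -, -, h5, h6⟩ := hWa j _ hX
    rw [hinv j z hz] at h5 h6
    set N := ‖1 / ((k : ℂ) * rot k j z ^ k)‖
    have hzk : 0 < ‖z‖ ^ k := pow_pos (norm_pos_iff.2 h0) k
    have h7 : ‖z‖ ^ k * (k * N) = 1 := by rw [h4]; field_simp
    have hN : 0 ≤ N := norm_nonneg _
    constructor
    · have : ‖z‖ ^ k * ‖normChart k b j z‖ ≤ ‖z‖ ^ k * (2 * (k * N)) := by
        gcongr; nlinarith
      linarith
    · have : ‖z‖ ^ k * (k * N) ≤ ‖z‖ ^ k * (k * (2 * ‖normChart k b j z‖)) := by gcongr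
      linarith
  · have h1 := hWb j R hR _ (mem_petal_iff.1 hz).2.2.2
    rwa [hinv j z (petal_anti hR hz)] at h1
  · have hXn := lt_norm_of_mem_attr hX
    have hsub : Metric.closedBall X 1 ⊆ attr R₀ := by
      intro Y hY
      rw [Metric.mem_closedBall, dist_eq_norm] at hY
      exact mem_attr_of_norm_sub_lt hX hY (by linarith)
    -- The logarithmic derivative of `W` has size `2 / ‖W‖`, and `‖W‖ ≥ ‖X‖ / 4` on the unit ball
    -- around `X`.
    have hL : ‖Complex.log ((k : ℝ) * W j X') - Complex.log ((k : ℝ) * W j X)‖ ≤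
        8 / ‖X‖ * ‖X' - X‖ := by
      refine (convex_closedBall X 1).norm_image_sub_le_of_norm_hasDerivWithin_le
        (f := fun Y => Complex.log ((k : ℝ) * W j Y)) (C := 8 / ‖X‖)
        (f' := fun Y => 1 / W j Y * (1 - (sgn j * b / k : ℝ) / W j Y)⁻¹) (fun Y hY => ?_)
        (fun Y hY => ?_) (Metric.mem_closedBall_self zero_le_one)
        (by simpa [dist_eq_norm] using hXX)
      · have h1 := hWa j Y (hsub hY)
        exact ((hasStrictDerivAt_log_mul hk0 h1.1).hasDerivAt.comp Y
          h1.2.2.2.1).hasDerivWithinAt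
      · obtain ⟨-, -, -, -, h5, h6, -⟩ := hWa j Y (hsub hY)
        rw [Metric.mem_closedBall, dist_eq_norm] at hY
        have h7 : ‖X‖ ≤ ‖Y‖ + 1 := by
          have := norm_sub_le Y (Y - X); simp only [sub_sub_cancel] at this; linarith
        have h8 : ‖X‖ / 4 ≤ ‖W j Y‖ := by linarith
        rw [norm_mul, norm_div, norm_one]
        calc 1 / ‖W j Y‖ * _ ≤ 1 / (‖X‖ / 4) * 2 := by gcongr; linarith
          _ = 8 / ‖X‖ := by field_simp; norm_num
    have hL' : 8 / ‖X‖ * ‖X' - X‖ ≤ 8 / ‖X‖ := by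
      exact mul_le_of_le_one_right (by positivity) hXX
    set t := -((Complex.log ((k : ℝ) * W j X') - Complex.log ((k : ℝ) * W j X)) / k) with ht
    have htn : ‖t‖ ≤ 8 / ‖X‖ := by
      rw [ht, norm_neg, norm_div, Complex.norm_natCast]
      exact (div_le_self (norm_nonneg _) hkr).trans (hL.trans hL')
    have ht1 : ‖t‖ ≤ 1 := htn.trans ((div_le_one (by linarith)).2 (by linarith))
    have heq : V j X' - V j X = (Complex.exp t - 1) * V j X := by
      have h1 : -(Complex.log ((k : ℝ) * W j X') / k) =
          t + -(Complex.log ((k : ℝ) * W j X) / k) := by rw [ht]; ring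
      simp only [hV]
      rw [h1, Complex.exp_add t]
      ring
    rw [heq, norm_mul]
    gcongr
    calc _ ≤ 2 * ‖t‖ := Complex.norm_exp_sub_one_le ht1
      _ ≤ 2 * (8 / ‖X‖) := by gcongr
      _ = _ := by ring

/-- The product of `‖z‖ ^ k` with the modulus of the chart is bounded, so a large parameter `R`
means a small petal, uniformly in the index. Estimates valid near `0` thus hold on deep petals. -/
theorem norm_lt_of_mem_petal (hk : 1 ≤ k) (b : ℝ) {ε : ℝ} (hε : 0 < ε) :
    ∃ R₀ : ℝ, 0 < R₀ ∧ ∀ j, ∀ z ∈ petal k b R₀ j, ‖z‖ < ε := by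
  obtain ⟨R₁, h8, -, V, -, -, -, hn, -⟩ := exists_petal_charts hk b
  refine ⟨max R₁ (2 / ε ^ k), lt_max_of_lt_left (by linarith), fun j z hz => ?_⟩
  have h1 := (hn j z (petal_anti (le_max_left _ _) hz)).1
  have h2 : 2 / ε ^ k < ‖normChart k b j z‖ :=
    (le_max_right _ _).trans_lt (lt_norm_of_mem_attr (mem_petal_iff.1 hz).2.2.2)
  rw [div_lt_iff₀ (by positivity)] at h2
  by_contra h3
  have h4 : ε ^ k ≤ ‖z‖ ^ k := by gcongr; exact not_lt.1 h3
  nlinarith [norm_nonneg (normChart k b j z)]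

/-- Points at distance `O(z ^ (k+1))` of `z` are in the same petals, at bounded distance in the
time charts. -/
theorem exists_petal_perturbation (hk : 1 ≤ k) (b : ℝ) {K : ℝ} (hK : 0 ≤ K) :
    ∃ R₀ : ℝ, 0 < R₀ ∧ ∃ K' : ℝ, 0 ≤ K' ∧ ∀ j, ∀ z ∈ petal k b R₀ j, ∀ y,
      ‖y - z‖ ≤ K * ‖z‖ ^ (k + 1) →
      Complex.log (rot k j y) = Complex.log (rot k j z) + Complex.log (y / z) ∧
      ‖normChart k b j y - normChart k b j z‖ ≤ K' ∧
      ∀ R R', z ∈ petal k b R j → R' ≤ R - K' → y ∈ petal k b R' j := by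
  have hkr : (1 : ℝ) ≤ k := by exact_mod_cast hk
  have hk0 : (0 : ℝ) < k := by linarith
  have hkc : (k : ℂ) ≠ 0 := by exact_mod_cast hk0.ne'
  obtain ⟨R₁, h8, -, V, -, -, -, hn, hloc, -⟩ := exists_petal_charts hk b
  obtain ⟨R₂, -, hsmall⟩ := norm_lt_of_mem_petal hk b (ε := 1 / 2) (by norm_num)
  set R₀ := max (max R₁ R₂) (8 * K * k + 32 * K + 4) with hR₀
  have hR₁ : R₁ ≤ R₀ := (le_max_left _ _).trans (le_max_left _ _)
  have hR₂ : R₂ ≤ R₀ := (le_max_right _ _).trans (le_max_left _ _)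
  have hR₃ : 8 * K * k + 32 * K + 4 ≤ R₀ := le_max_right _ _
  refine ⟨R₀, by linarith, 4 * K + |b|, by positivity, fun j z hz y hy => ?_⟩
  obtain ⟨hz0, hz1, harg, hX⟩ := mem_petal_iff.1 hz
  obtain ⟨h1, h2, h3, h4⟩ := slit_coordinate (b := b) hk hz0 harg
  have hzn : 0 < ‖z‖ := norm_pos_iff.2 hz0
  have hzk : 0 < ‖z‖ ^ k := by positivity
  set δ := y / z - 1 with hδ
  have hyz : y / z = 1 + δ := by rw [hδ]; ring
  have hyz' : y = z * (1 + δ) := by rw [← hyz]; field_simp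
  have hδn : ‖δ‖ ≤ K * ‖z‖ ^ k := by
    have : δ = (y - z) / z := by rw [hδ]; field_simp
    rw [this, norm_div, div_le_iff₀ hzn]
    calc _ ≤ K * ‖z‖ ^ (k + 1) := hy
      _ = _ := by ring
  have hzkR : ‖z‖ ^ k * R₀ ≤ 2 := by
    refine le_trans ?_ (hn j z (petal_anti hR₁ hz)).1
    gcongr
    exact (lt_norm_of_mem_attr hX).le
  have hδs : ‖δ‖ * (4 * k) ≤ 1 := by
    have h5 : ‖δ‖ * (4 * k) ≤ K * ‖z‖ ^ k * (4 * k) := by gcongr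
    have h6 : ‖z‖ ^ k * (8 * K * k) ≤ ‖z‖ ^ k * R₀ := by
      gcongr; linarith
    nlinarith
  have hδ4 : ‖δ‖ ≤ 1 / 4 := by nlinarith [norm_nonneg δ]
  have hlog1 : ‖Complex.log (1 + δ)‖ ≤ 3 / 2 * ‖δ‖ :=
    Complex.norm_log_one_add_half_le_self (by linarith)
  have h1δ : 1 + δ ≠ 0 := by
    intro h
    have : δ = -1 := by linear_combination h
    rw [this] at hδ4; norm_num at hδ4
  set u := rot k j z with hu
  have hu0 : u ≠ 0 := rot_ne_zero hz0
  have huy : rot k j y = u * (1 + δ) := by rw [hu, rot, rot, hyz']; ring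
  set w := 1 / ((k : ℂ) * u ^ k) with hw
  set w' := 1 / ((k : ℂ) * rot k j y ^ k) with hw'
  set t := -(k * Complex.log (1 + δ)) with ht
  have htn : ‖t‖ ≤ 2 * k * ‖δ‖ := by
    rw [ht, norm_neg, norm_mul, Complex.norm_natCast]
    have := mul_le_mul_of_nonneg_left hlog1 hk0.le
    have := mul_nonneg hk0.le (norm_nonneg δ)
    linarith
  have ht1 : ‖t‖ ≤ 1 := by nlinarith [norm_nonneg δ]
  have hww : w' = w * Complex.exp t := by
    rw [ht, Complex.exp_neg, Complex.exp_nat_mul, Complex.exp_log h1δ, hw', huy, hw, mul_pow]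
    field_simp
  -- A relative displacement of order `‖z‖ ^ k` is a bounded displacement of `w`, because `k * ‖w‖ *
  -- ‖z‖ ^ k = 1`.
  have hwd : ‖w' - w‖ ≤ 4 * K := by
    have : w' - w = w * (Complex.exp t - 1) := by rw [hww]; ring
    rw [this, norm_mul]
    have h5 := Complex.norm_exp_sub_one_le ht1
    have h6 : ‖Complex.exp t - 1‖ ≤ 4 * k * (K * ‖z‖ ^ k) := by nlinarith
    calc ‖w‖ * ‖Complex.exp t - 1‖ ≤ ‖w‖ * (4 * k * (K * ‖z‖ ^ k)) := by gcongr
      _ = 4 * K * ((k * ‖w‖) * ‖z‖ ^ k) := by ring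
      _ = 4 * K := by rw [h4]; field_simp
  have hwa : w ∈ attr (R₀ / 4) := hloc j R₀ hR₁ z hz
  have hball : Metric.closedBall w (4 * K) ⊆ attr (R₀ / 4 - 4 * K) := by
    intro Y hY
    rw [Metric.mem_closedBall, dist_eq_norm] at hY
    exact mem_attr_of_norm_sub_le hwa hY
  have hR4 : 4 * K + 1 ≤ R₀ / 4 - 4 * K := by nlinarith [mul_nonneg hK hk0.le]
  have hw'm : w' ∈ Metric.closedBall w (4 * K) := by simpa [dist_eq_norm] using hwd
  have hw's : w' ∈ Complex.slitPlane := attr_subset_slitPlane (by linarith) (hball hw'm)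
  have hld : ‖Complex.log ((k : ℝ) * w') - Complex.log ((k : ℝ) * w)‖ ≤ 1 := by
    have h5 := norm_log_sub_log_le hk0 (convex_closedBall w (4 * K))
      (fun Y hY => attr_subset_slitPlane (by linarith) (hball hY)) (r := 4 * K + 1) (by positivity)
      (fun Y hY => by linarith [lt_norm_of_mem_attr (hball hY)]) hw'm
      (Metric.mem_closedBall_self (by positivity))
    refine h5.trans ?_
    rw [one_div, inv_mul_le_iff₀ (by positivity)]
    linarith
  have hlogw : Complex.log ((k : ℝ) * w') = Complex.log ((k : ℝ) * w) + t := by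
    have hkw : ((k : ℝ) : ℂ) * w ≠ 0 := by
      push_cast; exact mul_ne_zero hkc (Complex.slitPlane_ne_zero h1)
    have hkw' : ((k : ℝ) : ℂ) * w' ≠ 0 := by
      push_cast; exact mul_ne_zero hkc (Complex.slitPlane_ne_zero hw's)
    have h5 : Complex.exp (Complex.log ((k : ℝ) * w')) =
        Complex.exp (Complex.log ((k : ℝ) * w) + t) := by
      rw [Complex.exp_add, Complex.exp_log hkw, Complex.exp_log hkw', hww]; ring
    -- The two logarithms can only differ by a multiple of `2πi`, and that multiple has norm at most
    -- `2`, so it is zero: no branch is crossed.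
    obtain ⟨n, hn⟩ := Complex.exp_eq_exp_iff_exists_int.1 h5
    have h6 : (n : ℂ) * (2 * π * Complex.I) =
        (Complex.log ((k : ℝ) * w') - Complex.log ((k : ℝ) * w)) - t := by rw [hn]; ring
    have h7 : ‖(n : ℂ) * (2 * π * Complex.I)‖ ≤ 2 := by
      rw [h6]; exact (norm_sub_le _ _).trans (by linarith)
    have h8 : ‖(n : ℂ) * (2 * π * Complex.I)‖ = |(n : ℝ)| * (2 * π) := by
      simp [abs_of_pos Real.pi_pos]
    rw [h8] at h7
    have h9 : n = 0 := by
      by_contra h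
      have : (1 : ℝ) ≤ |(n : ℝ)| := by exact_mod_cast Int.one_le_abs h
      nlinarith [Real.pi_gt_three]
    rw [hn, h9]; simp
  set v := Complex.log u + Complex.log (1 + δ) with hv
  have hvw : v = -(Complex.log ((k : ℝ) * w') / k) := by
    rw [hlogw, h2, ht, hv]; field_simp; ring
  have hvim : v.im = -(Complex.arg ((k : ℝ) * w') / k) := by
    have : v = ((-(1 / k) : ℝ) : ℂ) * Complex.log ((k : ℝ) * w') := by rw [hvw]; push_cast; ring
    rw [this, Complex.im_ofReal_mul, Complex.log_im]; ring
  have hargw : |Complex.arg ((k : ℝ) * w') / k| < π / k := by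
    have h5 := Complex.mem_slitPlane_iff_arg.1 (ofReal_mul_mem_slitPlane hk0 hw's)
    rw [abs_div, abs_of_pos hk0]
    gcongr
    rw [abs_lt]
    exact ⟨Complex.neg_pi_lt_arg _, lt_of_le_of_ne (Complex.arg_le_pi _) h5.1⟩
  have h4' : π / k ≤ π := div_le_self Real.pi_pos.le hkr
  have hlogy : Complex.log (rot k j y) = v := by
    have h5 : rot k j y = Complex.exp v := by
      rw [hv, Complex.exp_add, Complex.exp_log hu0, Complex.exp_log h1δ, huy]
    rw [h5, Complex.log_exp] <;> rw [hvim] <;> linarith [(abs_lt.1 hargw).1, (abs_lt.1 hargw).2]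
  have hy0 : y ≠ 0 := by rw [hyz']; exact mul_ne_zero hz0 h1δ
  have hXd : ‖normChart k b j y - normChart k b j z‖ ≤ 4 * K + |b| := by
    rw [normChart_eq hk hy0, normChart_eq hk hz0, hlogy, ← hu]
    have : 1 / ((k : ℂ) * rot k j y ^ k) + (sgn j * b : ℝ) * v -
        (1 / (k * u ^ k) + (sgn j * b : ℝ) * Complex.log u) =
        (w' - w) + (sgn j * b : ℝ) * Complex.log (1 + δ) := by rw [hv]; ring
    rw [this]
    refine (norm_add_le _ _).trans (add_le_add hwd ?_)
    rw [norm_mul, Complex.norm_real, Real.norm_eq_abs, abs_mul, abs_sgn, one_mul]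
    exact mul_le_of_le_one_right (abs_nonneg _) (by linarith)
  refine ⟨by rw [hlogy, hyz], hXd, fun R R' hzR hRR => mem_petal_iff.2 ⟨hy0, ?_, ?_, ?_⟩⟩
  · have h5 := hsmall j z (petal_anti hR₂ hz)
    rw [hyz', norm_mul]
    have h6 : ‖1 + δ‖ ≤ 5 / 4 := (norm_add_le _ _).trans (by rw [norm_one]; linarith)
    nlinarith [norm_nonneg (1 + δ)]
  · rw [← Complex.log_im, hlogy, hvim, abs_neg]; exact hargw
  · exact mem_attr_of_norm_sub_lt (mem_petal_iff.1 hzR).2.2.2 hXd hRR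

/-- Every point close to the origin is in the petal containing it in its middle half. -/
theorem exists_mem_petal (hk : 1 ≤ k) (b R : ℝ) : ∃ r : ℝ, 0 < r ∧ ∀ j z, z ≠ 0 → ‖z‖ < r →
    |Complex.arg (rot k j z)| ≤ π / (2 * k) → z ∈ petal k b R j := by
  have hkr : (1 : ℝ) ≤ k := by exact_mod_cast hk
  have hk0 : (0 : ℝ) < k := by linarith
  have hkc : (k : ℂ) ≠ 0 := by exact_mod_cast hk0.ne'
  have key : ∀ α : ℝ, ∃ N : ℝ, ∀ w ∈ Complex.slitPlane, |Complex.arg ((k : ℝ) * w)| ≤ π / 2 →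
      N < ‖w‖ → slitChart k α w ∈ attr R := by
    intro α
    obtain ⟨C, hC, hlog⟩ := exists_norm_log_le hkr α
    refine ⟨4 * (|R| + C) + 4, fun w hw ha hn => ?_⟩
    have hn1 : 1 ≤ k * ‖w‖ := by nlinarith [abs_nonneg R]
    have h1 := hlog w hn1
    have hre : 0 ≤ w.re := by
      have h2 : 0 ≤ ((k : ℝ) * w : ℂ).re := Complex.abs_arg_le_pi_div_two_iff.1 ha
      rw [Complex.re_ofReal_mul] at h2
      exact nonneg_of_mul_nonneg_right h2 hk0
    have hRa := le_abs_self R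
    -- In the right half-plane one of the two coordinates is at least `‖w‖ / 2`, which dominates the
    -- logarithmic term `‖w‖ / 8 + C`.
    have h2 : ‖w‖ ≤ w.re + |w.im| := by
      have := Complex.norm_le_abs_re_add_abs_im w
      rwa [abs_of_nonneg hre] at this
    have h3 := (Complex.abs_re_le_norm _).trans h1
    have h4 := (Complex.abs_im_le_norm _).trans h1
    rcases le_total |w.im| w.re with h5 | h5
    · right
      rw [slitChart, Complex.sub_re]
      linarith [(abs_le.1 h3).2]
    · left
      rw [slitChart, Complex.sub_im]
      have := abs_sub_abs_le_abs_sub w.im ((α : ℂ) * Complex.log ((k : ℝ) * w)).im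
      linarith
  obtain ⟨N₁, hN₁⟩ := key (b / k)
  obtain ⟨N₂, hN₂⟩ := key (-(b / k))
  set N := max (max N₁ N₂) 1 with hN
  have hN0 : 0 < N := lt_max_of_lt_right one_pos
  refine ⟨min 1 (1 / (k * N)), by positivity, fun j z hz hzr ha => ?_⟩
  have hzn : 0 < ‖z‖ := norm_pos_iff.2 hz
  have hz1 : ‖z‖ < 1 := hzr.trans_le (min_le_left _ _)
  have ha' : |Complex.arg (rot k j z)| < π / k := by
    refine ha.trans_lt ?_
    rw [div_lt_div_iff₀ (by positivity) hk0]
    nlinarith [Real.pi_pos]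
  obtain ⟨h1, h2, h3, h4⟩ := slit_coordinate (b := b) hk hz ha'
  set w := 1 / ((k : ℂ) * rot k j z ^ k)
  have hNw : N < ‖w‖ := by
    have h5 : ‖z‖ ^ k ≤ ‖z‖ := pow_le_of_le_one hzn.le hz1.le (by omega)
    have h6 : ‖z‖ < 1 / (k * N) := hzr.trans_le (min_le_right _ _)
    have h7 : k * N < (‖z‖ ^ k)⁻¹ := by
      rw [lt_inv_comm₀ (by positivity) (by positivity), ← one_div]
      linarith
    rw [← h4] at h7
    exact lt_of_mul_lt_mul_left h7 hk0.le
  have harg : |Complex.arg ((k : ℝ) * w)| ≤ π / 2 := by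
    rw [← Complex.log_im, h2]
    have : (-(k : ℂ) * Complex.log (rot k j z)) = ((-k : ℝ) : ℂ) * Complex.log (rot k j z) := by
      push_cast; ring
    rw [this, Complex.im_ofReal_mul, Complex.log_im, abs_mul, abs_neg, abs_of_pos hk0]
    calc k * _ ≤ k * (π / (2 * k)) := by gcongr
      _ = π / 2 := by field_simp
  refine mem_petal_iff.2 ⟨hz, hz1, ha', ?_⟩
  rw [h3]
  by_cases hj : Odd j
  · have : sgn j * b / k = b / k := by simp [sgn, hj]
    rw [this]
    exact hN₁ w h1 harg (((le_max_left _ _).trans (le_max_left _ _)).trans_lt hNw)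
  · have : sgn j * b / k = -(b / k) := by simp [sgn, hj, neg_div]
    rw [this]
    exact hN₂ w h1 harg (((le_max_right _ _).trans (le_max_left _ _)).trans_lt hNw)

end
end AntiParabolic

namespace AntiParabolic
section

/-! ### Dynamics in the time charts -/

theorem orderGE_inv_one_add_pow (k : ℕ) :
    OrderGE 3 fun x => ((1 + x) ^ k)⁻¹ - (1 - k * x + k * (k + 1) / 2 * x ^ 2) := by
  have hinv : ∀ m : ℕ, OrderGE 0 fun x => ((1 + x) ^ m)⁻¹ := by
    intro m
    have : ContinuousAt (fun x : ℂ => ((1 + x) ^ m)⁻¹) 0 :=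
      ContinuousAt.inv₀ (by fun_prop) (by simp)
    simpa [OrderGE] using this.isBigO_one ℂ
  have hne : ∀ᶠ x : ℂ in 𝓝 0, 1 + x ≠ 0 := by
    have : ContinuousAt (fun x : ℂ => 1 + x) 0 := by fun_prop
    exact this.eventually_ne (by simp)
  induction k with
  | zero => simpa using OrderGE.zero_fun 3
  | succ k ih =>
    have h1 := (ih.mul (hinv 1))
    have h2 := ((OrderGE.pow_self 3).mul (hinv 1)).const_mul ((k + 1) * (k + 2) / 2)
    refine ((h1.mono (by norm_num)).sub (h2.mono (by norm_num))).congr_ev ?_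
    filter_upwards [hne] with x hx
    push_cast
    field_simp
    ring

theorem orderGE_log_one_add : OrderGE 2 fun x => Complex.log (1 + x) - x := by
  have h0 : (1 + (0 : ℂ)) ∈ Complex.slitPlane := by simp [Complex.one_mem_slitPlane]
  have ha : AnalyticAt ℂ (fun x : ℂ => Complex.log (1 + x)) 0 :=
    AnalyticAt.clog (by fun_prop) h0
  have hd : HasDerivAt (fun x : ℂ => Complex.log (1 + x)) 1 0 := by
    have := ((hasDerivAt_id (0 : ℂ)).const_add 1).clog h0
    simpa using this
  simpa using OrderGE.of_hasDerivAt ha (by simp) hd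

variable {k : ℕ} {b : ℝ} {g g' : ℂ → ℂ}

/-- The prenormalized germs are `T_{1/2}` in the time charts, up to `O(z ^ (k+1))`. -/
theorem exists_norm_timeChart_sub_le (hk : 1 ≤ k) (b : ℝ) (hg : AnalyticAt ℂ g 0)
    (hgN : OrderGE (2 * k + 2) fun z => g z - normalJet k b z) :
    ∃ R₀ : ℝ, 0 < R₀ ∧ ∃ C : ℝ, 0 ≤ C ∧ ∀ j, ∀ z ∈ petal k b R₀ j,
      ‖timeChart k b j (g z) - timeChart k b j z - 1 / 2‖ ≤ C * ‖z‖ ^ (k + 1) := by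
  have hkc : (k : ℂ) ≠ 0 := by exact_mod_cast (by omega : k ≠ 0)
  have hgid : OrderGE (k + 1) fun z => g z - z :=
    ((hgN.mono (by omega)).add (orderGE_normalJet_sub_id k b)).congr fun z => by ring
  obtain ⟨K, hK, r, hr, hKr⟩ := norm_pow_le_of_orderGE hgid
  obtain ⟨R₁, hR₁, K', hK', hpert⟩ := exists_petal_perturbation hk b hK
  obtain ⟨s, hs, hsz⟩ := OrderGE.exists_factor (OrderGE.analyticAt_sub_id hg) hgid
  -- The relative displacement, so that `g z = z * (1 + δ z)`.
  set δ : ℂ → ℂ := fun z => z ^ k * s z with hδ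
  have hδa : AnalyticAt ℂ δ 0 := (analyticAt_id.pow k).mul hs
  have hδk : OrderGE k δ := by
    have := (OrderGE.pow_self k).mul (m := 0) (e' := s) (by
      simpa [OrderGE] using hs.continuousAt.isBigO_one ℂ)
    simpa [hδ] using this
  have hδ1 : OrderGE 1 δ := hδk.mono hk
  have hδ2 : OrderGE (2 * k + 1) fun z =>
      δ z - (1 / 2 * z ^ k + (((k : ℂ) + 1) / 8 - b / 2) * z ^ (2 * k)) := by
    refine OrderGE.of_mul_pow (n := 1) (hδa.sub (by fun_prop)) ?_
    refine (hgN.mono (m := 1 + (2 * k + 1)) (by omega)).congr_ev ?_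
    filter_upwards [hsz] with z hz
    have : g z = z + z ^ (k + 1) * s z := by rw [← hz]; ring
    rw [this, normalJet, hδ]
    ring
  have hδ3 : OrderGE (2 * k + 1) fun z => δ z ^ 2 - 1 / 4 * z ^ (2 * k) := by
    have h1 : OrderGE (k + 1) fun z => δ z - 1 / 2 * z ^ k :=
      ((hδ2.mono (by omega)).add (((OrderGE.pow_self (2 * k)).const_mul
        (((k : ℂ) + 1) / 8 - b / 2)).mono (by omega))).congr fun z => by ring
    have h2 : OrderGE k fun z => δ z + 1 / 2 * z ^ k := hδk.add ((OrderGE.pow_self k).const_mul _)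
    exact ((h1.mul h2).mono (by omega)).congr fun z => by ring
  have he1 := ((orderGE_inv_one_add_pow k).comp hδ1)
  have he1' : OrderGE (2 * k + 1) fun z =>
      ((1 + δ z) ^ k)⁻¹ - (1 - k * δ z + k * (k + 1) / 2 * δ z ^ 2) := by
    have hc : AnalyticAt ℂ (fun x : ℂ => ((1 + x) ^ k)⁻¹ -
        (1 - k * x + k * (k + 1) / 2 * x ^ 2)) 0 := by
      refine AnalyticAt.sub (AnalyticAt.inv (by fun_prop) (by simp)) (by fun_prop)
    obtain ⟨q, hq, hqz⟩ := OrderGE.exists_factor hc (orderGE_inv_one_add_pow k)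
    have h0 : OrderGE 0 fun z => q (δ z) := by
      have : ContinuousAt q (δ 0) := by rw [hδ1.eq_zero le_rfl]; exact hq.continuousAt
      simpa [OrderGE] using (ContinuousAt.comp this hδa.continuousAt).isBigO_one ℂ
    refine (((hδk.pow 3).mul h0).mono (by omega)).congr_ev ?_
    filter_upwards [(hδ1.tendsto le_rfl).eventually hqz] with z hz
    exact hz.symm
  have he2 : OrderGE (2 * k) fun z => Complex.log (1 + δ z) - δ z := by
    have h0 : (1 + (0 : ℂ)) ∈ Complex.slitPlane := by simp [Complex.one_mem_slitPlane]
    have hc : AnalyticAt ℂ (fun x : ℂ => Complex.log (1 + x) - x) 0 :=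
      (AnalyticAt.clog (by fun_prop) h0).sub analyticAt_id
    obtain ⟨q, hq, hqz⟩ := OrderGE.exists_factor hc orderGE_log_one_add
    have h0 : OrderGE 0 fun z => q (δ z) := by
      have : ContinuousAt q (δ 0) := by rw [hδ1.eq_zero le_rfl]; exact hq.continuousAt
      simpa [OrderGE] using (ContinuousAt.comp this hδa.continuousAt).isBigO_one ℂ
    refine (((hδk.pow 2).mul h0).mono (by omega)).congr_ev ?_
    filter_upwards [(hδ1.tendsto le_rfl).eventually hqz] with z hz
    exact hz.symm
  -- This is `z ^ k` times the quantity to estimate. In degree `2 * k` the coefficients are `(k+1)/8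
  -- - b/2` from `δ`, `-(k+1)/8` from its square and `b/2` from the logarithm; their sum is zero,
  -- which is the purpose of the term `b log z` in the charts.
  have hE : OrderGE (2 * k + 1) fun z => -(((1 + δ z) ^ k)⁻¹ - 1) / k +
      b * (z ^ k * Complex.log (1 + δ z)) - 1 / 2 * z ^ k := by
    have h1 := he1'.const_mul (-1 / k)
    have h2 := hδ3.const_mul (-((k : ℂ) + 1) / 2)
    have h3 := ((((OrderGE.pow_self k).mul he2).const_mul b).mono (m := 2 * k + 1) (by omega))
    have h4 := ((((OrderGE.pow_self k).mul (hδ2.mono (m := 2 * k) (by omega))).const_mul b).mono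
      (m := 2 * k + 1) (by omega))
    have h5 := ((OrderGE.pow_self (3 * k)).const_mul
      (b * (((k : ℂ) + 1) / 8 - b / 2))).mono (m := 2 * k + 1) (by omega)
    refine (((((h1.add h2).add h3).add h4).add h5).add hδ2).congr fun z => ?_
    field_simp
    ring
  obtain ⟨C, hC, r', hr', hCr⟩ := norm_pow_le_of_orderGE hE
  obtain ⟨r'', hr'', hsr⟩ := Metric.eventually_nhds_iff.1 hsz
  obtain ⟨R₂, hR₂, hsmall⟩ := norm_lt_of_mem_petal hk b (ε := min r (min r' r'')) (by positivity)
  refine ⟨max R₁ R₂, lt_max_of_lt_left hR₁, C, hC, fun j z hz => ?_⟩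
  have hz2 := hsmall j z (petal_anti (le_max_right _ _) hz)
  obtain ⟨hzr, hz2⟩ := lt_min_iff.1 hz2
  obtain ⟨hzr', hzr''⟩ := lt_min_iff.1 hz2
  have hz0 := (mem_petal_iff.1 hz).1
  have hzk : z ^ k ≠ 0 := pow_ne_zero _ hz0
  have hgz : g z = z * (1 + δ z) := by
    have := hsr (y := z) (by simpa using hzr'')
    rw [hδ]; linear_combination this
  have hgz' : g z / z = 1 + δ z := by rw [hgz]; field_simp
  obtain ⟨hlog, -, hmem⟩ := hpert j z (petal_anti (le_max_left _ _) hz) (g z) (hKr z hzr)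
  have hg0 : g z ≠ 0 := (mem_petal_iff.1 (hmem R₁ (R₁ - K') (petal_anti (le_max_left _ _) hz) le_rfl)).1
  have h1δ : 1 + δ z ≠ 0 := by
    intro h; rw [h, mul_zero] at hgz; exact hg0 hgz
  have key : z ^ k * (timeChart k b j (g z) - timeChart k b j z - 1 / 2) =
      -(((1 + δ z) ^ k)⁻¹ - 1) / k +
      b * (z ^ k * Complex.log (1 + δ z)) - 1 / 2 * z ^ k := by
    rw [timeChart, timeChart, hlog, hgz', hgz, mul_pow]
    field_simp
    ring
  have h := hCr z hzr'
  simp only [← key] at h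
  rw [norm_mul, norm_pow] at h
  have hp : 0 < ‖z‖ ^ k := pow_pos (norm_pos_iff.2 hz0) k
  refine le_of_mul_le_mul_left (h.trans (le_of_eq ?_)) hp
  ring

/-- The estimate for `g` is applied at the point `g' z`, which is of size `O(‖z‖)` and still in the
petal. It is needed for repelling petals, where orbits are taken under the inverse. -/
theorem exists_norm_timeChart_inverse_le (hk : 1 ≤ k) (b : ℝ) (hg : AnalyticAt ℂ g 0)
    (hgN : OrderGE (2 * k + 2) fun z => g z - normalJet k b z)
    (hg' : OrderGE (k + 1) fun z => g' z - z) (hinv : ∀ᶠ z in 𝓝 0, g (g' z) = z) :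
    ∃ R₀ : ℝ, 0 < R₀ ∧ ∃ C : ℝ, 0 ≤ C ∧ ∀ j, ∀ z ∈ petal k b R₀ j,
      ‖timeChart k b j (g' z) - timeChart k b j z + 1 / 2‖ ≤ C * ‖z‖ ^ (k + 1) := by
  obtain ⟨R₁, hR₁, C, hC, hb⟩ := exists_norm_timeChart_sub_le hk b hg hgN
  obtain ⟨K, hK, r, hr, hKr⟩ := norm_pow_le_of_orderGE hg'
  obtain ⟨R₂, hR₂, K', hK', hpert⟩ := exists_petal_perturbation hk b hK
  obtain ⟨K₂, hK₂, r₂, hr₂, hKr₂⟩ := norm_pow_le_of_orderGE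
    ((hg'.mono (by omega)).add OrderGE.self |>.congr (e' := g') fun z => by ring)
  obtain ⟨r₃, hr₃, hinv⟩ := Metric.eventually_nhds_iff.1 hinv
  obtain ⟨R₃, hR₃, hsmall⟩ := norm_lt_of_mem_petal hk b (ε := min r (min r₂ r₃)) (by positivity)
  refine ⟨max (R₁ + K') (max R₂ R₃), lt_max_of_lt_right (lt_max_of_lt_left hR₂),
    C * K₂ ^ (k + 1), by positivity, fun j z hz => ?_⟩
  obtain ⟨hzr, hz2⟩ := lt_min_iff.1 (hsmall j z
    (petal_anti ((le_max_right _ _).trans (le_max_right _ _)) hz))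
  obtain ⟨hzr₂, hzr₃⟩ := lt_min_iff.1 hz2
  have hm := (hpert j z (petal_anti ((le_max_left _ _).trans (le_max_right _ _)) hz) (g' z)
    (hKr z hzr)).2.2 (R₁ + K') R₁ (petal_anti (le_max_left _ _) hz) (by linarith)
  have h := hb j _ hm
  rw [hinv (y := z) (by simpa using hzr₃)] at h
  have : timeChart k b j (g' z) - timeChart k b j z + 1 / 2 =
    -(timeChart k b j z - timeChart k b j (g' z) - 1 / 2) := by ring
  rw [this, norm_neg]
  refine h.trans ?_
  rw [mul_assoc, ← mul_pow]
  gcongr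
  simpa using hKr₂ z hzr₂

end
end AntiParabolic

namespace AntiParabolic
section

/-! ### Orbits of perturbations of a translation -/

theorem add_mem_attr {R t : ℝ} {X : ℂ} (hX : X ∈ attr R) (ht : 0 ≤ t) : X + t ∈ attr R := by
  rcases hX with h | h
  · left; simpa using h
  · right; simp only [Complex.add_re, Complex.ofReal_re]; linarith

theorem add_abs_re_le_of_mem_attr {R : ℝ} {X : ℂ} (hX : X ∈ attr R) : R + |X.re| ≤ 2 * ‖X‖ := by
  have h1 := Complex.abs_re_le_norm X
  have h2 := Complex.abs_im_le_norm X
  rcases hX with h | h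
  · linarith
  · linarith [le_abs_self X.re]

/-- The orbit of `X` under a sequence of maps. -/
def seqOrbit (G : ℕ → ℂ → ℂ) : ℕ → ℂ → ℂ
  | 0, X => X
  | n + 1, X => G n (seqOrbit G n X)

theorem summable_one_add_abs_rpow {s : ℝ} (hs : 1 < s) :
    Summable fun i : ℤ => (1 + |(i : ℝ)|) ^ (-s) := by
  have h : Summable fun n : ℕ => (1 + (n : ℝ)) ^ (-s) := by
    have := (summable_nat_add_iff 1).2 (Real.summable_nat_rpow.2 (by linarith : -s < -1))
    refine this.congr fun n => ?_
    push_cast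
    rw [add_comm]
  refine Summable.of_nat_of_neg ?_ ?_ <;> simpa using h

/-- Along an orbit the points stay close to `X + n / 2`, whose modulus grows linearly, so errors of
exponent `1 + δ` are summable and the orbit minus `n / 2` converges. The maps may depend on `n`, as
iterating an antiholomorphic germ requires, and the radius depends only on the constants, not on the
maps. -/
theorem exists_fatou_limit {C δ R₁ ε : ℝ} (hδ : 0 < δ) (hC : 0 ≤ C) (hε : 0 < ε) :
    ∃ R' : ℝ, R₁ ≤ R' ∧ ∀ G : ℕ → ℂ → ℂ, (∀ n, DifferentiableOn ℂ (G n) (attr R₁)) →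
      (∀ n, ∀ X ∈ attr R₁, ‖G n X - X - 1 / 2‖ ≤ C * ‖X‖ ^ (-(1 + δ))) →
      (∀ X ∈ attr R', ∀ n, ‖seqOrbit G n X - (X + (n / 2 : ℝ))‖ ≤ ε) ∧
      ∃ Φ : ℂ → ℂ, DifferentiableOn ℂ Φ (attr R') ∧
        ∀ X ∈ attr R', ‖Φ X - X‖ ≤ ε ∧
          Tendsto (fun n => seqOrbit G n X - (n / 2 : ℝ)) atTop (𝓝 (Φ X)) := by
  -- A deviation of at most `1` keeps the orbit inside `attr R₁`, where the next step can be
  -- estimated.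
  wlog hε1 : ε ≤ 1 generalizing ε
  · obtain ⟨R', h1, h2⟩ := this one_pos le_rfl
    have h1ε : 1 ≤ ε := (not_le.1 hε1).le
    refine ⟨R', h1, fun G hG hGe => ?_⟩
    obtain ⟨h3, Φ, h4, h5⟩ := h2 G hG hGe
    exact ⟨fun X hX n => (h3 X hX n).trans h1ε, Φ, h4, fun X hX =>
      ⟨(h5 X hX).1.trans h1ε, (h5 X hX).2⟩⟩
  -- The exponent is split: `1 + δ / 2` is spent on summability, and the remaining `δ / 2` gives a
  -- factor tending to `0` as the domain recedes.
  set a : ℤ → ℝ := fun i => (1 + |(i : ℝ)|) ^ (-(1 + δ / 2)) with ha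
  have hsum : Summable a := summable_one_add_abs_rpow (by linarith)
  have ha0 : ∀ i, 0 ≤ a i := fun i => by positivity
  set S := ∑' i, a i
  have hS : 0 ≤ S := tsum_nonneg ha0
  have hlim : Tendsto (fun R : ℝ => C * ((4 : ℝ)⁻¹ ^ (-(1 + δ / 2)) *
      ((R - 3) / 2) ^ (-(δ / 2))) * S) atTop (𝓝 0) := by
    have h1 : Tendsto (fun R : ℝ => (R - 3) / 2) atTop atTop :=
      (tendsto_atTop_add_const_right _ (-3) tendsto_id).atTop_div_const (by norm_num)
    have h2 := (tendsto_rpow_neg_atTop (by linarith : 0 < δ / 2)).comp h1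
    simpa using ((h2.const_mul ((4 : ℝ)⁻¹ ^ (-(1 + δ / 2)))).const_mul C).mul_const S
  obtain ⟨R', hR'⟩ := ((hlim.eventually (ge_mem_nhds hε)).and
    ((eventually_ge_atTop (R₁ + 1)).and (eventually_ge_atTop 4))).exists
  obtain ⟨hRε, hRR₁, hR4⟩ := hR'
  set M := C * ((4 : ℝ)⁻¹ ^ (-(1 + δ / 2)) * ((R' - 3) / 2) ^ (-(δ / 2))) with hM
  have hM0 : 0 ≤ M := by
    have : 0 ≤ (R' - 3) / 2 := by linarith
    positivity
  refine ⟨R', by linarith, fun G hG hGe => ?_⟩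
  -- estimate of one step
  have step : ∀ (x₀ : ℝ), ∀ X ∈ attr R', |X.re - x₀| ≤ 1 / 2 → ∀ n : ℕ, ∀ Y : ℂ,
      ‖Y - (X + (n / 2 : ℝ))‖ ≤ 1 → Y ∈ attr R₁ ∧
      ‖G n Y - Y - 1 / 2‖ ≤ M * a (⌊2 * x₀⌋ + n) := by
    intro x₀ X hX hx n Y hY
    have hX' := add_mem_attr hX (t := n / 2) (by positivity)
    have hYm : Y ∈ attr R₁ := mem_attr_of_norm_sub_lt hX' hY (by linarith)
    refine ⟨hYm, (hGe n Y hYm).trans ?_⟩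
    have h1 := add_abs_re_le_of_mem_attr hX'
    have h2 : ‖X + (n / 2 : ℝ)‖ ≤ ‖Y‖ + 1 := by
      have := norm_sub_le Y (Y - (X + (n / 2 : ℝ)))
      rw [sub_sub_cancel] at this
      linarith
    -- Approximately twice the real part of the `n`-th point. Distinct times give distinct integers,
    -- so the two-sided sum `S` bounds every orbit, including those starting far to the left and
    -- passing above or below the origin.
    set i : ℤ := ⌊2 * x₀⌋ + n with hi
    have h3 : |(i : ℝ)| ≤ 2 * |(X + (n / 2 : ℝ)).re| + 2 := by
      have h4 := Int.floor_le (2 * x₀)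
      have h5 := Int.lt_floor_add_one (2 * x₀)
      obtain ⟨h6, h7⟩ := abs_le.1 hx
      obtain ⟨h8, h9⟩ := abs_le.1 (le_refl |(X + (n / 2 : ℝ)).re|)
      simp only [Complex.add_re, Complex.ofReal_re] at h8 h9 ⊢
      rw [hi]
      push_cast
      rw [abs_le]
      constructor <;> linarith
    have hn : (R' - 3) / 2 + |(i : ℝ)| / 4 ≤ ‖Y‖ := by linarith
    have hr : (1 : ℝ) / 4 ≤ (R' - 3) / 2 := by linarith
    have hYpos : 0 < ‖Y‖ := by linarith [abs_nonneg (i : ℝ)]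
    have hA : 4⁻¹ * (1 + |(i : ℝ)|) ≤ ‖Y‖ := by linarith
    have hB : (R' - 3) / 2 ≤ ‖Y‖ := by linarith [abs_nonneg (i : ℝ)]
    have e1 : ‖Y‖ ^ (-(1 + δ)) = ‖Y‖ ^ (-(1 + δ / 2)) * ‖Y‖ ^ (-(δ / 2)) := by
      rw [← Real.rpow_add hYpos]; ring_nf
    have e2 : ‖Y‖ ^ (-(1 + δ / 2)) ≤ (4⁻¹ * (1 + |(i : ℝ)|)) ^ (-(1 + δ / 2)) :=
      Real.rpow_le_rpow_of_nonpos (by positivity) hA (by linarith)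
    have e3 : ‖Y‖ ^ (-(δ / 2)) ≤ ((R' - 3) / 2) ^ (-(δ / 2)) :=
      Real.rpow_le_rpow_of_nonpos (by linarith) hB (by linarith)
    rw [Real.mul_rpow (by norm_num) (by positivity)] at e2
    calc C * ‖Y‖ ^ (-(1 + δ)) ≤ C * ((4⁻¹ ^ (-(1 + δ / 2)) * a i) * ((R' - 3) / 2) ^ (-(δ / 2))) := by
          rw [e1]; gcongr
      _ = M * a i := by rw [hM]; ring
  have hpart : ∀ (x₀ : ℝ) (n : ℕ), M * ∑ m ∈ Finset.range n, a (⌊2 * x₀⌋ + m) ≤ ε := by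
    intro x₀ n
    refine le_trans ?_ hRε
    gcongr
    have hinj : Function.Injective fun m : ℕ => ⌊2 * x₀⌋ + (m : ℤ) := fun m m' h => by
      simpa using h
    have := (hsum.comp_injective hinj).sum_le_tsum (Finset.range n) fun m _ => ha0 _
    exact this.trans (tsum_comp_le_tsum_of_inj hsum ha0 hinj)
  have orb : ∀ (x₀ : ℝ), ∀ X ∈ attr R', |X.re - x₀| ≤ 1 / 2 → ∀ n : ℕ,
      ‖seqOrbit G n X - (X + (n / 2 : ℝ))‖ ≤ M * ∑ m ∈ Finset.range n, a (⌊2 * x₀⌋ + m) := by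
    intro x₀ X hX hx n
    induction n with
    | zero => simp [seqOrbit]
    | succ n ih =>
      have h1 := (step x₀ X hX hx n _ (ih.trans ((hpart x₀ n).trans hε1))).2
      have h2 : seqOrbit G (n + 1) X - (X + ((n + 1 : ℕ) / 2 : ℝ)) =
          (seqOrbit G n X - (X + (n / 2 : ℝ))) +
          (G n (seqOrbit G n X) - seqOrbit G n X - 1 / 2) := by
        simp only [seqOrbit]; push_cast; ring
      rw [h2, Finset.sum_range_succ, mul_add]
      exact (norm_add_le _ _).trans (add_le_add ih h1)
  have horb : ∀ X ∈ attr R', ∀ n, ‖seqOrbit G n X - (X + (n / 2 : ℝ))‖ ≤ ε := fun X hX n =>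
    (orb X.re X hX (by simp) n).trans (hpart _ n)
  refine ⟨horb, ?_⟩
  set F : ℕ → ℂ → ℂ := fun n X => G n (seqOrbit G n X) - seqOrbit G n X - 1 / 2 with hF
  have hmem : ∀ X ∈ attr R', ∀ n, seqOrbit G n X ∈ attr R₁ := fun X hX n =>
    (step X.re X hX (by simp) n _ ((horb X hX n).trans hε1)).1
  have hFb : ∀ (x₀ : ℝ), ∀ X ∈ attr R', |X.re - x₀| ≤ 1 / 2 → ∀ n, ‖F n X‖ ≤
      M * a (⌊2 * x₀⌋ + n) := fun x₀ X hX hx n =>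
    (step x₀ X hX hx n _ ((horb X hX n).trans hε1)).2
  have hdo : ∀ n, DifferentiableOn ℂ (seqOrbit G n) (attr R') := by
    intro n
    induction n with
    | zero => exact differentiableOn_id
    | succ n ih => exact (hG n).comp ih fun X hX => hmem X hX n
  have hdF : ∀ n, DifferentiableOn ℂ (F n) (attr R') := fun n =>
    (((hG n).comp (hdo n) fun X hX => hmem X hX n).sub (hdo n)).sub_const _
  have hsumx : ∀ x₀ : ℝ, Summable fun n : ℕ => M * a (⌊2 * x₀⌋ + n) := fun x₀ =>
    (hsum.comp_injective (i := fun m : ℕ => ⌊2 * x₀⌋ + (m : ℤ))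
      fun m m' h => by simpa using h).mul_left M
  refine ⟨fun X => X + ∑' n, F n X, fun X hX => ?_, fun X hX => ?_⟩
  -- On this vertical strip the same reference abscissa `X.re` gives one majorant for all points,
  -- hence uniform convergence.
  · set U := attr R' ∩ {Y : ℂ | |Y.re - X.re| < 1 / 2} with hU
    have hUo : IsOpen U := (isOpen_attr R').inter
      (isOpen_lt ((Complex.continuous_re.sub continuous_const).abs) continuous_const)
    have := Complex.differentiableOn_tsum_of_summable_norm (hsumx X.re)
      (fun n => (hdF n).mono Set.inter_subset_left) hUo (fun n Y hY => hFb X.re Y hY.1 hY.2.le n)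
    exact ((differentiableOn_id.add this).differentiableAt
      (hUo.mem_nhds ⟨hX, by simp⟩)).differentiableWithinAt
  · have hs : Summable fun n => F n X :=
      Summable.of_norm_bounded (hsumx X.re) (hFb X.re X hX (by simp))
    have hpartial : ∀ n, seqOrbit G n X - (n / 2 : ℝ) = X + ∑ m ∈ Finset.range n, F m X := by
      intro n
      induction n with
      | zero => simp [seqOrbit]
      | succ n ih =>
        rw [Finset.sum_range_succ, ← add_assoc, ← ih]
        simp only [hF, seqOrbit]; push_cast; ring
    have htend : Tendsto (fun n => seqOrbit G n X - (n / 2 : ℝ)) atTop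
        (𝓝 (X + ∑' n, F n X)) := by
      simp only [hpartial]
      exact tendsto_const_nhds.add hs.hasSum.tendsto_sum_nat
    refine ⟨?_, htend⟩
    refine le_of_tendsto ((htend.sub_const X).norm) (Eventually.of_forall fun n => ?_)
    have := horb X hX n
    rwa [sub_sub, add_comm ((n / 2 : ℝ) : ℂ)]

/-- A holomorphic function close to the identity on `attr R` is injective, and has a holomorphic
right inverse on a smaller domain. -/
theorem exists_inverse_of_near_id {R : ℝ} {Φ : ℂ → ℂ} (hd : DifferentiableOn ℂ Φ (attr R))
    (h : ∀ X ∈ attr R, ‖Φ X - X‖ ≤ 1 / 8) :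
    Set.InjOn Φ (attr (R + 1)) ∧ ∃ Θ : ℂ → ℂ, DifferentiableOn ℂ Θ (attr (R + 2)) ∧
      ∀ W ∈ attr (R + 2), Φ (Θ W) = W ∧ ‖Θ W - W‖ ≤ 1 / 8 := by
  -- On a unit ball `Φ - id` varies by at most `1/4`; the Schwarz lemma turns this into a Lipschitz
  -- bound.
  have hlip : ∀ X ∈ attr (R + 1), ∀ Y, ‖Y - X‖ < 1 →
      ‖(Φ Y - Y) - (Φ X - X)‖ ≤ 1 / 4 * ‖Y - X‖ := by
    intro X hX Y hY
    have hsub : Metric.ball X 1 ⊆ attr R := by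
      intro Z hZ
      rw [Metric.mem_ball, dist_eq_norm] at hZ
      exact mem_attr_of_norm_sub_lt hX hZ.le (by linarith)
    have hX0 : X ∈ attr R := attr_anti (by linarith) hX
    have := Complex.dist_le_div_mul_dist_of_mapsTo_ball (f := fun Z => Φ Z - Z) (c := X) (z := Y)
      (R₁ := 1) (R₂ := 1 / 4) ((hd.mono hsub).sub differentiableOn_id) (fun Z hZ => by
        rw [Metric.mem_closedBall, dist_eq_norm]
        refine (norm_sub_le _ _).trans ?_
        linarith [h Z (hsub hZ), h X hX0]) (by rwa [Metric.mem_ball, dist_eq_norm])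
    simpa [dist_eq_norm] using this
  have hinj' : ∀ X ∈ attr (R + 1), ∀ Y ∈ attr R, Φ X = Φ Y → X = Y := by
    intro X hX Y hY he
    have h1 := h X (attr_anti (by linarith) hX)
    have h2 := h Y hY
    have h3 : ‖Y - X‖ < 1 := by
      have : Y - X = (Φ X - X) - (Φ Y - Y) := by rw [he]; ring
      rw [this]
      exact (norm_sub_le _ _).trans_lt (by linarith)
    have h4 := hlip X hX Y h3
    have h5 : (Φ Y - Y) - (Φ X - X) = -(Y - X) := by rw [he]; ring
    rw [h5, norm_neg] at h4
    have : ‖Y - X‖ = 0 := by linarith [norm_nonneg (Y - X)]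
    exact (sub_eq_zero.1 (norm_eq_zero.1 this)).symm
  refine ⟨fun X hX Y hY he => hinj' X hX Y (attr_anti (by linarith) hY) he, ?_⟩
  have hex : ∀ W ∈ attr (R + 2), ∃ X, Φ X = W ∧ ‖X - W‖ ≤ 1 / 8 := by
    intro W hW
    have hball : Metric.closedBall W (1 / 8) ⊆ attr (R + 1) := by
      intro X hX
      rw [Metric.mem_closedBall, dist_eq_norm] at hX
      exact mem_attr_of_norm_sub_lt hW hX (by linarith)
    have hm : Set.MapsTo (fun X => W - (Φ X - X)) (Metric.closedBall W (1 / 8))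
        (Metric.closedBall W (1 / 8)) := by
      intro X hX
      rw [Metric.mem_closedBall, dist_eq_norm]
      simpa [norm_sub_rev X] using h X (attr_anti (by linarith) (hball hX))
    have hcw : ContractingWith (1 / 4) (hm.restrict _ _ _) := by
      refine ⟨by norm_num, LipschitzWith.of_dist_le_mul fun y y' => ?_⟩
      have h1 := y.2
      have h2 := y'.2
      rw [Metric.mem_closedBall] at h1 h2
      have h3 : ‖(y' : ℂ) - y‖ < 1 := by
        rw [← dist_eq_norm]
        exact (dist_triangle_right _ _ W).trans_lt (by linarith)
      have := hlip y (hball y.2) y' h3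
      rw [Subtype.dist_eq, Subtype.dist_eq, dist_eq_norm, dist_comm, dist_eq_norm]
      simp only [Set.MapsTo.val_restrict_apply, sub_sub_sub_cancel_left]
      simpa using this
    obtain ⟨X, hX, hfix, -⟩ := hcw.exists_fixedPoint' Metric.isClosed_closedBall.isComplete hm
      (Metric.mem_closedBall_self (by norm_num)) (edist_ne_top _ _)
    have h2 : W - (Φ X - X) = X := hfix
    rw [Metric.mem_closedBall, dist_eq_norm] at hX
    exact ⟨X, by linear_combination -h2, hX⟩
  choose! Θ hΘ1 hΘ2 using hex
  refine ⟨Θ, fun W hW => ?_, fun W hW => ⟨hΘ1 W hW, hΘ2 W hW⟩⟩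
  have hm : ∀ W ∈ attr (R + 2), Θ W ∈ attr (R + 1) := fun W hW =>
    mem_attr_of_norm_sub_lt hW (hΘ2 W hW) (by linarith)
  have hcont : ContinuousAt Θ W := by
    have hb : ∀ᶠ W' in 𝓝 W, ‖Θ W' - Θ W‖ ≤ 2 * ‖W' - W‖ := by
      have h1 : ∀ᶠ W' in 𝓝 W, ‖W' - W‖ < 1 / 2 := by
        filter_upwards [Metric.ball_mem_nhds W (by norm_num : (0 : ℝ) < 1 / 2)] with W' hW'
        rwa [Metric.mem_ball, dist_eq_norm] at hW'
      filter_upwards [h1, (isOpen_attr (R + 2)).mem_nhds hW] with W' hW1 hW2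
      have h3 : ‖Θ W' - Θ W‖ ≤ ‖Θ W' - W'‖ + ‖Θ W - W‖ + ‖W' - W‖ := by
        have : Θ W' - Θ W = (Θ W' - W') - (Θ W - W) + (W' - W) := by ring
        rw [this]
        exact (norm_add_le _ _).trans (by gcongr; exact norm_sub_le _ _)
      have h4 := hlip _ (hm W hW) (Θ W') (by linarith [hΘ2 W hW, hΘ2 W' hW2])
      rw [hΘ1 W hW, hΘ1 W' hW2] at h4
      have h5 : ‖Θ W' - Θ W‖ ≤ ‖W' - W‖ + ‖(W' - Θ W') - (W - Θ W)‖ := by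
        have : Θ W' - Θ W = (W' - W) - ((W' - Θ W') - (W - Θ W)) := by ring
        rw [this]
        exact norm_sub_le _ _
      linarith [norm_nonneg (W' - W)]
    rw [ContinuousAt, tendsto_iff_norm_sub_tendsto_zero]
    refine squeeze_zero' (Eventually.of_forall fun _ => norm_nonneg _) hb ?_
    have : Tendsto (fun W' => 2 * ‖W' - W‖) (𝓝 W) (𝓝 (2 * ‖W - W‖)) :=
      ((continuous_id.sub continuous_const).norm.const_mul 2).tendsto W
    simpa using this
  have hderiv : HasDerivAt Φ (deriv Φ (Θ W)) (Θ W) :=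
    (hd.differentiableAt ((isOpen_attr R).mem_nhds (attr_anti (by linarith) (hm W hW)))).hasDerivAt
  have hne : deriv Φ (Θ W) ≠ 0 := by
    intro h0
    have h1 := hderiv.sub (hasDerivAt_id (Θ W))
    have h2 := h1.le_of_lip' (C := 1 / 4) (by norm_num) (by
      filter_upwards [Metric.ball_mem_nhds (Θ W) one_pos] with Y hY
      rw [Metric.mem_ball, dist_eq_norm] at hY
      exact hlip _ (hm W hW) Y hY)
    rw [h0] at h2
    norm_num at h2
  exact (HasDerivAt.of_local_left_inverse hcont hderiv hne (by
    filter_upwards [(isOpen_attr (R + 2)).mem_nhds hW] with W' hW'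
    exact hΘ1 W' hW')).differentiableAt.differentiableWithinAt

end
end AntiParabolic

namespace AntiParabolic
section

/-! ### Fatou coordinates -/

variable {k : ℕ} {b : ℝ} {j : ℤ} {z : ℂ} {R : ℝ} {d : ℂ → ℂ}

theorem differentiableAt_normChart (hk : 1 ≤ k) (hz : z ≠ 0)
    (ha : |Complex.arg (rot k j z)| < π / k) : DifferentiableAt ℂ (normChart k b j) z := by
  have h1 : π / k ≤ π := div_le_self Real.pi_pos.le (by exact_mod_cast hk)
  have hs : rot k j z ∈ Complex.slitPlane := by
    rw [Complex.mem_slitPlane_iff_arg]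
    exact ⟨fun h => by rw [h, abs_of_pos Real.pi_pos] at ha; linarith, rot_ne_zero hz⟩
  have hk0 : (k : ℂ) ≠ 0 := by exact_mod_cast (by omega : k ≠ 0)
  have h2 : DifferentiableAt ℂ (fun z => Complex.log (rot k j z)) z :=
    DifferentiableAt.clog (by unfold rot; fun_prop) hs
  have h3 : DifferentiableAt ℂ (fun z : ℂ => -1 / ((k : ℂ) * z ^ k)) z :=
    (differentiableAt_const _).div (by fun_prop) (mul_ne_zero hk0 (pow_ne_zero _ hz))
  exact ((h3.add (h2.const_mul (b : ℂ))).const_mul (sgn j : ℂ))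

theorem mem_petal_of_mem_attr {R R' : ℝ} (hz : z ∈ petal k b R j)
    (h : normChart k b j z ∈ attr R') : z ∈ petal k b R' j := by
  rw [mem_petal_iff] at hz ⊢
  exact ⟨hz.1, hz.2.1, hz.2.2.1, h⟩

theorem normChart_conj (hk : 1 ≤ k) (h : |Complex.arg (rot k j z)| < π / k) :
    normChart k b (-j) (conj z) = conj (normChart k b j z) := by
  rw [normChart, normChart, timeChart_conj hk h, sgn_neg, map_mul, Complex.conj_ofReal]

/-- The holomorphic germs whose compositions are, up to conjugation, the iterates of the
antiholomorphic germ `z ↦ d (conj z)`. -/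
noncomputable def altGerm (d : ℂ → ℂ) (n : ℕ) : ℂ → ℂ := if Even n then conjGerm d else d

theorem altGerm_conj (d : ℂ → ℂ) (n : ℕ) (z : ℂ) :
    altGerm d n (conj z) = conj (altGerm d (n + 1) z) := by
  by_cases h : Even n
  · simp [altGerm, h, Nat.even_add_one, conjGerm]
  · simp [altGerm, h, Nat.even_add_one, conjGerm]

/-- One application of `z ↦ d (conj z)` shifts the alternating orbit by one step, up to conjugation.
In the limit the shift becomes the `1/2` in the relation between `φ (-j)` and `φ j`. -/
theorem seqOrbit_altGerm_conj (d : ℂ → ℂ) (n : ℕ) (z : ℂ) :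
    seqOrbit (altGerm d) n (d (conj z)) = conj (seqOrbit (altGerm d) (n + 1) z) := by
  induction n with
  | zero => simp [seqOrbit, altGerm, conjGerm]
  | succ n ih =>
    rw [seqOrbit, ih, altGerm_conj]
    rfl

/-- Transports `exists_fatou_limit` to the petals. The parity is fixed by the sign `s` because
attracting and repelling petals use different germs `d`, the second being built from the inverse. -/
theorem exists_fatou_limit_petal (hk : 1 ≤ k) (b s : ℝ) (hd : AnalyticAt ℂ d 0)
    (hdid : OrderGE (k + 1) fun z => d z - z)
    (H : ∃ R₀ : ℝ, 0 < R₀ ∧ ∃ C : ℝ, 0 ≤ C ∧ ∀ j, sgn j = s → ∀ z ∈ petal k b R₀ j,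
      ‖normChart k b j (d z) - normChart k b j z - 1 / 2‖ ≤ C * ‖z‖ ^ (k + 1)) :
    ∃ R₁ : ℝ, 0 < R₁ ∧ ∃ R₂ : ℝ, R₁ ≤ R₂ ∧ ∃ Λ Θ : ℤ → ℂ → ℂ,
      (∀ j, sgn j = s →
        (∀ z ∈ petal k b R₁ j,
          (∀ n, |Complex.arg (rot k j (seqOrbit (altGerm d) n z))| < π / k) ∧
          Tendsto (fun n => normChart k b j (seqOrbit (altGerm d) n z) - (n / 2 : ℝ)) atTop
            (𝓝 (Λ j z))) ∧
        DifferentiableOn ℂ (Λ j) (petal k b R₁ j) ∧ Set.InjOn (Λ j) (petal k b R₁ j) ∧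
        DifferentiableOn ℂ (Θ j) (attr R₂) ∧
        ∀ W ∈ attr R₂, Θ j W ∈ petal k b R₁ j ∧ Λ j (Θ j W) = W ∧
          ‖normChart k b j (Θ j W) - W‖ ≤ 1 / 8) ∧
      ∀ ε > 0, ∃ R', R₁ ≤ R' ∧ ∀ j, sgn j = s → ∀ z ∈ petal k b R' j,
        ‖Λ j z - normChart k b j z‖ ≤ ε := by
  have hkr : (1 : ℝ) ≤ k := by exact_mod_cast hk
  have hk0 : (0 : ℝ) < k := by linarith
  obtain ⟨R₀, h8, -, V, hV1, hV2, hV3, hV4, -⟩ := exists_petal_charts hk b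
  obtain ⟨R_H, hR_H, C, hC, hH⟩ := H
  obtain ⟨K, hK, r, hr, hKr⟩ := norm_pow_le_of_orderGE hdid
  obtain ⟨R_P, hR_P, K', hK', hpert⟩ := exists_petal_perturbation hk b hK
  obtain ⟨r', hr', hdr'⟩ := Metric.eventually_nhds_iff.1
    ((Complex.analyticAt_iff_eventually_differentiableAt.1 hd).and
      (Complex.analyticAt_iff_eventually_differentiableAt.1 (analyticAt_conjGerm hd)))
  obtain ⟨R_S, hR_S, hsmall⟩ := norm_lt_of_mem_petal hk b (ε := min r r') (by positivity)
  set R_a := max (max R_H R_P) (max R_S (R₀ + K')) with hR_a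
  have hHa : R_H ≤ R_a := (le_max_left _ _).trans (le_max_left _ _)
  have hPa : R_P ≤ R_a := (le_max_right _ _).trans (le_max_left _ _)
  have hSa : R_S ≤ R_a := (le_max_left _ _).trans (le_max_right _ _)
  have h0a : R₀ + K' ≤ R_a := (le_max_right _ _).trans (le_max_right _ _)
  -- one step in the petals
  have hDstep : ∀ n j, sgn j = s → ∀ z ∈ petal k b R_a j,
      DifferentiableAt ℂ (altGerm d n) z ∧ altGerm d n z ∈ petal k b R₀ j ∧
      ‖normChart k b j (altGerm d n z) - normChart k b j z - 1 / 2‖ ≤ C * ‖z‖ ^ (k + 1) := by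
    have hodd : ∀ j, sgn j = s → ∀ z ∈ petal k b R_a j, d z ∈ petal k b R₀ j ∧
        ‖normChart k b j (d z) - normChart k b j z - 1 / 2‖ ≤ C * ‖z‖ ^ (k + 1) := by
      intro j hj z hz
      have h1 := (lt_min_iff.1 (hsmall j z (petal_anti hSa hz))).1
      exact ⟨(hpert j z (petal_anti hPa hz) (d z) (hKr z h1)).2.2 R_a R₀ hz (by linarith),
        hH j hj z (petal_anti hHa hz)⟩
    intro n j hj z hz
    have h1 := (lt_min_iff.1 (hsmall j z (petal_anti hSa hz))).2
    have h2 := hdr' (y := z) (by simpa using h1)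
    -- For even `n` the conjugate germ acts on the petal of index `j` as `d` does on the petal of
    -- index `-j`, which has the same sign.
    by_cases hn : Even n
    · simp only [altGerm, hn, if_true]
      have hcz := conj_mem_petal hk hz
      obtain ⟨h3, h4⟩ := hodd (-j) (by rw [sgn_neg, hj]) _ hcz
      have h5 : conjGerm d z ∈ petal k b R₀ j := by
        simpa [conjGerm] using conj_mem_petal hk h3
      refine ⟨h2.2, h5, ?_⟩
      have e1 := normChart_conj (b := b) hk (mem_petal_iff.1 h3).2.2.1
      have e2 := normChart_conj (b := b) hk (mem_petal_iff.1 hz).2.2.1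
      rw [neg_neg] at e1
      rw [e2] at h4
      have e3 : normChart k b j (conjGerm d z) - normChart k b j z - 1 / 2 =
          conj (normChart k b (-j) (d (conj z)) - conj (normChart k b j z) - 1 / 2) := by
        rw [conjGerm, e1]; simp [Complex.conj_ofNat]
      rw [e3, Complex.norm_conj]
      simpa using h4
    · simp only [altGerm, hn, if_false]
      obtain ⟨h3, h4⟩ := hodd j hj z hz
      exact ⟨h2.1, h3, h4⟩
  set G : ℤ → ℕ → ℂ → ℂ := fun j n X => normChart k b j (altGerm d n (V j X)) with hG
  have hVa : ∀ j, ∀ X ∈ attr R_a, V j X ∈ petal k b R_a j := fun j X hX => by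
    obtain ⟨h1, h2⟩ := hV1 j X (attr_anti (by linarith) hX)
    exact mem_petal_of_mem_attr h1 (by rwa [h2])
  have hGd : ∀ j, sgn j = s → ∀ n, DifferentiableOn ℂ (G j n) (attr R_a) := by
    intro j hj n X hX
    obtain ⟨h1, h2, -⟩ := hDstep n j hj _ (hVa j X hX)
    obtain ⟨h3, -, h4, -⟩ := mem_petal_iff.1 h2
    have h5 : DifferentiableAt ℂ (V j) X := (hV3 j).differentiableAt
      ((isOpen_attr R₀).mem_nhds (attr_anti (by linarith) hX))
    exact (DifferentiableAt.comp X (differentiableAt_normChart hk h3 h4)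
      (h1.comp X h5)).differentiableWithinAt
  have hGe : ∀ j, sgn j = s → ∀ n, ∀ X ∈ attr R_a,
      ‖G j n X - X - 1 / 2‖ ≤ C * 2 ^ (1 + 1 / (k : ℝ)) * ‖X‖ ^ (-(1 + 1 / (k : ℝ))) := by
    intro j hj n X hX
    obtain ⟨-, -, h3⟩ := hDstep n j hj _ (hVa j X hX)
    obtain ⟨h1, h2⟩ := hV1 j X (attr_anti (by linarith) hX)
    have h4 := (hV4 j _ h1).1
    rw [h2] at h3 h4
    refine h3.trans ?_
    have hXn : 0 < ‖X‖ := by linarith [lt_norm_of_mem_attr hX]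
    -- Since `‖z‖ ^ k` is comparable to `1 / ‖X‖`, an error `‖z‖ ^ (k + 1)` has exponent `1 + 1 / k
    -- > 1` in the chart.
    have h5 : ‖V j X‖ ^ (k + 1) = (‖V j X‖ ^ k) ^ (1 + 1 / (k : ℝ)) := by
      rw [← Real.rpow_natCast, ← Real.rpow_natCast, ← Real.rpow_mul (norm_nonneg _)]
      congr 1
      push_cast
      field_simp
    have h6 : ‖V j X‖ ^ k ≤ 2 / ‖X‖ := by rwa [le_div_iff₀ hXn]
    rw [h5, mul_assoc]
    gcongr
    calc (‖V j X‖ ^ k) ^ (1 + 1 / (k : ℝ)) ≤ (2 / ‖X‖) ^ (1 + 1 / (k : ℝ)) := by gcongr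
      _ = _ := by rw [Real.div_rpow (by norm_num) hXn.le, Real.rpow_neg hXn.le, div_eq_mul_inv]
  have hCpos : 0 ≤ C * 2 ^ (1 + 1 / (k : ℝ)) := by positivity
  have hδ : 0 < 1 / (k : ℝ) := by positivity
  have horbit : ∀ R' ε : ℝ, R_a ≤ R' → ε ≤ 1 → ∀ j, sgn j = s →
      (∀ X ∈ attr (R' + 1), ∀ n, ‖seqOrbit (G j) n X - (X + (n / 2 : ℝ))‖ ≤ ε) →
      ∀ z ∈ petal k b (R' + 1) j, ∀ n, seqOrbit (altGerm d) n z ∈ petal k b R₀ j ∧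
        normChart k b j (seqOrbit (altGerm d) n z) = seqOrbit (G j) n (normChart k b j z) := by
    intro R' ε hR' hε j hj ho z hz n
    have hX := (mem_petal_iff.1 hz).2.2.2
    induction n with
    | zero => exact ⟨petal_anti (by linarith) hz, rfl⟩
    | succ n ih =>
      have h1 : seqOrbit (G j) n (normChart k b j z) ∈ attr R_a :=
        mem_attr_of_norm_sub_lt (add_mem_attr hX (t := n / 2) (by positivity)) (ho _ hX n)
          (by linarith)
      have h2 : seqOrbit (altGerm d) n z ∈ petal k b R_a j :=
        mem_petal_of_mem_attr ih.1 (by rwa [ih.2])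
      refine ⟨(hDstep n j hj _ h2).2.1, ?_⟩
      rw [seqOrbit, seqOrbit, ← ih.2, hG]
      simp only
      rw [hV2 j _ ih.1]
  obtain ⟨R', hR'a, hfat⟩ := exists_fatou_limit (R₁ := R_a) hδ hCpos (by norm_num : (0 : ℝ) < 1 / 8)
  have hfat' : ∀ j, ∃ Φ : ℂ → ℂ, sgn j = s → DifferentiableOn ℂ Φ (attr R') ∧
      ∀ X ∈ attr R', ‖Φ X - X‖ ≤ 1 / 8 ∧
        Tendsto (fun n => seqOrbit (G j) n X - (n / 2 : ℝ)) atTop (𝓝 (Φ X)) := by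
    intro j
    by_cases hj : sgn j = s
    · obtain ⟨-, Φ, h⟩ := hfat (G j) (hGd j hj) (hGe j hj)
      exact ⟨Φ, fun _ => h⟩
    · exact ⟨id, fun h => absurd h hj⟩
  choose Φ hΦ using hfat'
  have hinv : ∀ j, ∃ Θ : ℂ → ℂ, sgn j = s → DifferentiableOn ℂ Θ (attr (R' + 2)) ∧
      ∀ W ∈ attr (R' + 2), Φ j (Θ W) = W ∧ ‖Θ W - W‖ ≤ 1 / 8 := by
    intro j
    by_cases hj : sgn j = s
    · obtain ⟨-, Θ, h⟩ := exists_inverse_of_near_id (hΦ j hj).1 fun X hX => ((hΦ j hj).2 X hX).1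
      exact ⟨Θ, fun _ => h⟩
    · exact ⟨id, fun h => absurd h hj⟩
  choose Θ hΘ using hinv
  have hlim : ∀ j, sgn j = s → ∀ z ∈ petal k b (R' + 1) j,
      (∀ n, seqOrbit (altGerm d) n z ∈ petal k b R₀ j) ∧
      Tendsto (fun n => normChart k b j (seqOrbit (altGerm d) n z) - (n / 2 : ℝ)) atTop
        (𝓝 (Φ j (normChart k b j z))) := by
    intro j hj z hz
    have h1 := horbit R' (1 / 8) hR'a (by norm_num) j hj (fun X hX =>
      (hfat (G j) (hGd j hj) (hGe j hj)).1 X (attr_anti (by linarith) hX)) z hz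
    refine ⟨fun n => (h1 n).1, ?_⟩
    have h2 := ((hΦ j hj).2 _ (attr_anti (by linarith : R' ≤ R' + 1)
      (mem_petal_iff.1 hz).2.2.2)).2
    exact h2.congr fun n => by rw [(h1 n).2]
  refine ⟨R' + 1, by linarith, R' + 2, by linarith, fun j z => Φ j (normChart k b j z),
    fun j W => V j (Θ j W), fun j hj => ⟨fun z hz => ⟨fun n =>
    (mem_petal_iff.1 ((hlim j hj z hz).1 n)).2.2.1, (hlim j hj z hz).2⟩, fun z hz => ?_,
    fun z hz z' hz' he => ?_, fun W hW => ?_, fun W hW => ?_⟩, fun ε hε => ?_⟩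
  · obtain ⟨h1, -, h2, h3⟩ := mem_petal_iff.1 hz
    have h4 : DifferentiableAt ℂ (Φ j) (normChart k b j z) := (hΦ j hj).1.differentiableAt
      ((isOpen_attr R').mem_nhds (attr_anti (by linarith) h3))
    exact (h4.comp z (differentiableAt_normChart hk h1 h2)).differentiableWithinAt
  · have h1 := (exists_inverse_of_near_id (hΦ j hj).1 fun X hX => ((hΦ j hj).2 X hX).1).1
      (mem_petal_iff.1 hz).2.2.2 (mem_petal_iff.1 hz').2.2.2 he
    rw [← hV2 j z (petal_anti (by linarith) hz), ← hV2 j z' (petal_anti (by linarith) hz'), h1]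
  · have h1 := mem_attr_of_norm_sub_lt hW ((hΘ j hj).2 W hW).2
      (by linarith : R₀ ≤ R' + 2 - 1 / 8)
    exact (((hV3 j).differentiableAt ((isOpen_attr R₀).mem_nhds h1)).comp W
      ((hΘ j hj).1.differentiableAt ((isOpen_attr _).mem_nhds hW))).differentiableWithinAt
  · obtain ⟨h1, h2⟩ := (hΘ j hj).2 W hW
    obtain ⟨h3, h4⟩ := hV1 j _ (mem_attr_of_norm_sub_lt hW h2 (by linarith : R₀ ≤ R' + 2 - 1 / 8))
    refine ⟨mem_petal_of_mem_attr h3 ?_, ?_, ?_⟩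
    · rw [h4]; exact mem_attr_of_norm_sub_lt hW h2 (by linarith)
    · simp only [h4, h1]
    · rwa [h4]
  -- The construction is repeated with the given precision; uniqueness of limits identifies its
  -- result with the function already chosen.
  · obtain ⟨R'', hR''a, hfat2⟩ := exists_fatou_limit (R₁ := R_a) hδ hCpos hε
    refine ⟨max (R' + 1) R'', le_max_left _ _, fun j hj z hz => ?_⟩
    have hX := (mem_petal_iff.1 hz).2.2.2
    obtain ⟨-, Φ', -, h2⟩ := hfat2 (G j) (hGd j hj) (hGe j hj)
    obtain ⟨h3, h4⟩ := h2 _ (attr_anti (le_max_right _ _) hX)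
    have h5 := ((hΦ j hj).2 _ (attr_anti ((by linarith : R' ≤ R' + 1).trans (le_max_left _ _)) hX)).2
    simp only
    rwa [tendsto_nhds_unique h5 h4]

end
end AntiParabolic

namespace AntiParabolic
section

/-! ### ### Existence of standard Fatou coordinates -/

variable {k : ℕ} {b : ℝ} {j : ℤ} {z : ℂ} {R : ℝ} {p : ℂ → ℂ}

theorem conj_normalJet (k : ℕ) (b : ℝ) (z : ℂ) :
    conj (normalJet k b (conj z)) = normalJet k b z := by
  simp [normalJet, Complex.conj_ofNat]

theorem exists_mem_petal_of_orderGE (hk : 1 ≤ k) (b : ℝ) {m : ℂ → ℂ}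
    (hm : OrderGE (k + 1) fun z => m z - z) : ∃ R₀ : ℝ, 0 < R₀ ∧ ∃ K : ℝ, 0 ≤ K ∧
      ∀ R, R₀ ≤ R → ∀ R', R' ≤ R - K → ∀ j, ∀ z ∈ petal k b R j, m z ∈ petal k b R' j := by
  obtain ⟨K, hK, r, hr, hKr⟩ := norm_pow_le_of_orderGE hm
  obtain ⟨R₁, hR₁, K', hK', hpert⟩ := exists_petal_perturbation hk b hK
  obtain ⟨R₂, -, hsmall⟩ := norm_lt_of_mem_petal hk b hr
  exact ⟨max R₁ R₂, lt_max_of_lt_left hR₁, K', hK', fun R hR R' hR' j z hz =>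
    (hpert j z (petal_anti ((le_max_left _ _).trans hR) hz) (m z)
      (hKr z (hsmall j z (petal_anti ((le_max_right _ _).trans hR) hz)))).2.2 R R' hz hR'⟩

/-- An antiholomorphic germ tangent to the conjugation up to order `k` maps `S_j` to `S_{-j}`. -/
theorem exists_mem_petal_neg_of_orderGE (hk : 1 ≤ k) (b : ℝ) {τ : ℂ → ℂ}
    (hτ : OrderGE (k + 1) fun z => τ (conj z) - z) : ∃ R₀ : ℝ, 0 < R₀ ∧ ∃ K : ℝ, 0 ≤ K ∧
      ∀ R, R₀ ≤ R → ∀ R', R' ≤ R - K → ∀ j, ∀ z ∈ petal k b R j, τ z ∈ petal k b R' (-j) := by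
  obtain ⟨R₀, hR₀, K, hK, h⟩ := exists_mem_petal_of_orderGE hk b hτ
  refine ⟨R₀, hR₀, K, hK, fun R hR R' hR' j z hz => ?_⟩
  simpa using h R hR R' hR' (-j) _ (conj_mem_petal hk hz)

theorem orderGE_of_isPrenormalized {b : ℂ} (hp : IsPrenormalized p k b) :
    OrderGE (k + 1) fun z => p (conj z) - z :=
  (((isPrenormalized_iff.1 hp).2.mono (by omega)).add (orderGE_normalJet_sub_id k b)).congr
    fun z => by ring

/-- The local inverse of a prenormalized germ. -/
theorem exists_inverse_of_isPrenormalized (hk : 1 ≤ k) {b : ℂ} (hp : IsPrenormalized p k b) :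
    ∃ c' : ℂ → ℂ, AnalyticAt ℂ c' 0 ∧ OrderGE (k + 1) (fun z => c' z - z) ∧
      (∀ᶠ z in 𝓝 0, c' (p (conj z)) = z) ∧ ∀ᶠ z in 𝓝 0, p (conj (c' z)) = z := by
  have hid := orderGE_of_isPrenormalized hp
  have hd : HasDerivAt (fun z => p (conj z)) 1 0 :=
    OrderGE.hasDerivAt ((hid.mono (by omega)).congr fun z => by ring)
  have hb : IsBiholomorphicGerm fun z => p (conj z) :=
    IsBiholomorphicGerm.of_hasDerivAt hp.1.2 (by simp [hp.1.1]) hd one_ne_zero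
  obtain ⟨c', h1, -, h2, h3⟩ := hb.exists_inverse
  refine ⟨c', h1.analytic, ?_, h2, h3⟩
  refine ((hid.comp h1.orderGE).neg).congr_ev ?_
  filter_upwards [h3] with z hz
  rw [hz]; ring

/-- Fatou coordinates asymptotic to the time charts, with holomorphic right inverses. -/
structure IsStandardFatou (p : ℂ → ℂ) (k : ℕ) (b R₁ R₂ : ℝ) (φ Θ : ℤ → ℂ → ℂ) : Prop where
  fatou : IsFatouCoordinates p k b R₁ φ
  pos : 0 < R₁
  le : R₁ ≤ R₂
  near : ∀ ε > 0, ∃ R', R₁ ≤ R' ∧ ∀ j, ∀ z ∈ petal k b R' j, ‖φ j z - timeChart k b j z‖ ≤ ε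
  inv_holomorphic : ∀ j, DifferentiableOn ℂ (Θ j) (timeDomain R₂ j)
  inv_mem : ∀ j, ∀ W ∈ timeDomain R₂ j, Θ j W ∈ petal k b R₁ j
  inv_right : ∀ j, ∀ W ∈ timeDomain R₂ j, φ j (Θ j W) = W
  inv_near : ∀ j, ∀ W ∈ timeDomain R₂ j, ‖timeChart k b j (Θ j W) - W‖ ≤ 1 / 8

/-- On attracting petals the coordinate is the limit along orbits of `p`. On repelling petals the
inverse germ is used: the normalized chart reverses the sign, so the inverse again advances by
`1/2`. Gluing and conjugacy follow from uniqueness of limits. -/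
theorem exists_isStandardFatou (hk : 1 ≤ k) (hp : IsPrenormalized p k b) :
    ∃ R₁ R₂ φ Θ, IsStandardFatou p k b R₁ R₂ φ Θ := by
  obtain ⟨c', hc', hc'id, hl, hr⟩ := exists_inverse_of_isPrenormalized hk hp
  have hpid := orderGE_of_isPrenormalized hp
  have hN := (isPrenormalized_iff.1 hp).2
  have hs : ∀ j, sgn j = 1 ∨ sgn j = -1 := fun j => by unfold sgn; split_ifs <;> simp
  have H1 : ∃ R₀ : ℝ, 0 < R₀ ∧ ∃ C : ℝ, 0 ≤ C ∧ ∀ j, sgn j = 1 → ∀ z ∈ petal k b R₀ j,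
      ‖normChart k b j (p (conj z)) - normChart k b j z - 1 / 2‖ ≤ C * ‖z‖ ^ (k + 1) := by
    obtain ⟨R₀, hR₀, C, hC, h⟩ := exists_norm_timeChart_sub_le hk b hp.1.2 hN
    refine ⟨R₀, hR₀, C, hC, fun j hj z hz => ?_⟩
    simpa [normChart, hj] using h j z hz
  have H2 : ∃ R₀ : ℝ, 0 < R₀ ∧ ∃ C : ℝ, 0 ≤ C ∧ ∀ j, sgn j = -1 → ∀ z ∈ petal k b R₀ j,
      ‖normChart k b j (conjGerm c' z) - normChart k b j z - 1 / 2‖ ≤ C * ‖z‖ ^ (k + 1) := by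
    have hN' : OrderGE (2 * k + 2) fun z => conjGerm (fun z => p (conj z)) z - normalJet k b z := by
      refine hN.conjGerm.congr fun z => ?_
      simp only [conjGerm, map_sub, conj_normalJet]
    obtain ⟨R₀, hR₀, C, hC, h⟩ := exists_norm_timeChart_inverse_le hk b
      (analyticAt_conjGerm hp.1.2) hN' (g' := conjGerm c')
      (hc'id.conjGerm.congr fun z => by simp [conjGerm])
      (by filter_upwards [eventually_conj hr] with z hz; simp [conjGerm] at hz ⊢; simp [hz])
    refine ⟨R₀, hR₀, C, hC, fun j hj z hz => ?_⟩
    have : normChart k b j (conjGerm c' z) - normChart k b j z - 1 / 2 =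
        -(timeChart k b j (conjGerm c' z) - timeChart k b j z + 1 / 2) := by
      simp only [normChart, hj]; push_cast; ring
    rw [this, norm_neg]
    exact h j z hz
  have hdid2 : OrderGE (k + 1) fun z => conjGerm c' z - z :=
    hc'id.conjGerm.congr fun z => by simp [conjGerm]
  obtain ⟨A₁, hA₁, A₂, hA₁₂, Λ, Θ, hΛ, hΛε⟩ := exists_fatou_limit_petal hk b 1 hp.1.2 hpid H1
  obtain ⟨B₁, hB₁, B₂, hB₁₂, Λ', Θ', hΛ', hΛε'⟩ := exists_fatou_limit_petal hk b (-1)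
    (analyticAt_conjGerm hc') hdid2 H2
  obtain ⟨r, hr0, hlr⟩ := Metric.eventually_nhds_iff.1 hl
  obtain ⟨R_S, -, hsmall⟩ := norm_lt_of_mem_petal hk b hr0
  set R₁ := max (max A₁ B₁) R_S with hR₁
  have hA : A₁ ≤ R₁ := (le_max_left _ _).trans (le_max_left _ _)
  have hB : B₁ ≤ R₁ := (le_max_right _ _).trans (le_max_left _ _)
  have hS : R_S ≤ R₁ := le_max_right _ _
  have hR₁0 : 0 < R₁ := hA₁.trans_le hA
  set R₂ := max (max A₂ B₂) (R₁ + 1) with hR₂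
  have hA2 : A₂ ≤ R₂ := (le_max_left _ _).trans (le_max_left _ _)
  have hB2 : B₂ ≤ R₂ := (le_max_right _ _).trans (le_max_left _ _)
  have hR₁₂ : R₁ + 1 ≤ R₂ := le_max_right _ _
  set φ : ℤ → ℂ → ℂ := fun j z => sgn j * (if sgn j = 1 then Λ j z else Λ' j z) with hφ
  set Ξ : ℤ → ℂ → ℂ := fun j W => if sgn j = 1 then Θ j (sgn j * W) else Θ' j (sgn j * W) with hΞ
  have hinv : ∀ j, DifferentiableOn ℂ (Ξ j) (timeDomain R₂ j) ∧ ∀ W ∈ timeDomain R₂ j,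
      Ξ j W ∈ petal k b R₁ j ∧ φ j (Ξ j W) = W ∧ ‖timeChart k b j (Ξ j W) - W‖ ≤ 1 / 8 := by
    intro j
    have hmaps : Set.MapsTo (fun W => (sgn j : ℂ) * W) (timeDomain R₂ j) (attr R₂) :=
      fun W hW => mem_timeDomain_iff.1 hW
    have hfin : ∀ W ∈ timeDomain R₂ j, ∀ y, ∀ R', y ∈ petal k b R' j →
        ‖normChart k b j y - sgn j * W‖ ≤ 1 / 8 →
        y ∈ petal k b R₁ j ∧ ‖timeChart k b j y - W‖ ≤ 1 / 8 := by
      intro W hW y R' hy hn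
      refine ⟨mem_petal_of_mem_attr hy (mem_attr_of_norm_sub_lt (hmaps hW) hn (by linarith)), ?_⟩
      rwa [normChart, ← mul_sub, norm_mul, norm_sgn, one_mul] at hn
    rcases hs j with hj | hj
    · obtain ⟨-, -, -, hd, h⟩ := hΛ j hj
      simp only [hΞ, hφ, hj, if_true]
      simp only [hj] at hmaps
      refine ⟨(hd.mono (attr_anti hA2)).comp (differentiableOn_id.const_mul _) hmaps,
        fun W hW => ?_⟩
      obtain ⟨h1, h2, h3⟩ := h _ (attr_anti hA2 (hmaps hW))
      obtain ⟨h4, h5⟩ := hfin W hW _ _ h1 (by rw [hj]; exact h3)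
      exact ⟨h4, by rw [h2]; simp, h5⟩
    · have hj' : ¬ sgn j = 1 := by rw [hj]; norm_num
      obtain ⟨-, -, -, hd, h⟩ := hΛ' j hj
      simp only [hΞ, hφ, hj', if_false]
      refine ⟨(hd.mono (attr_anti hB2)).comp (differentiableOn_id.const_mul _) hmaps,
        fun W hW => ?_⟩
      obtain ⟨h1, h2, h3⟩ := h _ (attr_anti hB2 (hmaps hW))
      obtain ⟨h4, h5⟩ := hfin W hW _ _ h1 h3
      exact ⟨h4, by rw [h2, ← mul_assoc, sgn_mul_self', one_mul], h5⟩
  refine ⟨R₁, R₂, φ, Ξ, ⟨⟨fun j _ => ?_, fun j _ => ?_, fun z hz => ?_, fun j _ z hz hpz => ?_⟩,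
    hR₁0, by linarith, fun ε hε => ?_, fun j => (hinv j).1, fun j W hW => ((hinv j).2 W hW).1,
    fun j W hW => ((hinv j).2 W hW).2.1, fun j W hW => ((hinv j).2 W hW).2.2⟩⟩
  · rcases hs j with hj | hj
    · simp only [hφ, hj, if_true]
      exact ((hΛ j hj).2.1.mono (petal_anti hA)).const_mul _
    · have hj' : ¬ sgn j = 1 := by rw [hj]; norm_num
      simp only [hφ, hj', if_false]
      exact ((hΛ' j hj).2.1.mono (petal_anti hB)).const_mul _
  · intro z hz z' hz' he
    have hsj : (sgn j : ℂ) ≠ 0 := by rw [← norm_ne_zero_iff, norm_sgn]; norm_num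
    have he' := mul_left_cancel₀ hsj he
    rcases hs j with hj | hj
    · simp only [hj, if_true] at he'
      exact (hΛ j hj).2.2.1 (petal_anti hA hz) (petal_anti hA hz') he'
    · have hj' : ¬ sgn j = 1 := by rw [hj]; norm_num
      simp only [hj', if_false] at he'
      exact (hΛ' j hj).2.2.1 (petal_anti hB hz) (petal_anti hB hz') he'
  · have hz' : z ∈ petal k b R₁ (-(k : ℤ)) := by rw [petal_glue hk]; exact hz
    have hnc : normChart k b (-(k : ℤ)) = normChart k b k := by
      ext z; rw [normChart, normChart, timeChart_glue hk, sgn_neg]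
    simp only [hφ, sgn_neg]
    congr 1
    rcases hs k with hj | hj
    · simp only [hj, if_true]
      have h1 := ((hΛ k hj).1 z (petal_anti hA hz)).2
      have h2 := ((hΛ (-k) (by rw [sgn_neg, hj])).1 z (petal_anti hA hz')).2
      rw [hnc] at h2
      exact tendsto_nhds_unique h2 h1
    · have hj' : ¬ sgn (k : ℤ) = 1 := by rw [hj]; norm_num
      simp only [hj', if_false]
      have h1 := ((hΛ' k hj).1 z (petal_anti hB hz)).2
      have h2 := ((hΛ' (-k) (by rw [sgn_neg, hj])).1 z (petal_anti hB hz')).2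
      rw [hnc] at h2
      exact tendsto_nhds_unique h2 h1
  -- Comparing the orbit of the image of `w` with the conjugated orbit of `w` shifted by one step
  -- gives the relation between the two limits.
  · have hlimit : ∀ (d : ℂ → ℂ) (i : ℤ) (w : ℂ) (u v : ℂ),
        (∀ n, |Complex.arg (rot k i (seqOrbit (altGerm d) n w))| < π / k) →
        Tendsto (fun n => normChart k b i (seqOrbit (altGerm d) n w) - (n / 2 : ℝ)) atTop (𝓝 u) →
        Tendsto (fun n => normChart k b (-i) (seqOrbit (altGerm d) n (d (conj w))) - (n / 2 : ℝ))
          atTop (𝓝 v) → v = conj (u + 1 / 2) := by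
      intro d i w u v ha hu hv
      have h1 : Tendsto (fun n : ℕ => conj (normChart k b i (seqOrbit (altGerm d) (n + 1) w) -
          ((n + 1 : ℕ) / 2 : ℝ) + 1 / 2)) atTop (𝓝 (conj (u + 1 / 2))) :=
        (Complex.continuous_conj.tendsto _).comp
          (((tendsto_add_atTop_iff_nat 1).2 hu).add_const (1 / 2))
      refine tendsto_nhds_unique hv (h1.congr fun n => ?_)
      rw [seqOrbit_altGerm_conj, normChart_conj hk (ha (n + 1))]
      simp only [map_add, map_sub, Complex.conj_ofReal]
      push_cast
      simp [Complex.conj_ofNat]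
      ring
    simp only [hφ, sgn_neg]
    rcases hs j with hj | hj
    · simp only [hj, if_true]
      obtain ⟨h1, h2⟩ := (hΛ j hj).1 z (petal_anti hA hz)
      obtain ⟨-, h4⟩ := (hΛ (-j) (by rw [sgn_neg, hj])).1 (p z) (petal_anti hA hpz)
      have := hlimit (fun z => p (conj z)) j z _ _ h1 h2 (by simpa using h4)
      simpa using this
    · have hj' : ¬ sgn j = 1 := by rw [hj]; norm_num
      simp only [hj', if_false]
      obtain ⟨h1, h2⟩ := (hΛ' j hj).1 z (petal_anti hB hz)
      obtain ⟨h3, h4⟩ := (hΛ' (-j) (by rw [sgn_neg, hj])).1 (p z) (petal_anti hB hpz)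
      -- On a repelling petal the limiting relation runs along the inverse, so it is applied at `p
      -- z` and read backwards.
      have hq : conjGerm c' (conj (p z)) = z := by
        have h5 := hsmall _ _ (petal_anti hS (conj_mem_petal hk hz))
        have h6 := hlr (y := conj z) (by simpa using h5)
        simp only [Complex.conj_conj] at h6
        simp [conjGerm, h6]
      have := hlimit (conjGerm c') (-j) (p z) _ (Λ' j z) h3 h4 (by rw [hq, neg_neg]; exact h2)
      rw [this, hj]
      simp [Complex.conj_ofNat]
  · obtain ⟨R', h1, h2⟩ := hΛε ε hε
    obtain ⟨R'', h3, h4⟩ := hΛε' ε hε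
    refine ⟨max R₁ (max R' R''), le_max_left _ _, fun j z hz => ?_⟩
    rw [timeChart_eq]
    simp only [hφ]
    rw [← mul_sub, norm_mul, norm_sgn, one_mul]
    rcases hs j with hj | hj
    · simp only [hj, if_true]
      exact h2 j hj z (petal_anti ((le_max_left _ _).trans (le_max_right _ _)) hz)
    · have hj' : ¬ sgn j = 1 := by rw [hj]; norm_num
      simp only [hj', if_false]
      exact h4 j hj z (petal_anti ((le_max_right _ _).trans (le_max_right _ _)) hz)

end
end AntiParabolic

namespace AntiParabolic
section

/-! ### Uniqueness of Fatou coordinates -/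

/-- An injective entire function commuting with a translation is a translation. -/
theorem eq_add_const_of_injective {E : ℂ → ℂ} (hE : Differentiable ℂ E)
    (hinj : Function.Injective E) (hper : ∀ X, E (X + 1) = E X + 1) : ∃ C, ∀ X, E X = X + C := by
  obtain ⟨X₀, hX₀⟩ : ∃ X₀, deriv E X₀ ≠ 0 := by
    by_contra! h
    have h1 := is_const_of_deriv_eq_zero hE h (0 + 1) 0
    rw [hper] at h1
    simp at h1
  set F := dslope E X₀ with hF
  have hFd : Differentiable ℂ F := by
    rw [← differentiableOn_univ]
    exact (Complex.differentiableOn_dslope univ_mem).2 hE.differentiableOn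
  have hF0 : ∀ X, F X ≠ 0 := by
    intro X
    by_cases hX : X = X₀
    · rw [hX, hF, dslope_same]; exact hX₀
    · rw [hF, dslope_of_ne _ hX, slope_def_field]
      exact div_ne_zero (sub_ne_zero.2 fun h => hX (hinj h)) (sub_ne_zero.2 hX)
  have hEF : ∀ X, E X - E X₀ = (X - X₀) * F X := fun X => by
    have := sub_smul_dslope E X₀ X
    simpa using this.symm
  -- The function `(X - X₀) / (E X - E X₀)` is entire without zeros, because `E` is injective. By
  -- the open mapping theorem and injectivity its denominator is bounded below away from `X₀`, so it
  -- grows at most linearly. Liouville applied to its derivative makes it affine, and the absence of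
  -- zeros makes it constant.
  set g : ℂ → ℂ := fun X => (F X)⁻¹ with hg
  have hgd : Differentiable ℂ g := hFd.inv hF0
  obtain ⟨r, hr, hball⟩ : ∃ r > 0, ∀ X, 1 ≤ ‖X - X₀‖ → r ≤ ‖E X - E X₀‖ := by
    have hs : HasStrictDerivAt E (deriv E X₀) X₀ :=
      (hE.analyticAt X₀).hasStrictDerivAt
    have h1 : E '' Metric.ball X₀ 1 ∈ 𝓝 (E X₀) := by
      rw [← hs.map_nhds_eq hX₀]
      exact image_mem_map (Metric.ball_mem_nhds _ one_pos)
    obtain ⟨r, hr, hsub⟩ := Metric.mem_nhds_iff.1 h1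
    refine ⟨r, hr, fun X hX => ?_⟩
    by_contra! h
    obtain ⟨Y, hY, hYX⟩ := hsub (show E X ∈ Metric.ball (E X₀) r by
      rwa [Metric.mem_ball, dist_eq_norm])
    rw [hinj hYX, Metric.mem_ball, dist_eq_norm] at hY
    linarith
  obtain ⟨M, hM⟩ := (isCompact_closedBall X₀ 1).exists_bound_of_continuousOn
    hgd.continuous.continuousOn
  have hM0 : 0 ≤ M := (norm_nonneg _).trans (hM X₀ (Metric.mem_closedBall_self zero_le_one))
  have hgrow : ∀ X, ‖g X‖ ≤ M + ‖X - X₀‖ / r := by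
    intro X
    rcases le_total ‖X - X₀‖ 1 with h | h
    · have := hM X (by rwa [Metric.mem_closedBall, dist_eq_norm])
      have : 0 ≤ ‖X - X₀‖ / r := by positivity
      linarith
    · have h1 := hball X h
      rw [hEF, norm_mul] at h1
      have hFp : 0 < ‖F X‖ := norm_pos_iff.2 (hF0 X)
      have : ‖g X‖ ≤ ‖X - X₀‖ / r := by
        rw [hg, norm_inv, le_div_iff₀ hr, inv_mul_le_iff₀ hFp]
        linarith
      linarith
  have hdg : ∀ c, ‖deriv g c‖ ≤ M + 2 / r := by
    intro c
    have hρ : 0 < 1 + ‖c - X₀‖ := by positivity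
    refine (Complex.norm_deriv_le_of_forall_mem_sphere_norm_le hρ hgd.diffContOnCl
      (C := M + (1 + 2 * ‖c - X₀‖) / r) fun X hX => ?_).trans ?_
    · refine (hgrow X).trans ?_
      gcongr
      rw [mem_sphere_iff_norm] at hX
      have : X - X₀ = (X - c) + (c - X₀) := by ring
      rw [this]
      refine (norm_add_le _ _).trans ?_
      rw [hX]; linarith
    · rw [div_le_iff₀ hρ]
      have h1 : (1 + 2 * ‖c - X₀‖) / r ≤ 2 / r * (1 + ‖c - X₀‖) := by
        rw [div_mul_eq_mul_div]
        gcongr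
        linarith
      nlinarith [norm_nonneg (c - X₀), mul_nonneg hM0 (norm_nonneg (c - X₀))]
  obtain ⟨α, hα⟩ := hgd.deriv.exists_const_forall_eq_of_bounded
    (isBounded_iff_forall_norm_le.2 ⟨M + 2 / r, by rintro _ ⟨c, rfl⟩; exact hdg c⟩)
  have hlin : ∀ X, g X = g X₀ + α * (X - X₀) := by
    intro X
    have h1 : Differentiable ℂ fun X => g X - α * X := hgd.sub (differentiable_id.const_mul α)
    have h2 : ∀ X, deriv (fun X => g X - α * X) X = 0 := fun X => by
      have := (hgd X).hasDerivAt.sub ((hasDerivAt_id X).const_mul α)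
      rw [hα] at this
      have := this.deriv
      rw [mul_one, sub_self] at this
      exact this
    have := is_const_of_deriv_eq_zero h1 h2 X X₀
    linear_combination this
  have hg0 : ∀ X, g X ≠ 0 := fun X => inv_ne_zero (hF0 X)
  have hα0 : α = 0 := by
    by_contra h
    refine hg0 (X₀ - g X₀ / α) ?_
    rw [hlin]
    field_simp
    ring
  have hFc : ∀ X, F X = F X₀ := by
    intro X
    have := hlin X
    rw [hα0, zero_mul, add_zero] at this
    exact inv_injective this
  have h1 : F X₀ = 1 := by
    have := hEF (X₀ + 1)
    rw [hper, hFc] at this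
    linear_combination -this
  refine ⟨E X₀ - X₀, fun X => ?_⟩
  have := hEF X
  rw [hFc, h1] at this
  linear_combination this

/-- Every point enters the domain after enough unit translations, so the functional equation extends
`H` to an entire function. Two points can be moved by the same integer, which preserves injectivity.
-/
theorem eq_add_const_of_injOn {R : ℝ} {H : ℂ → ℂ} (hd : DifferentiableOn ℂ H (attr R))
    (hinj : Set.InjOn H (attr R)) (hper : ∀ X ∈ attr R, H (X + 1) = H X + 1) :
    ∃ C, ∀ X ∈ attr R, H X = X + C := by
  have hnat : ∀ (n : ℕ), ∀ X ∈ attr R, X + n ∈ attr R ∧ H (X + n) = H X + n := by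
    intro n X hX
    induction n with
    | zero => simpa using hX
    | succ n ih =>
      have h1 : X + ((n + 1 : ℕ) : ℂ) = (X + n) + 1 := by push_cast; ring
      rw [h1, hper _ ih.1, ih.2]
      refine ⟨?_, by push_cast; ring⟩
      simpa using add_mem_attr ih.1 zero_le_one
  have hmem : ∀ X : ℂ, ∀ n : ℕ, R - X.re < n → X + n ∈ attr R := by
    intro X n hn
    right
    simp only [Complex.add_re, Complex.natCast_re]
    linarith
  have hex : ∀ X : ℂ, ∃ n : ℕ, R - X.re < n := fun X => exists_nat_gt _
  choose N hN using hex
  set E : ℂ → ℂ := fun X => H (X + N X) - N X with hE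
  have hEn : ∀ X : ℂ, ∀ n : ℕ, X + n ∈ attr R → E X = H (X + n) - n := by
    intro X n hn
    have h1 := (hnat n _ (hmem X _ (hN X))).2
    have h2 := (hnat (N X) _ hn).2
    rw [add_right_comm] at h2
    rw [h1] at h2
    simp only [hE]
    linear_combination h2
  have hEd : Differentiable ℂ E := by
    intro X
    have h1 := (hmem X _ (hN X))
    have h2 : DifferentiableAt ℂ (fun Y => H (Y + N X) - N X) X :=
      ((hd.differentiableAt ((isOpen_attr R).mem_nhds h1)).comp X
        (differentiableAt_id.add_const _)).sub_const _
    refine h2.congr_of_eventuallyEq ?_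
    have h3 : ∀ᶠ Y : ℂ in 𝓝 X, Y + N X ∈ attr R :=
      (continuous_id.add continuous_const).continuousAt.eventually ((isOpen_attr R).mem_nhds h1)
    filter_upwards [h3] with Y hY
    exact hEn Y _ hY
  have hEinj : Function.Injective E := by
    intro X Y he
    have h1 := (hnat (N Y) _ (hmem X _ (hN X))).1
    have h2 := (hnat (N X) _ (hmem Y _ (hN Y))).1
    rw [add_assoc, ← Nat.cast_add] at h1 h2
    rw [Nat.add_comm] at h2
    rw [hEn X _ h1, hEn Y _ h2] at he
    have := hinj h1 h2 (by linear_combination he)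
    exact add_right_cancel this
  have hEper : ∀ X, E (X + 1) = E X + 1 := by
    intro X
    have h1 := hmem X _ (hN X)
    have h2 := (hnat 1 _ h1).1
    rw [Nat.cast_one, add_right_comm] at h2
    rw [hEn X _ h1, hEn (X + 1) _ h2, add_right_comm, hper _ h1]
    ring
  obtain ⟨C, hC⟩ := eq_add_const_of_injective hEd hEinj hEper
  refine ⟨C, fun X hX => ?_⟩
  rw [← hC, hEn X 0 (by simpa using hX)]
  simp

variable {k : ℕ} {b : ℝ} {j : ℤ} {z : ℂ} {R R₁ R₂ : ℝ} {p : ℂ → ℂ} {φ Θ ψ : ℤ → ℂ → ℂ}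

theorem timeDomain_anti {R R' : ℝ} (h : R ≤ R') : timeDomain R' j ⊆ timeDomain R j := fun W hW => by
  rw [mem_timeDomain_iff] at hW ⊢
  exact attr_anti h hW

theorem mem_timeDomain_of_norm_sub_le {R R' r : ℝ} {Z Z' : ℂ} (hZ : Z ∈ timeDomain R j)
    (h : ‖Z' - Z‖ ≤ r) (hR : R' ≤ R - r) : Z' ∈ timeDomain R' j := by
  rw [mem_timeDomain_iff] at hZ ⊢
  refine mem_attr_of_norm_sub_lt hZ ?_ hR
  rwa [← mul_sub, norm_mul, norm_sgn, one_mul]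

theorem neg_mem_Icc (hj : j ∈ Set.Icc (-(k : ℤ)) k) : -j ∈ Set.Icc (-(k : ℤ)) k := by
  rw [Set.mem_Icc] at hj ⊢; omega

theorem IsFatouCoordinates.exists_comp_self (hk : 1 ≤ k) (hp : IsPrenormalized p k b)
    (hψ : IsFatouCoordinates p k b R ψ) : ∃ R', R ≤ R' ∧ ∀ j ∈ Set.Icc (-(k : ℤ)) k,
      ∀ z ∈ petal k b R' j, p z ∈ petal k b R (-j) ∧ p (p z) ∈ petal k b R j ∧
        ψ j (p (p z)) = ψ j z + 1 := by
  obtain ⟨R₀, hR₀, K, hK, h⟩ := exists_mem_petal_neg_of_orderGE hk b (orderGE_of_isPrenormalized hp)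
  set A := max R R₀
  have hA : R ≤ A := le_max_left _ _
  have hA₀ : R₀ ≤ A := le_max_right _ _
  refine ⟨A + 2 * K, by linarith, fun j hj z hz => ?_⟩
  have h1 : p z ∈ petal k b (A + K) (-j) := h (A + 2 * K) (by linarith) _ (by linarith) j z hz
  have h2 : p (p z) ∈ petal k b A j := by
    simpa using h (A + K) (by linarith) A (by linarith) (-j) _ h1
  have h3 := petal_anti (by linarith : R ≤ A + K) h1
  have h4 := petal_anti hA h2
  refine ⟨h3, h4, ?_⟩
  have e1 := hψ.conjugate j hj z (petal_anti (by linarith) hz) h3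
  have e2 := hψ.conjugate (-j) (neg_mem_Icc hj) (p z) h3 (by simpa using h4)
  rw [neg_neg] at e2
  rw [e2, e1]
  simp [Complex.conj_ofNat]
  ring

namespace IsStandardFatou

theorem exists_mem_timeDomain (S : IsStandardFatou p k b R₁ R₂ φ Θ) (R : ℝ) :
    ∃ R', R₂ ≤ R' ∧ R ≤ R' ∧ ∀ j, ∀ z ∈ petal k b R' j, φ j z ∈ timeDomain R j := by
  obtain ⟨R', h1, h2⟩ := S.near 1 one_pos
  refine ⟨max (max R' R₂) (R + 1), (le_max_right _ _).trans (le_max_left _ _),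
    (by linarith : R ≤ R + 1).trans (le_max_right _ _), fun j z hz => ?_⟩
  exact mem_timeDomain_of_norm_sub_le hz.2.2.2
    (h2 j z (petal_anti ((le_max_left _ _).trans (le_max_left _ _)) hz))
    (by linarith [le_max_right (max R' R₂) (R + 1)])

theorem inv_mem_petal (S : IsStandardFatou p k b R₁ R₂ φ Θ) (hR : R₂ ≤ R) {W : ℂ}
    (hW : W ∈ timeDomain R j) : Θ j W ∈ petal k b (R - 1) j := by
  have h1 := S.inv_mem j W (timeDomain_anti hR hW)
  have h2 := S.inv_near j W (timeDomain_anti hR hW)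
  exact ⟨h1.1, h1.2.1, h1.2.2.1, mem_timeDomain_of_norm_sub_le hW h2 (by linarith)⟩

theorem inv_left (S : IsStandardFatou p k b R₁ R₂ φ Θ) (hj : j ∈ Set.Icc (-(k : ℤ)) k)
    (hz : z ∈ petal k b R₁ j) (h : φ j z ∈ timeDomain R₂ j) : Θ j (φ j z) = z :=
  S.fatou.injective j hj (S.inv_mem j _ h) hz (S.inv_right j _ h)

/-- Uniqueness of Fatou coordinates up to translations. -/
theorem exists_eq_add_const (hk : 1 ≤ k) (hp : IsPrenormalized p k b)
    (S : IsStandardFatou p k b R₁ R₂ φ Θ) (hψ : IsFatouCoordinates p k b R ψ) :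
    ∃ R', R₂ ≤ R' ∧ R ≤ R' ∧ ∃ C : ℤ → ℂ, ∀ j ∈ Set.Icc (-(k : ℤ)) k, ∀ z ∈ petal k b R' j,
      ψ j z = φ j z + C j := by
  obtain ⟨R_a, ha, hcψ⟩ := hψ.exists_comp_self hk hp
  obtain ⟨R_b, hb, hcφ⟩ := S.fatou.exists_comp_self hk hp
  set R_c := max (max R_a R_b) R₂ + 1 with hR_c
  have hac : R_a + 1 ≤ R_c := by
    have := (le_max_left R_a R_b).trans (le_max_left _ R₂); linarith
  have hbc : R_b + 1 ≤ R_c := by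
    have := (le_max_right R_a R_b).trans (le_max_left _ R₂); linarith
  have h2c : R₂ + 1 ≤ R_c := by
    have := le_max_right (max R_a R_b) R₂; linarith
  have key : ∀ j ∈ Set.Icc (-(k : ℤ)) k, ∃ C, ∀ W ∈ timeDomain R_c j, ψ j (Θ j W) = W + C := by
    intro j hj
    have hmem : ∀ W ∈ timeDomain R_c j, Θ j W ∈ petal k b R_a j ∧ Θ j W ∈ petal k b R_b j := by
      intro W hW
      have := S.inv_mem_petal (by linarith) hW
      exact ⟨petal_anti (by linarith) this, petal_anti (by linarith) this⟩
    have hper : ∀ W ∈ timeDomain R_c j, W + 1 ∈ timeDomain R_c j →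
        ψ j (Θ j (W + 1)) = ψ j (Θ j W) + 1 := by
      intro W hW hW1
      obtain ⟨h1, h2⟩ := hmem W hW
      obtain ⟨-, h3, h4⟩ := hcφ j hj _ h2
      have h5 : Θ j (W + 1) = p (p (Θ j W)) := by
        refine S.fatou.injective j hj (S.inv_mem j _ (timeDomain_anti (by linarith) hW1)) h3 ?_
        rw [h4, S.inv_right j _ (timeDomain_anti (by linarith) hW1),
          S.inv_right j _ (timeDomain_anti (by linarith) hW)]
      rw [h5, (hcψ j hj _ h1).2.2]
    have hsj : (sgn j : ℂ) ≠ 0 := by rw [← norm_ne_zero_iff, norm_sgn]; norm_num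
    have hmaps : Set.MapsTo (fun X => (sgn j : ℂ) * X) (attr R_c) (timeDomain R_c j) := by
      intro X hX
      rw [mem_timeDomain_iff, ← mul_assoc, sgn_mul_self', one_mul]
      exact hX
    -- The change of Fatou coordinate is conjugated by the sign, so that repelling petals are also
    -- read on an attracting domain.
    have hd : DifferentiableOn ℂ (fun X => (sgn j : ℂ) * ψ j (Θ j (sgn j * X))) (attr R_c) := by
      refine DifferentiableOn.const_mul ((hψ.holomorphic j hj).comp
        (((S.inv_holomorphic j).mono (timeDomain_anti (by linarith))).comp
        (differentiableOn_id.const_mul _) hmaps) fun X hX => ?_) _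
      exact petal_anti (by linarith) (hmem _ (hmaps hX)).1
    have hinj : Set.InjOn (fun X => (sgn j : ℂ) * ψ j (Θ j (sgn j * X))) (attr R_c) := by
      intro X hX Y hY he
      have h1 := hψ.injective j hj (petal_anti ha (hmem _ (hmaps hX)).1)
        (petal_anti ha (hmem _ (hmaps hY)).1) (mul_left_cancel₀ hsj he)
      have h2 := congrArg (φ j) h1
      rw [S.inv_right j _ (timeDomain_anti (by linarith) (hmaps hX)),
        S.inv_right j _ (timeDomain_anti (by linarith) (hmaps hY))] at h2
      exact mul_left_cancel₀ hsj h2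
    have hstep : ∀ X ∈ attr R_c, (fun X => (sgn j : ℂ) * ψ j (Θ j (sgn j * X))) (X + 1) = (fun X => (sgn j : ℂ) * ψ j (Θ j (sgn j * X))) X + 1 := by
      intro X hX
      have h1 := hmaps hX
      have h2 := hmaps (by simpa using add_mem_attr hX zero_le_one : X + 1 ∈ attr R_c)
      simp only
      have hs : sgn j = 1 ∨ sgn j = -1 := by unfold sgn; split_ifs <;> simp
      rcases hs with hs | hs <;> rw [hs] at h1 h2 ⊢ <;> push_cast at h1 h2 ⊢
      · rw [mul_add, mul_one] at h2 ⊢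
        rw [hper _ h1 h2]; ring
      · have := hper _ h2 (by rwa [mul_add, mul_one, neg_add_cancel_right])
        rw [mul_add, mul_one, neg_add_cancel_right] at this
        rw [this, mul_add, mul_one]; ring
    obtain ⟨C, hC⟩ := eq_add_const_of_injOn hd hinj hstep
    refine ⟨sgn j * C, fun W hW => ?_⟩
    have h1 := hC _ (mem_timeDomain_iff.1 hW)
    simp only [← mul_assoc, sgn_mul_self', one_mul] at h1
    refine mul_left_cancel₀ hsj (h1.trans ?_)
    rw [mul_add, ← mul_assoc, sgn_mul_self', one_mul]
  choose! C hC using key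
  obtain ⟨R', h1, h2, h3⟩ := S.exists_mem_timeDomain R_c
  refine ⟨R', h1, by linarith, C, fun j hj z hz => ?_⟩
  have h4 := hC j hj _ (h3 j z hz)
  rwa [S.inv_left hj (petal_anti (S.le.trans h1) hz) (timeDomain_anti (by linarith) (h3 j z hz))]
    at h4

end IsStandardFatou

end
end AntiParabolic

namespace AntiParabolic
section

/-! ### Ends of the plane and equivalence of transition functions -/

variable {k : ℕ} {b : ℝ} {j : ℤ} {z : ℂ} {R R₁ R₂ : ℝ} {p : ℂ → ℂ} {φ Θ ψ : ℤ → ℂ → ℂ}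

/-- The sign of the imaginary part at the end of index `j`. -/
def hornSign (j : ℤ) : ℝ := if (Odd j ↔ 0 < j) then 1 else -1

theorem eventually_hornEnd {P : ℂ → Prop} :
    (∀ᶠ W in hornEnd j, P W) ↔ ∃ M : ℝ, ∀ W : ℂ, M < hornSign j * W.im → P W := by
  unfold hornEnd hornSign
  split_ifs
  · rw [eventually_comap]
    constructor
    · intro h
      obtain ⟨M, hM⟩ := eventually_atTop.1 h
      exact ⟨M, fun W hW => hM W.im (by linarith) W rfl⟩
    · rintro ⟨M, hM⟩
      filter_upwards [eventually_gt_atTop M] with y hy W hW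
      exact hM W (by rw [hW]; linarith)
  · rw [eventually_comap]
    constructor
    · intro h
      obtain ⟨M, hM⟩ := eventually_atBot.1 h
      exact ⟨-M, fun W hW => hM W.im (by linarith) W rfl⟩
    · rintro ⟨M, hM⟩
      filter_upwards [eventually_lt_atBot (-M)] with y hy W hW
      exact hM W (by rw [hW]; linarith)

theorem tendsto_hornEnd {i j : ℤ} {F : ℂ → ℂ} (c : ℝ)
    (h : ∀ W, hornSign j * (F W).im = hornSign i * W.im + c) :
    Tendsto F (hornEnd i) (hornEnd j) := by
  intro s hs
  obtain ⟨M, hM⟩ := eventually_hornEnd.1 (show ∀ᶠ W in hornEnd j, W ∈ s from hs)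
  exact eventually_hornEnd.2 ⟨M - c, fun W hW => hM _ (by rw [h]; linarith)⟩

theorem hornSign_neg (hj : j ≠ 0) : hornSign (-j) = -hornSign j := by
  unfold hornSign
  simp only [odd_neg]
  rcases lt_or_gt_of_ne hj with h | h
  · have h1 : (0 < -j) = True := by simpa using h
    have h2 : (0 < j) = False := by simp; omega
    simp only [h1, h2]
    by_cases h3 : Odd j <;> simp [h3]
  · have h1 : (0 < -j) = False := by simp; omega
    have h2 : (0 < j) = True := by simpa using h
    simp only [h1, h2]
    by_cases h3 : Odd j <;> simp [h3]

theorem hornSign_rotation (hk : Even k) (hj : j ∈ Set.Icc (1 : ℤ) k) :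
    hornSign (k - j + 1) = -hornSign j := by
  obtain ⟨h1, h2⟩ := hj
  have h3 : (0 : ℤ) < k - j + 1 := by omega
  have h4 : 0 < j := by omega
  have h5 : Odd ((k : ℤ) - j + 1) ↔ ¬ Odd j := by
    have : Even (k : ℤ) := by exact_mod_cast hk
    rw [Int.odd_add, Int.odd_sub, ← Int.not_even_iff_odd, ← Int.not_even_iff_odd]
    simp [this]
  unfold hornSign
  by_cases h6 : Odd j
  · simp [h3, h4, h5, h6]
  · simp [h3, h4, h5, h6]

/-- The germ `Ψ` at the end of index `j` commutes with `T_{1/2}`. -/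
def CommutesWithHalf (j : ℤ) (Ψ : ℂ → ℂ) : Prop := Ψ ∘ T (1 / 2) =ᶠ[hornEnd j] T (1 / 2) ∘ Ψ

theorem CommutesWithHalf.congr {Ψ Ψ' : ℂ → ℂ} (h : CommutesWithHalf j Ψ) (he : Ψ =ᶠ[hornEnd j] Ψ') :
    CommutesWithHalf j Ψ' := by
  have ht : Tendsto (T (1 / 2)) (hornEnd j) (hornEnd j) :=
    tendsto_hornEnd 0 fun W => by simp [T]
  filter_upwards [h, he, ht.eventually he] with W h1 h2 h3
  simp only [Function.comp] at h1 ⊢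
  rw [← h3, ← h2, h1]

theorem CommutesWithHalf.translate {Ψ : ℂ → ℂ} (h : CommutesWithHalf j Ψ) (C : ℝ) :
    CommutesWithHalf j (T C ∘ Ψ ∘ T (-(C : ℂ))) := by
  have ht : Tendsto (T (-(C : ℂ))) (hornEnd j) (hornEnd j) :=
    tendsto_hornEnd 0 fun W => by simp [T]
  filter_upwards [ht.eventually h] with W hW
  simp only [Function.comp, T] at hW ⊢
  rw [add_right_comm, hW]
  ring

theorem CommutesWithHalf.opposite {i j : ℤ} {Ψ : ℂ → ℂ} (hij : hornSign j = -hornSign i)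
    (h : CommutesWithHalf i Ψ) : CommutesWithHalf j (opposite Ψ) := by
  have ht : Tendsto (Sig ∘ T (-(1 / 2))) (hornEnd j) (hornEnd i) :=
    tendsto_hornEnd 0 fun W => by simp [Sig, T, hij, Complex.conj_ofNat]
  filter_upwards [ht.eventually h] with W hW
  simp only [Function.comp, T, Sig, AntiParabolic.opposite, map_add, map_neg, map_div₀, map_one,
    Complex.conj_ofNat] at hW ⊢
  rw [show conj W + 1 / 2 + -(1 / 2) = conj W + -(1 / 2) + 1 / 2 by ring, hW]
  simp [Complex.conj_ofNat]

theorem commutesWithHalf_translationRel {Ψ Ψ' : ℤ → ℂ → ℂ} (h : TranslationRel k Ψ Ψ') :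
    (∀ j ∈ Set.Icc (1 : ℤ) k, CommutesWithHalf j (Ψ j)) ↔
      ∀ j ∈ Set.Icc (1 : ℤ) k, CommutesWithHalf j (Ψ' j) := by
  obtain ⟨C, hC⟩ := h
  refine forall₂_congr fun j hj => ⟨fun h => ?_, fun h => ?_⟩
  · have h1 := (h.congr (hC j hj)).translate (-C)
    refine h1.congr (Eventually.of_forall fun W => ?_)
    simp [T]
  · exact (h.translate C).congr (hC j hj).symm

/-- The operation is an involution only up to conjugation by `T 1`. Hence the converse direction for
the rotation relation ends with a shift by `1`. -/
theorem opposite_opposite (Ψ : ℂ → ℂ) : opposite (opposite Ψ) = fun W => Ψ (W - 1) + 1 := by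
  ext W
  simp only [Function.comp, T, Sig, opposite, map_add, map_neg, map_div₀, map_one,
    Complex.conj_ofNat, Complex.conj_conj]
  ring_nf

theorem commutesWithHalf_rotationRel (hk : Even k) {Ψ Ψ' : ℤ → ℂ → ℂ} (h : RotationRel k Ψ Ψ') :
    (∀ j ∈ Set.Icc (1 : ℤ) k, CommutesWithHalf j (Ψ j)) ↔
      ∀ j ∈ Set.Icc (1 : ℤ) k, CommutesWithHalf j (Ψ' j) := by
  have hmem : ∀ j ∈ Set.Icc (1 : ℤ) k, (k : ℤ) - j + 1 ∈ Set.Icc (1 : ℤ) k := by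
    intro j hj; rw [Set.mem_Icc] at hj ⊢; omega
  constructor
  · intro hQ j hj
    have h1 := hQ _ (hmem j hj)
    exact (h1.opposite (by rw [hornSign_rotation hk hj]; ring)).congr (h j hj).symm
  · intro hQ i hi
    have hj := hmem i hi
    have h1 := (hQ _ hj).congr (h _ hj)
    rw [show (k : ℤ) - (k - i + 1) + 1 = i by ring] at h1
    have h2 := h1.opposite (j := i) (by rw [hornSign_rotation hk hi]; ring)
    rw [opposite_opposite] at h2
    have ht : Tendsto (T 1) (hornEnd i) (hornEnd i) := tendsto_hornEnd 0 fun W => by simp [T]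
    filter_upwards [ht.eventually h2] with W hW
    simp only [Function.comp, T] at hW ⊢
    rw [show W + 1 + 1 / 2 - 1 = W + 1 / 2 by ring, add_sub_cancel_right] at hW
    linear_combination hW

theorem commutesWithHalf_of_eqvGen {Ψ Ψ' : ℤ → ℂ → ℂ}
    (h : Relation.EqvGen (fun Φ Φ' => TranslationRel k Φ Φ' ∨ (Even k ∧ RotationRel k Φ Φ')) Ψ Ψ') :
    (∀ j ∈ Set.Icc (1 : ℤ) k, CommutesWithHalf j (Ψ j)) ↔
      ∀ j ∈ Set.Icc (1 : ℤ) k, CommutesWithHalf j (Ψ' j) := by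
  induction h with
  | rel x y h =>
    rcases h with h | ⟨hk, h⟩
    · exact commutesWithHalf_translationRel h
    · exact commutesWithHalf_rotationRel hk h
  | refl x => rfl
  | symm x y _ ih => exact ih.symm
  | trans x y z _ _ ih1 ih2 => exact ih1.trans ih2

/-- In `Sig ∘ opposite Ψ` the two conjugations on the left cancel, leaving `T (1/2) ∘ Ψ` at the
point `Sig (T (-1/2) W)`. Equality with `Ψ (Sig W)` is commutation at that point, and this
substitution exchanges the ends of index `j` and `-j`. -/
theorem commutesWithHalf_iff_sig (hj : j ∈ Set.Icc (1 : ℤ) k) (Ψ : ℂ → ℂ) :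
    CommutesWithHalf j Ψ ↔ Ψ ∘ Sig =ᶠ[hornEnd (-j)] Sig ∘ opposite Ψ := by
  have hj0 : j ≠ 0 := by rw [Set.mem_Icc] at hj; omega
  constructor
  · intro h
    have ht : Tendsto (Sig ∘ T (-(1 / 2))) (hornEnd (-j)) (hornEnd j) :=
      tendsto_hornEnd 0 fun W => by simp [Sig, T, hornSign_neg hj0, Complex.conj_ofNat]
    filter_upwards [ht.eventually h] with W hW
    simp only [Function.comp, T, Sig, AntiParabolic.opposite, map_add, map_neg, map_div₀, map_one,
      Complex.conj_ofNat, Complex.conj_conj, neg_add_cancel_right] at hW ⊢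
    exact hW
  · intro h
    have ht : Tendsto (Sig ∘ T (1 / 2)) (hornEnd j) (hornEnd (-j)) :=
      tendsto_hornEnd 0 fun W => by simp [Sig, T, hornSign_neg hj0, Complex.conj_ofNat]
    filter_upwards [ht.eventually h] with W hW
    simp only [Function.comp, T, Sig, AntiParabolic.opposite, map_add, map_div₀, map_one,
      Complex.conj_ofNat, Complex.conj_conj, add_neg_cancel_right] at hW ⊢
    exact hW

end
end AntiParabolic

namespace AntiParabolic
section

/-! ### Germs with real coefficients -/

variable {k : ℕ} {b : ℝ} {j : ℤ} {z : ℂ} {R R₁ R₂ : ℝ} {p P h f : ℂ → ℂ} {A : ℕ → ℝ}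
  {φ Θ ψ : ℤ → ℂ → ℂ}

theorem HasRealExpansion.hasFPowerSeriesAt (hP : HasRealExpansion P A) :
    HasFPowerSeriesAt (fun z => P (conj z))
      (FormalMultilinearSeries.ofScalars ℂ fun n => (A n : ℂ)) 0 := by
  rw [hasFPowerSeriesAt_iff]
  filter_upwards [eventually_conj hP.2] with z hz
  simpa [mul_comm] using hz

theorem HasRealExpansion.isAntiholomorphicGerm (hP : HasRealExpansion P A) :
    IsAntiholomorphicGerm P := by
  refine ⟨?_, hP.hasFPowerSeriesAt.analyticAt⟩
  have h1 := hP.2.self_of_nhds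
  simp only [map_zero] at h1
  have h2 := hasSum_single (f := fun n : ℕ => (A n : ℂ) * 0 ^ n) 0 fun n hn => by simp [hn]
  have := h1.unique h2
  simpa [hP.1] using this

theorem HasRealExpansion.hasDerivAt (hP : HasRealExpansion P A) :
    HasDerivAt (fun z => P (conj z)) (A 1) 0 := by
  simpa using hP.hasFPowerSeriesAt.hasDerivAt

theorem HasRealExpansion.eventually_conj_eq (hP : HasRealExpansion P A) :
    ∀ᶠ z in 𝓝 0, P (conj z) = conj (P z) := by
  filter_upwards [hP.2, eventually_conj hP.2] with z h1 h2
  have h3 := h1.map (starRingEnd ℂ) Complex.continuous_conj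
  refine h2.unique ?_
  simpa [Function.comp_def] using h3

/-- An antiholomorphic germ commuting with the conjugation has real coefficients. -/
theorem exists_hasRealExpansion (hP : IsAntiholomorphicGerm P)
    (h : ∀ᶠ z in 𝓝 0, P (conj z) = conj (P z)) : ∃ A, HasRealExpansion P A ∧ (A 1 : ℂ) = dbar P := by
  obtain ⟨q, hq⟩ := hP.2
  have h1 := hasFPowerSeriesAt_iff.1 hq
  have hreal : ∀ n, conj (q.coeff n) = q.coeff n := by
    have h2 : HasFPowerSeriesAt (fun z => P (conj z))
        (FormalMultilinearSeries.ofScalars ℂ fun n => conj (q.coeff n)) 0 := by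
      rw [hasFPowerSeriesAt_iff]
      filter_upwards [eventually_conj h1, h] with z h3 h4
      have h5 := h3.map (starRingEnd ℂ) Complex.continuous_conj
      simp only [zero_add, Complex.conj_conj, ← h4] at h5 ⊢
      simpa [Function.comp_def] using h5
    intro n
    have h3 := hq.eq_formalMultilinearSeries h2
    conv_rhs => rw [h3]
    simp
  refine ⟨fun n => (q.coeff n).re, ⟨?_, ?_⟩, ?_⟩
  · have : q.coeff 0 = P (conj 0) := hq.coeff_zero _
    simp [this, hP.1]
  · filter_upwards [eventually_conj h1] with z hz
    simp only [zero_add, Complex.conj_conj] at hz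
    have h2 : (fun n : ℕ => (((q.coeff n).re : ℝ) : ℂ) * conj z ^ n) =
        fun n => conj z ^ n • q.coeff n := by
      ext n
      rw [Complex.conj_eq_iff_re.1 (hreal n), smul_eq_mul, mul_comm]
    rwa [h2]
  · rw [Complex.conj_eq_iff_re.1 (hreal 1), dbar, hq.deriv]
    simp

/-- The square is `z ↦ p (conj z)` composed with its conjugate germ, and since `b` is real both have
the jet `normalJet k b`. -/
theorem square_of_isPrenormalized (hk : 1 ≤ k) (hp : IsPrenormalized p k b) :
    OrderGE (2 * k + 2) fun z => p (p z) -
      (z + z ^ (k + 1) + (((k : ℂ) + 1) / 2 - b) * z ^ (2 * k + 1)) := by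
  have hN := (isPrenormalized_iff.1 hp).2
  have hid := orderGE_of_isPrenormalized hp
  have hNbar : OrderGE (2 * k + 2) fun z => conj (p z) - normalJet k b z :=
    hN.conjGerm.congr fun z => by simp only [conjGerm, map_sub, conj_normalJet, Complex.conj_conj]
  have hN1 : OrderGE 1 (normalJet k b) :=
    (((orderGE_normalJet_sub_id k b).mono (by omega)).add OrderGE.self).congr fun z => by ring
  have hc1 : OrderGE 1 fun z => conj (p z) := hp.1.orderGE.star
  have e1 := hN.comp hc1
  have e2 := OrderGE.comp_sub_comp (n := 0) (analyticAt_normalJet k b 0) hN1 hc1 hN1 hNbar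
  refine ((e1.add (e2.mono (by omega))).add (normalJet_comp_self hk b)).congr fun z => ?_
  simp only [Complex.conj_conj]
  ring

/-- A prenormalized germ conjugate to a germ with real coefficients commutes with an antiholomorphic
involution tangent to the conjugation. -/
theorem exists_symmetry (hk : 1 ≤ k) (hp : IsPrenormalized p k b) (hc : Conjugates h p P)
    (hP : HasRealExpansion P A) (hA : Even k → A 1 = 1) :
    ∃ τ : ℂ → ℂ, IsAntiholomorphicGerm τ ∧ OrderGE (k + 1) (fun z => τ (conj z) - z) ∧
      (∀ᶠ z in 𝓝 0, τ (τ z) = z) ∧ ∀ᶠ z in 𝓝 0, τ (p z) = p (τ z) := by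
  obtain ⟨hh, hcomm⟩ := hc
  obtain ⟨h', hh', hd', hl, hr⟩ := hh.exists_inverse
  have hPa := hP.isAntiholomorphicGerm
  set τ : ℂ → ℂ := fun z => h' (conj (h z)) with hτ
  have hτa : IsAntiholomorphicGerm τ :=
    (isAntiholomorphicGerm_conj.comp_holomorphic hh.analytic hh.map_zero).holomorphic_comp
      hh'.analytic hh'.map_zero
  have hττ : ∀ᶠ z in 𝓝 0, τ (τ z) = z := by
    filter_upwards [(tendsto_conj_zero.comp hh.tendsto).eventually hr, hl] with z h1 h2
    simp only [Function.comp] at h1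
    simp only [hτ, h1, Complex.conj_conj, h2]
  have hτp : ∀ᶠ z in 𝓝 0, τ (p z) = p (τ z) := by
    filter_upwards [hcomm, hh.tendsto.eventually hP.eventually_conj_eq,
      hτa.tendsto.eventually hcomm, (tendsto_conj_zero.comp hh.tendsto).eventually hr,
      (hp.1.tendsto.comp hτa.tendsto).eventually hl] with z h1 h2 h3 h4 h5
    simp only [Function.comp] at h4 h5
    have h6 : h (τ z) = conj (h z) := h4
    rw [← h5, h3, h6, h2, ← h1]
  -- the linear part
  set a := deriv h 0 with ha
  have hpid := orderGE_of_isPrenormalized hp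
  have hpd : HasDerivAt (fun z => p (conj z)) 1 0 :=
    OrderGE.hasDerivAt ((hpid.mono (by omega)).congr fun z => by ring)
  have hcd := hasDerivAt_conjGerm hh.hasDerivAt
  have haA : a = A 1 * conj a := by
    have e1 : HasDerivAt (fun z => h (p (conj z))) (a * 1) 0 :=
      hasDerivAt_comp_zero hh.hasDerivAt hpd (by simp [hp.1.1])
    have e2 : HasDerivAt (fun z => P (conj (conjGerm h z))) (A 1 * conj a) 0 :=
      hasDerivAt_comp_zero (F := fun z => P (conj z)) hP.hasDerivAt hcd (by simp [conjGerm, hh.map_zero])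
    have e3 := e2.congr_of_eventuallyEq (f₁ := fun z => h (p (conj z))) (by
      filter_upwards [eventually_conj hcomm] with z hz
      simp [hz, conjGerm])
    rw [← e1.unique e3, mul_one]
  -- The multipliers satisfy `a = A 1 * conj a` with `A 1` real; inserting the conjugate relation
  -- gives the square.
  have hA1 : A 1 * A 1 = 1 := by
    have h1 : conj a = A 1 * a := by
      have := congrArg (starRingEnd ℂ) haA
      simpa using this
    rw [h1] at haA
    have h2 : ((A 1 * A 1 : ℝ) : ℂ) = 1 := by
      refine mul_right_cancel₀ hh.deriv_ne_zero ?_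
      push_cast
      rw [← ha]
      linear_combination -haA
    exact_mod_cast h2
  have htd : HasDerivAt (fun z => τ (conj z)) (A 1) 0 := by
    have h0 : HasDerivAt (fun z => h' (conjGerm h z)) (a⁻¹ * conj a) 0 :=
      hasDerivAt_comp_zero hd' hcd (by simp [conjGerm, hh.map_zero])
    have h1 : a⁻¹ * conj a = A 1 := by
      have h2 : (A 1 : ℂ) * A 1 = 1 := by exact_mod_cast hA1
      have : conj a = A 1 * a := by
        rw [haA, map_mul, Complex.conj_ofReal, Complex.conj_conj, ← haA]
      rw [this, inv_mul_eq_iff_eq_mul₀ hh.deriv_ne_zero]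
      ring
    rw [h1] at h0
    exact h0
  have hto : OrderGE 2 fun z => τ (conj z) - A 1 * z :=
    OrderGE.of_hasDerivAt hτa.2 (by simp [hτa.1]) htd
  have hsq := square_of_isPrenormalized hk hp
  have hsq' : OrderGE (2 * k + 2) fun z => conj (p (p (conj z))) -
      (z + z ^ (k + 1) + (((k : ℂ) + 1) / 2 - b) * z ^ (2 * k + 1)) :=
    hsq.conjGerm.congr fun z => by simp [conjGerm, Complex.conj_ofNat]
  have hcm : ∀ᶠ z in 𝓝 0, τ (conj (conj (p (p (conj z))))) = p (p (τ (conj z))) := by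
    filter_upwards [eventually_conj hτp, (hp.1.tendsto.comp tendsto_conj_zero).eventually hτp]
      with z h1 h2
    simp only [Function.comp] at h2
    rw [Complex.conj_conj, h2, h1]
  have hcm0 : ∀ n, OrderGE n fun z => τ (conj (conj (p (p (conj z))))) - p (p (τ (conj z))) :=
    fun n => (OrderGE.zero_fun n).congr_ev (by
      filter_upwards [hcm] with z hz; rw [hz, sub_self])
  have hlow : ∀ {g : ℂ → ℂ}, OrderGE (2 * k + 2) (fun z => g z -
      (z + z ^ (k + 1) + (((k : ℂ) + 1) / 2 - b) * z ^ (2 * k + 1))) →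
      OrderGE (k + 2) fun z => g z - (z + 1 * z ^ (k + 1)) := by
    intro g hg
    refine ((hg.mono (by omega)).add (((OrderGE.pow_self (2 * k + 1)).const_mul
      (((k : ℂ) + 1) / 2 - b)).mono (by omega))).congr fun z => by ring
  have hlead := leading_coeff_of_conjugation hk hτa.2 hto (hlow hsq') (hlow hsq) (hcm0 _)
  -- The leading terms give `A 1 = A 1 ^ (k + 1)`. With `A 1 = ±1` this settles odd `k`; for even
  -- `k` it says nothing, and the assumption on `A 1` is indispensable.
  have hA1' : A 1 = 1 := by
    by_cases hev : Even k
    · exact hA hev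
    · have h1 : A 1 ^ (k + 1) = 1 := by
        have h2 : Even (k + 1) := by rw [Nat.even_add_one]; exact hev
        obtain ⟨m, hm⟩ := h2
        rw [hm, pow_add, ← mul_pow, hA1, one_pow]
      have h2 : ((A 1 : ℝ) : ℂ) = 1 := by
        rw [mul_one, one_mul] at hlead
        rw [hlead]; exact_mod_cast h1
      exact_mod_cast h2
  rw [hA1'] at hto
  exact ⟨τ, hτa, (conjugation_of_prenormalized hk hτa.2 (hto.congr fun z => by simp) hsq' hsq
    (hcm0 _)).1, hττ, hτp⟩

end
end AntiParabolic

namespace AntiParabolic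
section

/-! ### Symmetric germs have symmetric transition functions -/

variable {k : ℕ} {b : ℝ} {j : ℤ} {z : ℂ} {R R₁ R₂ : ℝ} {p P h f τ : ℂ → ℂ} {A : ℕ → ℝ}
  {φ Θ ψ : ℤ → ℂ → ℂ}

theorem isOpen_petal (hk : 1 ≤ k) (b R : ℝ) (j : ℤ) : IsOpen (petal k b R j) := by
  rw [isOpen_iff_mem_nhds]
  intro z hz
  obtain ⟨h1, h2, h3, h4⟩ := mem_petal_iff.1 hz
  have h5 : π / k ≤ π := div_le_self Real.pi_pos.le (by exact_mod_cast hk)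
  have hs : rot k j z ∈ Complex.slitPlane := by
    rw [Complex.mem_slitPlane_iff_arg]
    exact ⟨fun h => by rw [h, abs_of_pos Real.pi_pos] at h3; linarith, rot_ne_zero h1⟩
  have hrot : ContinuousAt (rot k j) z := by unfold rot; fun_prop
  have ha : ContinuousAt (fun z => |Complex.arg (rot k j z)|) z :=
    (ContinuousAt.comp (Complex.continuousAt_arg hs) hrot).abs
  filter_upwards [isOpen_ne.mem_nhds h1, continuous_norm.continuousAt.eventually_lt_const h2,
    ha.eventually_lt_const h3, (differentiableAt_normChart hk h1 h3).continuousAt.eventually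
      ((isOpen_attr R).mem_nhds h4)] with y e1 e2 e3 e4
  exact mem_petal_iff.2 ⟨e1, e2, e3, e4⟩

theorem differentiableAt_conj_comp {F : ℂ → ℂ} (h : DifferentiableAt ℂ (fun w => F (conj w)) (conj z)) :
    DifferentiableAt ℂ (fun w => conj (F w)) z := by
  have := h.conj_conj
  simpa [Function.comp_def] using! this

theorem half_mem_timeDomain (R : ℝ) (j : ℤ) :
    ((sgn j * (|R| + 1) : ℝ) : ℂ) ∈ timeDomain R j := by
  rw [mem_timeDomain_iff]
  push_cast
  rw [← mul_assoc, sgn_mul_self', one_mul]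
  right
  simp only [Complex.add_re, Complex.ofReal_re, Complex.one_re]
  linarith [le_abs_self R]

theorem IsStandardFatou.petal_nonempty (S : IsStandardFatou p k b R₁ R₂ φ Θ) (R : ℝ) (j : ℤ) :
    (petal k b R j).Nonempty := by
  have h := S.inv_mem_petal (R := max (R + 1) R₂) (le_max_right _ _)
    (half_mem_timeDomain (max (R + 1) R₂) j)
  exact ⟨_, petal_anti (by linarith [le_max_left (R + 1) R₂]) h⟩

/-- An antiholomorphic symmetry acts as the conjugation in Fatou coordinates. -/
theorem exists_symmetric (hk : 1 ≤ k) (hp : IsPrenormalized p k b)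
    (hψ : IsFatouCoordinates p k b R ψ) (hτ : IsAntiholomorphicGerm τ)
    (hτ1 : OrderGE (k + 1) fun z => τ (conj z) - z) (hττ : ∀ᶠ z in 𝓝 0, τ (τ z) = z)
    (hτp : ∀ᶠ z in 𝓝 0, τ (p z) = p (τ z)) :
    ∃ R', R ≤ R' ∧ ∀ j ∈ Set.Icc (-(k : ℤ)) k, ∀ z ∈ petal k b R' j, τ z ∈ petal k b R (-j) ∧
      ψ (-j) (τ z) = conj (ψ j z) := by
  obtain ⟨R₁, R₂, φ, Θ, S⟩ := exists_isStandardFatou hk hp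
  obtain ⟨A₁, hA₁, K₁, hK₁, hτm⟩ := exists_mem_petal_neg_of_orderGE hk b hτ1
  obtain ⟨A₂, hA₂, K₂, hK₂, hpm⟩ := exists_mem_petal_neg_of_orderGE hk b
    (orderGE_of_isPrenormalized hp)
  obtain ⟨r, hr, hsm⟩ := Metric.eventually_nhds_iff.1 ((hττ.and hτp).and
    (Complex.analyticAt_iff_eventually_differentiableAt.1 hτ.2))
  obtain ⟨R_S, -, hS⟩ := norm_lt_of_mem_petal hk b hr
  set B := max (max (R + K₁) A₁) R_S with hB
  have hB1 : R + K₁ ≤ B := (le_max_left _ _).trans (le_max_left _ _)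
  have hB2 : A₁ ≤ B := (le_max_right _ _).trans (le_max_left _ _)
  have hB3 : R_S ≤ B := le_max_right _ _
  have hnear : ∀ {j : ℤ} {z : ℂ}, z ∈ petal k b B j → τ (τ z) = z ∧ τ (p z) = p (τ z) ∧
      DifferentiableAt ℂ (fun w => τ (conj w)) (conj z) := by
    intro j z hz
    have h1 := hS j z (petal_anti hB3 hz)
    have h2 := hsm (y := z) (by simpa using h1)
    have h3 := hsm (y := conj z) (by simpa using h1)
    exact ⟨h2.1.1, h2.1.2, h3.2⟩
  have hτB : ∀ {j : ℤ} {z : ℂ}, z ∈ petal k b B j → τ z ∈ petal k b R (-j) := fun hz =>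
    hτm B hB2 R (by linarith) _ _ hz
  -- Transporting the coordinates by the symmetry yields Fatou coordinates of the same germ, so they
  -- differ from `ψ` by constants.
  set χ : ℤ → ℂ → ℂ := fun j z => conj (ψ (-j) (τ z)) with hχ
  have hχF : IsFatouCoordinates p k b B χ := by
    refine ⟨fun j hj z hz => ?_, fun j hj z hz z' hz' he => ?_, fun z hz => ?_,
      fun j hj z hz hpz => ?_⟩
    · refine (differentiableAt_conj_comp (F := fun w => ψ (-j) (τ w)) ?_).differentiableWithinAt
      have h1 := (hψ.holomorphic (-j) (neg_mem_Icc hj)).differentiableAt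
        ((isOpen_petal hk b R (-j)).mem_nhds (hτB hz))
      refine DifferentiableAt.comp (f := fun w => τ (conj w)) (conj z) ?_ (hnear hz).2.2
      simpa using h1
    · have h1 := hψ.injective (-j) (neg_mem_Icc hj) (hτB hz) (hτB hz')
        ((starRingEnd ℂ).injective he)
      rw [← (hnear hz).1, h1, (hnear hz').1]
    · have h1 := hτB hz
      rw [petal_glue hk] at h1
      simp only [hχ, neg_neg]
      rw [hψ.glue h1]
    · simp only [hχ, neg_neg]
      have h1 := hτB hz
      have h2 := hτB hpz
      rw [(hnear hz).2.1] at h2 ⊢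
      have h3 := hψ.conjugate (-j) (neg_mem_Icc hj) _ h1 h2
      rw [neg_neg] at h3
      rw [h3]
      simp [Complex.conj_ofNat]
  obtain ⟨D₁, -, hD₁B, C₁, hC₁⟩ := S.exists_eq_add_const hk hp hχF
  obtain ⟨D₂, -, hD₂R, C₂, hC₂⟩ := S.exists_eq_add_const hk hp hψ
  set D := max D₁ D₂ with hD
  have hDB : B ≤ D := hD₁B.trans (le_max_left _ _)
  have hDR : R ≤ D := hD₂R.trans (le_max_right _ _)
  have hdiff : ∀ j ∈ Set.Icc (-(k : ℤ)) k, ∀ z ∈ petal k b D j,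
      conj (ψ (-j) (τ z)) = ψ j z + (C₁ j - C₂ j) := by
    intro j hj z hz
    have h1 := hC₁ j hj z (petal_anti (le_max_left _ _) hz)
    have h2 := hC₂ j hj z (petal_anti (le_max_right _ _) hz)
    rw [h2]
    simp only [hχ] at h1
    rw [h1]; ring
  -- Write `d j` for the difference. That `τ` is an involution gives `d j = -conj (d (-j))`;
  -- compatibility with `p` gives `d (-j) = conj (d j)`. Together `d j = -d j`.
  have hzero : ∀ j ∈ Set.Icc (-(k : ℤ)) k, C₁ j - C₂ j = 0 := by
    intro j hj
    set E := max (D + K₁ + K₂) (max A₁ A₂)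
    have hE1 : D + K₁ + K₂ ≤ E := le_max_left _ _
    have hE2 : A₁ ≤ E := (le_max_left _ _).trans (le_max_right _ _)
    have hE3 : A₂ ≤ E := (le_max_right _ _).trans (le_max_right _ _)
    obtain ⟨z, hz⟩ := S.petal_nonempty E j
    have hzD := petal_anti (by linarith : D ≤ E) hz
    have h1 : τ z ∈ petal k b D (-j) := hτm E hE2 D (by linarith) j z hz
    have h2 : p z ∈ petal k b D (-j) := hpm E hE3 D (by linarith) j z hz
    have e1 := hdiff j hj z hzD
    have e2 := hdiff (-j) (neg_mem_Icc hj) _ h1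
    rw [neg_neg, (hnear (petal_anti hDB hzD)).1] at e2
    have e3 := hdiff (-j) (neg_mem_Icc hj) _ h2
    have e4 := hχF.conjugate j hj z (petal_anti hDB hzD) (petal_anti hDB h2)
    have e5 := hψ.conjugate j hj z (petal_anti hDR hzD) (petal_anti hDR h2)
    simp only [hχ] at e4
    rw [e3, e5, e1] at e4
    have e6 := congrArg (starRingEnd ℂ) e2
    simp only [map_add, map_sub, Complex.conj_conj, map_div₀, map_one, Complex.conj_ofNat] at e4 e6
    have e7 := congrArg (starRingEnd ℂ) e4
    simp only [map_add, map_sub, Complex.conj_conj, map_div₀, map_one, Complex.conj_ofNat] at e7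
    linear_combination (-1 / 2) * e7 + (-1 / 2) * e6 + (-1 / 2) * e1
  refine ⟨D, hDR, fun j hj z hz => ⟨hτB (petal_anti hDB hz), ?_⟩⟩
  have h1 := hdiff j hj z hz
  rw [hzero j hj, add_zero] at h1
  rw [← h1, Complex.conj_conj]

theorem source_mem_Icc (hj : j ∈ Set.Icc (1 : ℤ) k) : source j ∈ Set.Icc (-(k : ℤ)) k := by
  unfold source; rw [Set.mem_Icc] at *; split_ifs <;> omega

theorem target_mem_Icc (hj : j ∈ Set.Icc (1 : ℤ) k) : target j ∈ Set.Icc (-(k : ℤ)) k := by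
  unfold target; rw [Set.mem_Icc] at *; split_ifs <;> omega

theorem source_target (j : ℤ) : (source j = j - 1 ∧ target j = j) ∨ (source j = j ∧ target j = j - 1) := by
  unfold source target; split_ifs <;> simp

theorem petalInter_subset (hz : z ∈ petalInter k b R j) :
    z ∈ petal k b R (source j) ∧ z ∈ petal k b R (target j) := by
  obtain ⟨⟨h1, h2⟩, -⟩ := hz
  rcases source_target j with ⟨h3, h4⟩ | ⟨h3, h4⟩ <;> rw [h3, h4]
  · exact ⟨h1, h2⟩
  · exact ⟨h2, h1⟩

theorem abs_im_of_lt_hornSign {M : ℝ} {W : ℂ} (h : M < hornSign j * W.im) : M < |W.im| := by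
  refine h.trans_le ?_
  unfold hornSign
  split_ifs
  · rw [one_mul]; exact le_abs_self _
  · rw [neg_one_mul]; exact neg_le_abs _

/-- Points of consecutive petals whose Fatou coordinate is close to the end are deep in both
petals. -/
theorem IsStandardFatou.eventually_mem_petal (hk : 1 ≤ k) (hp : IsPrenormalized p k b)
    (S : IsStandardFatou p k b R₁ R₂ φ Θ) (hψ : IsFatouCoordinates p k b R ψ) (R' : ℝ)
    (hj : j ∈ Set.Icc (1 : ℤ) k) : ∀ᶠ W in hornEnd j, ∀ z ∈ petalInter k b R j,
      ψ (source j) z = W → z ∈ petal k b R' (source j) ∧ z ∈ petal k b R' (target j) := by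
  obtain ⟨D, hD₂, hDR, C, hC⟩ := S.exists_eq_add_const hk hp hψ
  set B := max D R' with hB
  refine eventually_hornEnd.2 ⟨B + 1 + ‖C (source j)‖ + ‖Complex.I * π * b / k‖ + 1,
    fun W hW z hz hzW => ?_⟩
  have hs := source_mem_Icc hj
  obtain ⟨hzs, hzt⟩ := petalInter_subset hz
  have hWim := abs_im_of_lt_hornSign hW
  have hBD : D ≤ B := le_max_left _ _
  have hBR : R' ≤ B := le_max_right _ _
  have him : B + 1 + ‖Complex.I * π * b / k‖ + 1 < |(W - C (source j)).im| := by
    have h1 := Complex.abs_im_le_norm (C (source j))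
    have h2 := abs_sub_abs_le_abs_sub W.im (C (source j)).im
    rw [Complex.sub_im]; linarith
  have hdom : W - C (source j) ∈ timeDomain (B + 1) (source j) := by
    left; linarith [norm_nonneg (Complex.I * π * b / k)]
  have hz₀ := S.inv_mem_petal (by linarith) hdom
  rw [add_sub_cancel_right] at hz₀
  have hr := S.inv_right _ _ (timeDomain_anti (by linarith) hdom)
  have hn := S.inv_near _ _ (timeDomain_anti (by linarith) hdom)
  -- The given point is only known to lie in the large petal; injectivity identifies it with the
  -- explicit preimage, which is deep.
  have hzz : z = Θ (source j) (W - C (source j)) := by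
    refine hψ.injective _ hs hzs (petal_anti (by linarith) hz₀) ?_
    rw [hzW, hC _ hs _ (petal_anti hBD hz₀), hr, sub_add_cancel]
  rw [← hzz] at hz₀ hn
  refine ⟨petal_anti hBR hz₀, ?_⟩
  have ht : |(timeChart k b (target j) z - timeChart k b (source j) z).im| ≤
      ‖Complex.I * π * b / k‖ := by
    refine (Complex.abs_im_le_norm _).trans (le_of_eq ?_)
    have h1 := (timeChart_succ (b := b) hk (mem_petal_iff.1 hzs).1 hz.2.1 hz.2.2).1
    rcases source_target j with ⟨h3, h4⟩ | ⟨h3, h4⟩ <;> rw [h3, h4, h1]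
    · rw [← norm_neg]; congr 1; ring
    · congr 1; ring
  refine ⟨hzt.1, hzt.2.1, hzt.2.2.1, Or.inl ?_⟩
  have h5 := (Complex.abs_im_le_norm _).trans hn
  have h6 : |(W - C (source j)).im| ≤ |(timeChart k b (target j) z).im| +
      |(timeChart k b (target j) z - timeChart k b (source j) z).im| +
      |(timeChart k b (source j) z - (W - C (source j))).im| := by
    have : (W - C (source j)).im = (timeChart k b (target j) z).im -
      (timeChart k b (target j) z - timeChart k b (source j) z).im -
      (timeChart k b (source j) z - (W - C (source j))).im := by
      simp only [Complex.sub_im]; ring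
    rw [this]
    exact (abs_sub _ _).trans (by gcongr; exact abs_sub _ _)
  linarith

/-- The germ `p ∘ τ` is holomorphic, maps deep points of each petal into the same petal, and acts as
`T (1/2)` in every Fatou coordinate. A transition function expresses one map in two such
coordinates, so it intertwines `T (1/2)` with itself. -/
theorem commutesWithHalf_of_symmetry (hk : 1 ≤ k) (hp : IsPrenormalized p k b)
    (hψ : IsFatouCoordinates p k b R ψ) (hτ : IsAntiholomorphicGerm τ)
    (hτ1 : OrderGE (k + 1) fun z => τ (conj z) - z) (hττ : ∀ᶠ z in 𝓝 0, τ (τ z) = z)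
    (hτp : ∀ᶠ z in 𝓝 0, τ (p z) = p (τ z)) (hj : j ∈ Set.Icc (1 : ℤ) k) {Ψ : ℂ → ℂ}
    (hΨ : IsTransition k b R ψ j Ψ) : CommutesWithHalf j Ψ := by
  obtain ⟨R₁, R₂, φ, Θ, S⟩ := exists_isStandardFatou hk hp
  obtain ⟨R', hR', hsym⟩ := exists_symmetric hk hp hψ hτ hτ1 hττ hτp
  obtain ⟨A, hA, K, hK, hm⟩ := exists_mem_petal_of_orderGE hk b (m := fun z => p (τ z)) (by
    have h1 := (orderGE_of_isPrenormalized hp).comp (x := fun z => conj (τ z)) hτ.orderGE.star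
    have h2 := hτ1.conjGerm
    refine (h1.add h2).congr fun z => ?_
    simp [conjGerm])
  have hhalf : ∀ i ∈ Set.Icc (-(k : ℤ)) k, ∀ z ∈ petal k b (max (max R' A) (R + K)) i,
      p (τ z) ∈ petal k b R i ∧ ψ i (p (τ z)) = ψ i z + 1 / 2 := by
    intro i hi z hz
    have h1 : p (τ z) ∈ petal k b R i := hm _ ((le_max_right _ _).trans (le_max_left _ _)) R
      (by linarith [le_max_right (max R' A) (R + K)]) i z hz
    refine ⟨h1, ?_⟩
    obtain ⟨h2, h3⟩ := hsym i hi z (petal_anti ((le_max_left _ _).trans (le_max_left _ _)) hz)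
    have h4 := hψ.conjugate (-i) (neg_mem_Icc hi) _ h2 (by simpa using h1)
    rw [neg_neg, h3] at h4
    simpa [Complex.conj_ofNat] using h4
  have ht : Tendsto (T (1 / 2)) (hornEnd j) (hornEnd j) :=
    tendsto_hornEnd 0 fun W => by simp [T]
  filter_upwards [hΨ, ht.eventually hΨ, S.eventually_mem_petal hk hp hψ
    (max (max R' A) (R + K)) hj] with W h1 h2 h3
  obtain ⟨z, hz, hz1, hz2⟩ := h1
  obtain ⟨z', hz', hz1', hz2'⟩ := h2
  obtain ⟨h4, h5⟩ := h3 z hz hz1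
  obtain ⟨h6, h7⟩ := hhalf _ (source_mem_Icc hj) z h4
  have h8 : p (τ z) = z' := by
    refine hψ.injective _ (source_mem_Icc hj) h6 (petalInter_subset hz').1 ?_
    rw [h7, hz1, hz1']
    rfl
  have h9 := (hhalf _ (target_mem_Icc hj) z h5).2
  rw [h8, hz2', hz2] at h9
  exact h9

theorem commutesWithHalf_of_realExpansion (hf : IsAntiholomorphicGerm f) (hk : 1 ≤ k)
    (hc : Conjugates h f P) (hP : HasRealExpansion P A) (hA : Even k → A 1 = 1)
    {Ψ : ℤ → ℂ → ℂ} (hΨ : Ψ ∈ analyticInvariant f k b) :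
    ∀ j ∈ Set.Icc (1 : ℤ) k, CommutesWithHalf j (Ψ j) := by
  obtain ⟨Ψ₀, ⟨h₀, p, hc₀, hp, R, φ, -, hφ, hΨ₀⟩, heq⟩ := hΨ
  rw [← commutesWithHalf_of_eqvGen heq]
  obtain ⟨h₀', hh', -, hl, hr⟩ := hc₀.1.exists_inverse
  obtain ⟨τ, h1, h2, h3, h4⟩ := exists_symmetry hk hp
    ((hc₀.symm_of_inverse hf.tendsto hh' hl hr).trans hc) hP hA
  exact fun j hj => commutesWithHalf_of_symmetry hk hp hφ h1 h2 h3 h4 hj (hΨ₀ j hj).1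

end
end AntiParabolic

namespace AntiParabolic
section

/-! ### Fourier expansion at the end of a half-plane -/

theorem hornEnd_one : hornEnd 1 = comap Complex.im atTop := by simp [hornEnd]

/-- A periodic holomorphic function tending to `0` at `+i∞` is a function of `q = e^{2iπW}` that
extends holomorphically by `0` at `q = 0`; its Taylor series is the Fourier series. -/
theorem exists_hasSum_exp {D : ℂ → ℂ} (hper : ∀ᶠ W in hornEnd 1, D (W + 1) = D W)
    (hd : ∀ᶠ W in hornEnd 1, DifferentiableAt ℂ D W) (h0 : Tendsto D (hornEnd 1) (𝓝 0)) :
    ∃ a : ℕ → ℂ, ∀ᶠ W in hornEnd 1,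
      HasSum (fun n : ℕ => a n * Complex.exp (2 * π * Complex.I * ((n : ℂ) + 1) * W)) (D W) := by
  classical
  obtain ⟨M, hM⟩ := eventually_hornEnd.1 hper
  simp only [hornSign, odd_one, zero_lt_one, if_true, one_mul] at hM
  have hdeep : ∀ᶠ W in hornEnd 1, M < W.im :=
    eventually_hornEnd.2 ⟨M, fun W hW => by simpa [hornSign] using hW⟩
  -- The function in `q` is defined from a globally periodic function, so `D` is cut off below a
  -- horizontal line.
  set F : ℂ → ℂ := fun W => if M < W.im then D W else 0 with hF
  have hFD : ∀ᶠ W in hornEnd 1, F W = D W := hdeep.mono fun W hW => by simp [hF, hW]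
  have hFper : Function.Periodic F ((1 : ℝ) : ℂ) := fun W => by
    by_cases hW : M < W.im
    · simp [hF, hW, hM W hW]
    · simp [hF, hW]
  have hFd : ∀ᶠ W in comap Complex.im atTop, DifferentiableAt ℂ F W := by
    rw [← hornEnd_one]
    filter_upwards [hdeep, hd] with W h1 h2
    refine h2.congr_of_eventuallyEq ?_
    filter_upwards [Complex.continuous_im.continuousAt.eventually_const_lt h1] with Y hY
    simp [hF, hY]
  have hF0 : Tendsto F (comap Complex.im atTop) (𝓝 0) := by
    rw [← hornEnd_one]; exact h0.congr' (hFD.mono fun W h => h.symm)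
  set G := Function.Periodic.cuspFunction 1 F with hG
  have hG0 : G 0 = 0 := Function.Periodic.cuspFunction_zero_of_zero_at_inf one_pos hF0
  have hGd : AnalyticAt ℂ G 0 := by
    rw [Complex.analyticAt_iff_eventually_differentiableAt, ← nhdsNE_sup_pure, eventually_sup]
    exact ⟨Function.Periodic.eventually_differentiableAt_cuspFunction_nhds_ne_zero one_pos hFper hFd,
      Function.Periodic.differentiableAt_cuspFunction_zero one_pos hFper hFd
        (Filter.ZeroAtFilter.boundedAtFilter hF0)⟩
  obtain ⟨s, hs⟩ := hGd
  refine ⟨fun n => s.coeff (n + 1), ?_⟩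
  have h1 := (Function.Periodic.qParam_tendsto one_pos).mono_right nhdsWithin_le_nhds
  rw [← hornEnd_one] at h1
  filter_upwards [h1.eventually hs.eventually_hasSum, hFD] with W h2 h3
  rw [zero_add, hG, Function.Periodic.eq_cuspFunction one_ne_zero hFper, h3] at h2
  have hc : s.coeff 0 = 0 := by
    rw [← hG0]
    exact hs.coeff_zero _
  have h4 := (hasSum_nat_add_iff' 1).2 h2
  simp only [FormalMultilinearSeries.apply_eq_pow_smul_coeff, Finset.range_one, Finset.sum_singleton,
    hc, smul_eq_mul] at h4
  rw [mul_zero, sub_zero] at h4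
  have h5 : (fun n : ℕ => s.coeff (n + 1) * Complex.exp (2 * π * Complex.I * ((n : ℂ) + 1) * W)) =
      fun n => Function.Periodic.qParam 1 W ^ (n + 1) * s.coeff (n + 1) := by
    ext n
    simp only [Function.Periodic.qParam]
    rw [← Complex.exp_nat_mul, mul_comm]
    congr 2
    push_cast; ring
  rw [h5]
  exact h4

theorem hasConstantTerm_of_tendsto {j : ℤ} (hj : 0 < j) {Ψ : ℂ → ℂ} {c : ℂ}
    (hper : ∀ᶠ W in hornEnd j, Ψ (W + 1) = Ψ W + 1)
    (hd : ∀ᶠ W in hornEnd j, DifferentiableAt ℂ Ψ W)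
    (h0 : Tendsto (fun W => Ψ W - W - c) (hornEnd j) (𝓝 0)) : HasConstantTerm j Ψ c := by
  set s : ℂ := if Odd j then 1 else -1 with hs
  have hss : s * s = 1 := by rw [hs]; split_ifs <;> norm_num
  have hsh : s = (hornSign j : ℝ) := by
    rw [hs, hornSign]; simp only [hj, iff_true]; split_ifs <;> simp
  have hh : hornSign j * hornSign j = 1 := by rw [hsh] at hss; exact_mod_cast hss
  have h1 : hornSign 1 = 1 := by simp [hornSign]
  have ht : Tendsto (fun W => s * W) (hornEnd 1) (hornEnd j) := tendsto_hornEnd 0 fun W => by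
    rw [hsh, Complex.im_ofReal_mul, ← mul_assoc, hh, h1, add_zero]
  have ht' : Tendsto (fun W => s * W) (hornEnd j) (hornEnd 1) := tendsto_hornEnd 0 fun W => by
    rw [hsh, Complex.im_ofReal_mul, h1, add_zero, one_mul]
  have ht1 : Tendsto (fun W => s * W - 1) (hornEnd 1) (hornEnd j) := tendsto_hornEnd 0 fun W => by
    rw [hsh, Complex.sub_im, Complex.im_ofReal_mul, Complex.one_im, sub_zero, ← mul_assoc, hh, h1,
      add_zero]
  obtain ⟨a, ha⟩ := exists_hasSum_exp (D := fun W => Ψ (s * W) - s * W - c) (by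
      filter_upwards [ht.eventually hper, ht1.eventually hper] with W e1 e2
      rw [sub_add_cancel] at e2
      rcases ite_eq_or_eq (Odd j) (1 : ℂ) (-1) with h | h
      · have h' : s = 1 := h
        rw [mul_add, h', mul_one]
        rw [h'] at e1
        rw [e1]; ring
      · have h' : s = -1 := h
        rw [mul_add, h', mul_one, ← sub_eq_add_neg]
        rw [h'] at e2
        rw [e2]; ring)
    (by
      filter_upwards [ht.eventually hd] with W e1
      exact ((DifferentiableAt.comp (f := fun W => s * W) W e1 (by fun_prop)).sub
        (by fun_prop)).sub_const c)
    (h0.comp ht)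
  refine ⟨a, ?_⟩
  filter_upwards [ht'.eventually ha] with W hW
  rw [← mul_assoc s s, hss, one_mul] at hW
  convert hW using 4 with n
  ring

/-! ### Transition functions of the standard Fatou coordinates -/

variable {k : ℕ} {b : ℝ} {j : ℤ} {z : ℂ} {R R₁ R₂ ρ M : ℝ} {p f h : ℂ → ℂ} {φ Θ : ℤ → ℂ → ℂ}

theorem sgn_sub_one (j : ℤ) : sgn (j - 1) = -sgn j := by
  unfold sgn
  rcases Int.even_or_odd j with h | h
  · rw [if_pos (h.sub_odd odd_one), if_neg (Int.not_odd_iff_even.2 h), neg_neg]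
  · rw [if_neg (Int.not_odd_iff_even.2 (h.sub_odd odd_one)), if_pos h]

theorem normChart_succ (hk : 1 ≤ k) (hz : z ≠ 0) (h0 : 0 < Complex.arg (rot k (j - 1) z))
    (h1 : Complex.arg (rot k (j - 1) z) < π / k) :
    normChart k b j z = -normChart k b (j - 1) z - sgn j * (Complex.I * π * b / k) := by
  rw [normChart, normChart, (timeChart_succ hk hz h0 h1).1, sgn_sub_one]
  push_cast; ring

theorem abs_im_sgn_mul_le (j : ℤ) (c : ℂ) : |((sgn j : ℂ) * c).im| ≤ ‖c‖ := by
  refine (Complex.abs_im_le_norm _).trans (le_of_eq ?_)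
  rw [norm_mul, norm_sgn, one_mul]

/-- A point of a petal which is close to the correct end lies deep in the next petal. -/
theorem mem_petalInter_of_im (hk : 1 ≤ k) (hM : |b| * π ≤ M)
    (hρ : ρ + ‖Complex.I * π * b / k‖ ≤ M)
    (h : (z ∈ petal k b R (j - 1) ∧ (normChart k b (j - 1) z).im < -M) ∨
      (z ∈ petal k b R j ∧ M < (normChart k b j z).im)) : z ∈ petalInter k b ρ j := by
  have hc := abs_le.1 (abs_im_sgn_mul_le j (Complex.I * π * b / k))
  have hn := norm_nonneg (Complex.I * π * b / k)
  rcases h with ⟨hz, him⟩ | ⟨hz, him⟩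
  · have hzM := mem_petal_of_mem_attr hz (R' := M) (Or.inl (by
      rw [← abs_neg]; exact lt_of_lt_of_le (by linarith) (le_abs_self _)))
    have h0 := (arg_rot_sign hk hzM hM).2 him
    obtain ⟨e1, e2, e3, e4⟩ := mem_petal_iff.1 hzM
    have h1 := (abs_lt.1 e3).2
    refine ⟨⟨petal_anti (by linarith) hzM, mem_petal_iff.2 ⟨e1, e2,
      (timeChart_succ (b := b) hk e1 h0 h1).2, Or.inl ?_⟩⟩, h0, h1⟩
    rw [normChart_succ hk e1 h0 h1, Complex.sub_im, Complex.neg_im]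
    exact lt_of_lt_of_le (by linarith) (le_abs_self _)
  · have hzM := mem_petal_of_mem_attr hz (R' := M) (Or.inl (lt_of_lt_of_le him (le_abs_self _)))
    have h0 := (arg_rot_sign hk hzM hM).1 him
    obtain ⟨e1, e2, e3, e4⟩ := mem_petal_iff.1 hzM
    have h1 := (abs_lt.1 e3).1
    have h2 := congrArg Complex.im (log_rot_pred hk e1 h0 h1)
    rw [Complex.log_im, Complex.add_im, Complex.log_im, Complex.im_ofReal_mul, Complex.I_im,
      mul_one] at h2
    have h3 : 0 < Complex.arg (rot k (j - 1) z) := by linarith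
    have h4 : Complex.arg (rot k (j - 1) z) < π / k := by linarith
    refine ⟨⟨mem_petal_iff.2 ⟨e1, e2, abs_lt.2 ⟨by linarith, h4⟩, Or.inl ?_⟩,
      petal_anti (by linarith) hzM⟩, h3, h4⟩
    have h5 := congrArg Complex.im (normChart_succ (b := b) hk e1 h3 h4)
    rw [Complex.sub_im, Complex.neg_im] at h5
    rw [← abs_neg]
    exact lt_of_lt_of_le (by linarith) (le_abs_self _)

/-- The two normalized charts have opposite real parts there, so the point cannot lie far to the
right in both: membership in one of them must come from the imaginary part. The sign of the argument
then decides which end it is. -/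
theorem im_normChart_of_mem_petalInter (hk : 1 ≤ k) (hM : |b| * π ≤ M) (hM0 : 0 ≤ M)
    (hρ : M + 2 * ‖Complex.I * π * b / k‖ ≤ ρ) (hz : z ∈ petalInter k b ρ j) :
    (normChart k b (j - 1) z).im < -M ∧ M < (normChart k b j z).im := by
  have hc := abs_le.1 (abs_im_sgn_mul_le j (Complex.I * π * b / k))
  have hn := norm_nonneg (Complex.I * π * b / k)
  obtain ⟨⟨h1, h2⟩, h0, h3⟩ := hz
  obtain ⟨e1, e2, e3, e4⟩ := mem_petal_iff.1 h1
  obtain ⟨f1, f2, f3, f4⟩ := mem_petal_iff.1 h2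
  have h5 := normChart_succ (b := b) hk e1 h0 h3
  have him := congrArg Complex.im h5
  have hre : (normChart k b j z).re = -(normChart k b (j - 1) z).re := by
    rw [h5, Complex.sub_re, Complex.neg_re,
      show (sgn j : ℂ) * (Complex.I * π * b / k) = ((sgn j * (π * b / k) : ℝ) : ℂ) * Complex.I by
        push_cast; ring, Complex.re_ofReal_mul, Complex.I_re]
    ring
  rw [Complex.sub_im, Complex.neg_im] at him
  have h6 : M + ‖Complex.I * π * b / k‖ < |(normChart k b (j - 1) z).im| := by
    rcases e4 with e4 | e4
    · linarith
    · rcases f4 with f4 | f4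
      · rw [him] at f4
        have := abs_sub (-(normChart k b (j - 1) z).im) ((sgn j : ℂ) * (Complex.I * π * b / k)).im
        rw [abs_neg] at this
        have h7 := abs_im_sgn_mul_le j (Complex.I * π * b / k)
        linarith
      · linarith
  have h7 := (arg_rot_sign hk (petal_anti (by linarith : M ≤ ρ) h1) hM).1
  rcases lt_abs.1 h6 with h8 | h8
  · linarith [h7 (by linarith)]
  · constructor <;> linarith

/-- The transition functions of the standard Fatou coordinates. -/
def transition (φ Θ : ℤ → ℂ → ℂ) (j : ℤ) (W : ℂ) : ℂ := φ (target j) (Θ (source j) W)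

theorem isOpen_timeDomain (R : ℝ) (j : ℤ) : IsOpen (timeDomain R j) := by
  have : timeDomain R j = (fun Z => (sgn j : ℂ) * Z) ⁻¹' attr R := by
    ext Z; exact mem_timeDomain_iff
  rw [this]
  exact (isOpen_attr R).preimage (by fun_prop)

theorem hornSign_eq_sgn (hj : j ∈ Set.Icc (1 : ℤ) k) : hornSign j = sgn j := by
  have : 0 < j := by have := hj.1; omega
  simp [hornSign, sgn, this]

theorem timeChart_target (hk : 1 ≤ k) (hz : z ∈ petalInter k b ρ j) :
    timeChart k b (target j) z = timeChart k b (source j) z + normalConstant k b j := by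
  have h1 := (timeChart_succ (b := b) hk (mem_petal_iff.1 hz.1.1).1 hz.2.1 hz.2.2).1
  unfold target source normalConstant
  split_ifs <;> rw [h1] <;> ring

namespace IsStandardFatou

theorem exists_lt_hornSign (hk : 1 ≤ k) (S : IsStandardFatou p k b R₁ R₂ φ Θ) (M : ℝ) :
    ∃ ρ, R₁ ≤ ρ ∧ ∀ j ∈ Set.Icc (1 : ℤ) k, ∀ z ∈ petalInter k b ρ j,
      M < hornSign j * (φ (source j) z).im := by
  obtain ⟨R', hR', hn⟩ := S.near 1 one_pos
  set M' := max (|M| + 1) (|b| * π) with hM'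
  set ρ := max (M' + 2 * ‖Complex.I * π * b / k‖) R' with hρ
  have hM0 : |M| + 1 ≤ M' := le_max_left _ _
  refine ⟨ρ, hR'.trans (le_max_right _ _), fun j hj z hz => ?_⟩
  obtain ⟨h1, h2⟩ := im_normChart_of_mem_petalInter hk (le_max_right (|M| + 1) _ : _ ≤ M')
    (by linarith [abs_nonneg M]) (le_max_left _ _) hz
  have h3 := hn _ z (petal_anti (le_max_right _ _) (petalInter_subset hz).1)
  have h4 := abs_le.1 ((Complex.abs_im_le_norm _).trans h3)
  rw [Complex.sub_im] at h4
  rw [hornSign_eq_sgn hj]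
  have h5 := le_abs_self M
  simp only [normChart, Complex.im_ofReal_mul, sgn_sub_one] at h1 h2
  rcases abs_eq (zero_le_one' ℝ) |>.1 (abs_sgn j) with h6 | h6
  all_goals
    rw [h6] at h1 h2 ⊢
    rcases source_target j with ⟨h7, -⟩ | ⟨h7, -⟩ <;> rw [h7] at h4 ⊢ <;> linarith

/-- Points of the source time domain close to the end come from deep points of both petals. -/
theorem eventually_inv_mem_petalInter (hk : 1 ≤ k) (S : IsStandardFatou p k b R₁ R₂ φ Θ) (ρ : ℝ)
    (hj : j ∈ Set.Icc (1 : ℤ) k) : ∀ᶠ W in hornEnd j, W ∈ timeDomain R₂ (source j) ∧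
      Θ (source j) W ∈ petalInter k b ρ j := by
  set M := max (ρ + ‖Complex.I * π * b / k‖) (|b| * π) with hM
  refine eventually_hornEnd.2 ⟨max R₂ (M + 1), fun W hW => ?_⟩
  have hW2 : W ∈ timeDomain R₂ (source j) :=
    Or.inl ((le_max_left _ _).trans_lt (abs_im_of_lt_hornSign hW))
  refine ⟨hW2, ?_⟩
  have h1 := S.inv_mem _ _ hW2
  have h2 := abs_le.1 ((Complex.abs_im_le_norm _).trans (S.inv_near _ _ hW2))
  rw [Complex.sub_im] at h2
  have h3 := (le_max_right R₂ (M + 1)).trans_lt hW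
  rw [hornSign_eq_sgn hj] at h3
  refine mem_petalInter_of_im hk (le_max_right _ _ : _ ≤ M) (le_max_left _ _) (R := R₁) ?_
  by_cases ho : Odd j
  · left
    have h4 : source j = j - 1 := if_pos ho
    have h5 : sgn j = 1 := if_pos ho
    rw [h4] at h1 h2 ⊢
    refine ⟨h1, ?_⟩
    rw [normChart, Complex.im_ofReal_mul, sgn_sub_one]
    rw [h5] at h3 ⊢
    linarith
  · right
    have h4 : source j = j := if_neg ho
    have h5 : sgn j = -1 := if_neg ho
    rw [h4] at h1 h2 ⊢
    refine ⟨h1, ?_⟩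
    rw [normChart, Complex.im_ofReal_mul]
    rw [h5] at h3 ⊢
    linarith

theorem isTransition (hk : 1 ≤ k) (S : IsStandardFatou p k b R₁ R₂ φ Θ)
    (hj : j ∈ Set.Icc (1 : ℤ) k) : IsTransition k b R₁ φ j (transition φ Θ j) := by
  filter_upwards [S.eventually_inv_mem_petalInter hk R₁ hj] with W hW
  exact ⟨_, hW.2, S.inv_right _ _ hW.1, rfl⟩

theorem eventually_transition_add_one (hk : 1 ≤ k) (hp : IsPrenormalized p k b)
    (S : IsStandardFatou p k b R₁ R₂ φ Θ) (hj : j ∈ Set.Icc (1 : ℤ) k) :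
    ∀ᶠ W in hornEnd j, transition φ Θ j (W + 1) = transition φ Θ j W + 1 := by
  obtain ⟨R', hR', hcomp⟩ := S.fatou.exists_comp_self hk hp
  have ht : Tendsto (fun W : ℂ => W + 1) (hornEnd j) (hornEnd j) :=
    tendsto_hornEnd 0 fun W => by simp
  have h0 := S.eventually_inv_mem_petalInter hk R' hj
  filter_upwards [h0, ht.eventually h0] with W h1 h2
  obtain ⟨h3, h4⟩ := petalInter_subset h1.2
  obtain ⟨h5, -⟩ := petalInter_subset h2.2
  obtain ⟨-, h6, h7⟩ := hcomp _ (source_mem_Icc hj) _ h3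
  obtain ⟨-, h8, h9⟩ := hcomp _ (target_mem_Icc hj) _ h4
  rw [S.inv_right _ _ h1.1] at h7
  have h10 : p (p (Θ (source j) W)) = Θ (source j) (W + 1) := by
    refine S.fatou.injective _ (source_mem_Icc hj) h6 (petal_anti hR' h5) ?_
    rw [h7, S.inv_right _ _ h2.1]
  rw [h10] at h9
  exact h9

theorem eventually_differentiableAt_transition (hk : 1 ≤ k)
    (S : IsStandardFatou p k b R₁ R₂ φ Θ) (hj : j ∈ Set.Icc (1 : ℤ) k) :
    ∀ᶠ W in hornEnd j, DifferentiableAt ℂ (transition φ Θ j) W := by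
  filter_upwards [S.eventually_inv_mem_petalInter hk R₁ hj] with W hW
  refine DifferentiableAt.comp W ((S.fatou.holomorphic _ (target_mem_Icc hj)).differentiableAt
    ((isOpen_petal hk b R₁ _).mem_nhds (petalInter_subset hW.2).2))
    ((S.inv_holomorphic _).differentiableAt ((isOpen_timeDomain R₂ _).mem_nhds hW.1))

/-- Both coordinates approach their time charts, and consecutive charts differ by `normalConstant`.
Hence coordinates asymptotic to the charts are automatically normalized. -/
theorem tendsto_transition (hk : 1 ≤ k)
    (S : IsStandardFatou p k b R₁ R₂ φ Θ) (hj : j ∈ Set.Icc (1 : ℤ) k) :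
    Tendsto (fun W => transition φ Θ j W - W - normalConstant k b j) (hornEnd j) (𝓝 0) := by
  refine Metric.tendsto_nhds.2 fun ε hε => ?_
  obtain ⟨R', hR', hn⟩ := S.near (ε / 3) (by positivity)
  filter_upwards [S.eventually_inv_mem_petalInter hk R' hj] with W hW
  obtain ⟨h1, h2⟩ := petalInter_subset hW.2
  have h3 := hn _ _ h1
  have h4 := hn _ _ h2
  rw [timeChart_target hk hW.2] at h4
  rw [S.inv_right _ _ hW.1] at h3
  rw [dist_zero_right]
  calc _ = ‖(φ (target j) (Θ (source j) W) - (timeChart k b (source j) (Θ (source j) W)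
        + normalConstant k b j)) - (W - timeChart k b (source j) (Θ (source j) W))‖ := by
        congr 1; simp only [transition]; ring
    _ ≤ ε / 3 + ε / 3 := (norm_sub_le _ _).trans (add_le_add h4 h3)
    _ < ε := by linarith

theorem transition_mem_analyticInvariant (hk : 1 ≤ k) (hc : Conjugates h f p)
    (hp : IsPrenormalized p k b) (S : IsStandardFatou p k b R₁ R₂ φ Θ) :
    transition φ Θ ∈ analyticInvariant f k b :=
  ⟨_, ⟨h, p, hc, hp, R₁, φ, S.pos, S.fatou, fun _ hj => ⟨S.isTransition hk hj,
    hasConstantTerm_of_tendsto (by have := hj.1; omega)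
      (S.eventually_transition_add_one hk hp hj) (S.eventually_differentiableAt_transition hk hj)
      (S.tendsto_transition hk hj)⟩⟩, Relation.EqvGen.refl _⟩

end IsStandardFatou

end
end AntiParabolic

namespace AntiParabolic
section

/-! ### The half iterate of the inverse of the square -/

variable {k : ℕ} {b : ℝ} {i j : ℤ} {z : ℂ} {R R₁ R₂ ρ : ℝ} {p : ℂ → ℂ} {φ Θ : ℤ → ℂ → ℂ}

theorem petalInter_anti {R R' : ℝ} (h : R ≤ R') : petalInter k b R' j ⊆ petalInter k b R j :=
  fun _ hz => ⟨⟨petal_anti h hz.1.1, petal_anti h hz.1.2⟩, hz.2⟩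

/-- The arguments of a point in the sheets of two petals which contain it. -/
theorem exists_arg_rot_eq (hk : 1 ≤ k) (hz : z ≠ 0) (hi : |Complex.arg (rot k i z)| < π / k)
    (hj : |Complex.arg (rot k j z)| < π / k) : ∃ m n : ℤ, i - j = 2 * (k : ℤ) * m + n ∧ -1 ≤ n ∧ n ≤ 1 ∧
      Complex.arg (rot k j z) = Complex.arg (rot k i z) + n * (π / k) := by
  have hk0 : (0 : ℝ) < k := by exact_mod_cast hk
  have hpk : 0 < π / k := div_pos Real.pi_pos hk0
  have h1 : rot k i z = rot k j z * Complex.exp (-((i - j : ℝ) * (π / k)) * Complex.I) := by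
    unfold rot
    rw [mul_assoc, ← Complex.exp_add]
    congr 2; push_cast; ring
  have hz' : (‖z‖ : ℂ) ≠ 0 := by exact_mod_cast norm_ne_zero_iff.2 hz
  have e1 := Complex.norm_mul_exp_arg_mul_I (rot k i z)
  have e2 := Complex.norm_mul_exp_arg_mul_I (rot k j z)
  rw [norm_rot] at e1 e2
  rw [← e2, mul_assoc, ← Complex.exp_add] at h1
  obtain ⟨m, hm⟩ := Complex.exp_eq_exp_iff_exists_int.1 (mul_left_cancel₀ hz' (e1.trans h1))
  have h3 : Complex.arg (rot k i z) = Complex.arg (rot k j z) - (i - j) * (π / k) + m * (2 * π) := by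
    have h : (Complex.arg (rot k i z) : ℂ) =
        ((Complex.arg (rot k j z) - (i - j) * (π / k) + m * (2 * π) : ℝ) : ℂ) := by
      refine mul_right_cancel₀ Complex.I_ne_zero (hm.trans ?_)
      push_cast; ring
    exact_mod_cast h
  have h4 : Complex.arg (rot k j z) = Complex.arg (rot k i z) + ((i - j - 2 * (k : ℤ) * m : ℤ) : ℝ) * (π / k) := by
    rw [h3]; push_cast; field_simp; ring
  generalize hn : i - j - 2 * (k : ℤ) * m = n at h4
  refine ⟨m, n, by rw [← hn]; ring, ?_, ?_, h4⟩
  · by_contra hlt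
    have h5 : (n : ℝ) ≤ -2 := by exact_mod_cast (by omega : n ≤ -2)
    have := mul_le_mul_of_nonneg_right h5 hpk.le
    linarith [abs_lt.1 hi, abs_lt.1 hj]
  · by_contra hlt
    have h5 : (2 : ℝ) ≤ n := by exact_mod_cast (by omega : 2 ≤ n)
    have := mul_le_mul_of_nonneg_right h5 hpk.le
    linarith [abs_lt.1 hi, abs_lt.1 hj]

theorem exists_abs_arg_rot_le (hk : 1 ≤ k) (hz : z ≠ 0) :
    ∃ j ∈ Set.Icc (-(k : ℤ)) k, |Complex.arg (rot k j z)| ≤ π / (2 * k) := by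
  have hk0 : (0 : ℝ) < k := by exact_mod_cast hk
  have hk1 : (1 : ℝ) ≤ k := by exact_mod_cast hk
  have hpi := Real.pi_pos
  set x := k * Complex.arg z / π with hx
  have hxa : Complex.arg z = x * (π / k) := by rw [hx]; field_simp
  have h1 := abs_le.1 (abs_sub_round x)
  have h2 := abs_le.1 (Complex.abs_arg_le_pi z)
  have hx1 : x ≤ k := by rw [hx, div_le_iff₀ hpi]; nlinarith
  have hx2 : -k ≤ x := by rw [hx, le_div_iff₀ hpi]; nlinarith
  have h3 : ((round x : ℤ) : ℝ) < k + 1 := by linarith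
  have h4 : -(k + 1 : ℝ) < ((round x : ℤ) : ℝ) := by linarith
  have h5 : round x < k + 1 := by exact_mod_cast h3
  have h6 : -(k + 1 : ℤ) < round x := by exact_mod_cast h4
  refine ⟨round x, ⟨by omega, by omega⟩, ?_⟩
  have h7 : rot k (round x) z = Complex.exp (Complex.log z - ((round x * (π / k) : ℝ)) * Complex.I) := by
    rw [sub_eq_add_neg, Complex.exp_add, Complex.exp_log hz, rot]
    congr 2; push_cast; ring
  have h8 : |Complex.arg z - round x * (π / k)| ≤ π / (2 * k) := by
    rw [hxa, ← sub_mul, abs_mul, abs_of_pos (div_pos hpi hk0)]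
    calc _ ≤ 1 / 2 * (π / k) := by gcongr; exact abs_sub_round x
      _ = _ := by ring
  have h9 : π / (2 * k) < π := by
    rw [div_lt_iff₀ (by positivity)]; nlinarith
  have h10 : (Complex.log z - ((round x * (π / k) : ℝ)) * Complex.I).im =
      Complex.arg z - round x * (π / k) := by
    rw [Complex.sub_im, Complex.log_im, Complex.im_ofReal_mul, Complex.I_im, mul_one]
  obtain ⟨e1, e2⟩ := abs_le.1 h8
  rw [← Complex.log_im, h7, Complex.log_exp (by rw [h10]; linarith) (by rw [h10]; linarith), h10]
  exact h8

/-- The map which acts as `T_{-1/2}` in the Fatou coordinate of index `j`. -/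
noncomputable def halfBack (φ Θ : ℤ → ℂ → ℂ) (j : ℤ) (z : ℂ) : ℂ := Θ j (φ j z - 1 / 2)

namespace IsStandardFatou

theorem eventually_halfBack_mem (S : IsStandardFatou p k b R₁ R₂ φ Θ) (R : ℝ) :
    ∀ᶠ ρ in atTop, ∀ j, ∀ z ∈ petal k b ρ j, φ j z - 1 / 2 ∈ timeDomain R₂ j ∧
      halfBack φ Θ j z ∈ petal k b R j ∧ φ j (halfBack φ Θ j z) = φ j z - 1 / 2 := by
  obtain ⟨R', -, -, h⟩ := S.exists_mem_timeDomain (max R₂ (R + 1) + 1)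
  filter_upwards [eventually_ge_atTop R'] with ρ hρ j z hz
  have h1 : φ j z - 1 / 2 ∈ timeDomain (max R₂ (R + 1)) j :=
    mem_timeDomain_of_norm_sub_le (h j z (petal_anti hρ hz)) (r := 1) (by norm_num) (by linarith)
  have h2 := timeDomain_anti (le_max_left _ _) h1
  refine ⟨h2, petal_anti ?_ (S.inv_mem_petal (le_max_left _ _) h1), S.inv_right _ _ h2⟩
  linarith [le_max_right R₂ (R + 1)]

/-- In the chart the point moves by at most `1/8 + 1/4 + 1/2`, which is a relative displacement of
at most `16` over the modulus of the chart; the inverse of that modulus is at most `2k ‖z‖ ^ k`. -/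
theorem eventually_norm_halfBack_sub_le (hk : 1 ≤ k) (S : IsStandardFatou p k b R₁ R₂ φ Θ) :
    ∀ᶠ ρ in atTop, ∀ j, ∀ z ∈ petal k b ρ j, ‖halfBack φ Θ j z - z‖ ≤ 32 * k * ‖z‖ ^ (k + 1) := by
  obtain ⟨R₀, hR₀, -, V, -, hV, -, hV2, -, hV3⟩ := exists_petal_charts hk b
  obtain ⟨R', -, hn⟩ := S.near (1 / 4) (by norm_num)
  filter_upwards [S.eventually_halfBack_mem R₀, eventually_ge_atTop (max (R₀ + 1) R')]
    with ρ h1 h2 j z hz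
  obtain ⟨h3, h4, h5⟩ := h1 j z hz
  have hz0 := petal_anti ((le_max_left _ _).trans h2) hz
  have hz1 := petal_anti (by linarith : R₀ ≤ R₀ + 1) hz0
  have h6 := hn j z (petal_anti ((le_max_right _ _).trans h2) hz)
  have h7 := S.inv_near j _ h3
  have h8 : ‖normChart k b j (halfBack φ Θ j z) - normChart k b j z‖ ≤ 1 := by
    rw [normChart, normChart, ← mul_sub, norm_mul, norm_sgn, one_mul]
    calc _ = ‖(timeChart k b j (halfBack φ Θ j z) - (φ j z - 1 / 2)) +
          (φ j z - timeChart k b j z) - 1 / 2‖ := by congr 1; ring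
      _ ≤ 1 / 8 + 1 / 4 + ‖(1 / 2 : ℂ)‖ := (norm_sub_le _ _).trans (by
          gcongr; exact (norm_add_le _ _).trans (add_le_add h7 h6))
      _ ≤ 1 := by norm_num
  have h9 := hV3 j _ (mem_petal_iff.1 hz0).2.2.2 _ h8
  rw [hV j _ h4, hV j _ hz1] at h9
  have h10 := (hV2 j z hz1).2
  have hX : 0 < ‖normChart k b j z‖ := by
    by_contra h
    have h0 : ‖normChart k b j z‖ = 0 := le_antisymm (not_lt.1 h) (norm_nonneg _)
    rw [h0] at h10; norm_num at h10
  refine h9.trans ?_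
  rw [div_mul_eq_mul_div, div_le_iff₀ hX]
  calc 16 * ‖z‖ = 16 * ‖z‖ * 1 := (mul_one _).symm
    _ ≤ 16 * ‖z‖ * (2 * k * (‖z‖ ^ k * ‖normChart k b j z‖)) := by gcongr
    _ = _ := by ring

theorem eventually_differentiableAt_halfBack (hk : 1 ≤ k) (S : IsStandardFatou p k b R₁ R₂ φ Θ) :
    ∀ᶠ ρ in atTop, ∀ j ∈ Set.Icc (-(k : ℤ)) k, ∀ z ∈ petal k b ρ j,
      DifferentiableAt ℂ (halfBack φ Θ j) z := by
  filter_upwards [S.eventually_halfBack_mem R₁, eventually_ge_atTop R₁] with ρ h1 h2 j hj z hz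
  have h3 := (S.fatou.holomorphic j hj).differentiableAt
    ((isOpen_petal hk b R₁ j).mem_nhds (petal_anti h2 hz))
  exact DifferentiableAt.comp (f := fun z => φ j z - 1 / 2) z
    ((S.inv_holomorphic j).differentiableAt ((isOpen_timeDomain R₂ j).mem_nhds (h1 j z hz).1))
    (h3.sub_const _)

theorem eventually_inv_left (S : IsStandardFatou p k b R₁ R₂ φ Θ) :
    ∀ᶠ ρ in atTop, ∀ j ∈ Set.Icc (-(k : ℤ)) k, ∀ z ∈ petal k b ρ j, Θ j (φ j z) = z := by
  obtain ⟨R', hR', -, h⟩ := S.exists_mem_timeDomain R₂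
  filter_upwards [eventually_ge_atTop R'] with ρ hρ j hj z hz
  exact S.inv_left hj (petal_anti (S.le.trans (hR'.trans hρ)) hz) (h j z (petal_anti hρ hz))

/-- The half iterates agree on consecutive petals of positive index. -/
theorem eventually_halfBack_eq_of_pos (hk : 1 ≤ k) (S : IsStandardFatou p k b R₁ R₂ φ Θ)
    (hj : j ∈ Set.Icc (1 : ℤ) k) (hcomm : CommutesWithHalf j (transition φ Θ j)) :
    ∀ᶠ ρ in atTop, ∀ z ∈ petalInter k b ρ j, halfBack φ Θ (j - 1) z = halfBack φ Θ j z := by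
  obtain ⟨R', hR'⟩ := S.eventually_inv_left.exists
  have ht : Tendsto (fun W : ℂ => W - 1 / 2) (hornEnd j) (hornEnd j) :=
    tendsto_hornEnd 0 fun W => by simp
  obtain ⟨M, hM⟩ := eventually_hornEnd.1 ((ht.eventually (hcomm.and
    (S.eventually_inv_mem_petalInter hk R' hj))))
  obtain ⟨ρ₀, -, hρ₀⟩ := S.exists_lt_hornSign hk M
  filter_upwards [eventually_ge_atTop (max R' ρ₀)] with ρ hρ z hz
  obtain ⟨h1, h2, h3⟩ := hM _ (hρ₀ j hj z (petalInter_anti ((le_max_right _ _).trans hρ) hz))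
  obtain ⟨h4, h5⟩ := petalInter_subset (petalInter_anti ((le_max_left _ _).trans hρ) hz)
  have h6 := hR' _ (source_mem_Icc hj) z h4
  have h7 := hR' _ (target_mem_Icc hj) _ (petalInter_subset h3).2
  simp only [Function.comp_apply, T, sub_add_cancel, transition, h6] at h1
  have h8 : halfBack φ Θ (target j) z = halfBack φ Θ (source j) z := by
    rw [halfBack, halfBack, h1, add_sub_cancel_right]
    exact h7
  rcases source_target j with ⟨e1, e2⟩ | ⟨e1, e2⟩ <;> rw [e1, e2] at h8
  · exact h8.symm
  · exact h8

/-- In Fatou coordinates this is the commutation of the real translation `T (-1/2)` with `Σ ∘ T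
(1/2)`. -/
theorem eventually_map_halfBack (hk : 1 ≤ k) (hp : IsPrenormalized p k b)
    (S : IsStandardFatou p k b R₁ R₂ φ Θ) : ∀ᶠ ρ in atTop, ∀ j ∈ Set.Icc (-(k : ℤ)) k,
      ∀ z ∈ petal k b ρ j, p (halfBack φ Θ j z) = halfBack φ Θ (-j) (p z) := by
  obtain ⟨R', hR', hR'₁⟩ := (S.eventually_inv_left.and (eventually_ge_atTop R₁)).exists
  obtain ⟨A, hA, K, hK, hm⟩ := exists_mem_petal_neg_of_orderGE hk b (orderGE_of_isPrenormalized hp)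
  set B := max A (R' + K)
  filter_upwards [S.eventually_halfBack_mem B, eventually_ge_atTop B] with ρ h1 h2 j hj z hz
  have hB1 : A ≤ B := le_max_left _ _
  have hB2 : R' + K ≤ B := le_max_right _ _
  obtain ⟨-, h4, h5⟩ := h1 j z hz
  have hzB := petal_anti h2 hz
  have h6 := hm B hB1 R' (by linarith) j _ h4
  have h7 := hm B hB1 R' (by linarith) j _ hzB
  have hB3 : R₁ ≤ B := by linarith
  have h8 := S.fatou.conjugate j hj _ (petal_anti hB3 h4) (petal_anti hR'₁ h6)
  have h9 := S.fatou.conjugate j hj _ (petal_anti hB3 hzB) (petal_anti hR'₁ h7)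
  rw [← hR' (-j) (neg_mem_Icc hj) _ h6, h8, h5, halfBack, h9]
  congr 1
  simp [Complex.conj_ofNat]

theorem eventually_halfBack_glue (hk : 1 ≤ k) (S : IsStandardFatou p k b R₁ R₂ φ Θ) :
    ∀ᶠ ρ in atTop, ∀ z ∈ petal k b ρ k, halfBack φ Θ (-(k : ℤ)) z = halfBack φ Θ k z := by
  filter_upwards [S.eventually_halfBack_mem R₁, eventually_ge_atTop R₁] with ρ h1 h2 z hz
  obtain ⟨-, h4, h5⟩ := h1 k z hz
  obtain ⟨-, h6, h7⟩ := h1 (-(k : ℤ)) z (by rwa [petal_glue hk])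
  rw [petal_glue hk] at h6
  refine S.fatou.injective k (by simp) h6 h4 ?_
  rw [h5, ← S.fatou.glue h6, h7, S.fatou.glue (petal_anti h2 hz)]

/-- The hypothesis concerns only positive indices. For `j ≤ 0` the germ `p` carries the intersection
of index `j` to the one of index `1 - j`, which is at least `1`, and the equality is pulled back
because `p` is injective near `0`. -/
theorem eventually_halfBack_eq_succ (hk : 1 ≤ k) (hp : IsPrenormalized p k b)
    (S : IsStandardFatou p k b R₁ R₂ φ Θ)
    (hcomm : ∀ j ∈ Set.Icc (1 : ℤ) k, CommutesWithHalf j (transition φ Θ j)) :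
    ∀ᶠ ρ in atTop, ∀ j ∈ Set.Icc (-(k : ℤ) + 1) k, ∀ z ∈ petalInter k b ρ j,
      halfBack φ Θ (j - 1) z = halfBack φ Θ j z := by
  have hpos : ∀ᶠ ρ in atTop, ∀ j ∈ Set.Icc (1 : ℤ) k, ∀ z ∈ petalInter k b ρ j,
      halfBack φ Θ (j - 1) z = halfBack φ Θ j z :=
    (eventually_all_finite (Set.finite_Icc _ _)).2 fun j hj =>
      S.eventually_halfBack_eq_of_pos hk hj (hcomm j hj)
  obtain ⟨ρ₀, hρ₀, hρ₀p, hρ₀R⟩ := (hpos.and ((S.eventually_map_halfBack hk hp).and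
    (eventually_ge_atTop R₁))).exists
  obtain ⟨c', -, -, hc', -⟩ := exists_inverse_of_isPrenormalized hk hp
  obtain ⟨r, hr, hinj⟩ := Metric.eventually_nhds_iff.1 hc'
  obtain ⟨B, -, hB⟩ := norm_lt_of_mem_petal hk b hr
  obtain ⟨A, hA, K, hK, hm⟩ := exists_mem_petal_neg_of_orderGE hk b (orderGE_of_isPrenormalized hp)
  obtain ⟨N, -, hN⟩ := S.near 1 one_pos
  set M := max (max (ρ₀ + ‖Complex.I * π * b / k‖) (|b| * π)) 0 with hM
  have hM1 : ρ₀ + ‖Complex.I * π * b / k‖ ≤ M := (le_max_left _ _).trans (le_max_left _ _)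
  have hM2 : |b| * π ≤ M := (le_max_right _ _).trans (le_max_left _ _)
  have hM3 : 0 ≤ M := le_max_right _ _
  set D := max ρ₀ (max A (max N R₁ + K)) with hD
  have hD1 : A ≤ D := (le_max_left _ _).trans (le_max_right _ _)
  have hD2 : max N R₁ + K ≤ D := (le_max_right _ _).trans (le_max_right _ _)
  have hD0 : ρ₀ ≤ D := le_max_left _ _
  filter_upwards [hpos, S.eventually_halfBack_mem B,
    eventually_ge_atTop (max D (M + 2 + 2 * ‖Complex.I * π * b / k‖))] with ρ h1 h2 h3 j hj z hz
  rcases lt_or_ge 0 j with hj0 | hj0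
  · exact h1 j ⟨by omega, hj.2⟩ z hz
  have hjk : j ∈ Set.Icc (-(k : ℤ)) k := ⟨by have := hj.1; omega, hj.2⟩
  have hjk' : j - 1 ∈ Set.Icc (-(k : ℤ)) k := ⟨by have := hj.1; omega, by have := hj.2; omega⟩
  have hρD : D ≤ ρ := (le_max_left _ _).trans h3
  have hρM : M + 2 + 2 * ‖Complex.I * π * b / k‖ ≤ ρ := (le_max_right _ _).trans h3
  have hz1 := petal_anti hρD hz.1.1
  have hz2 := petal_anti hρD hz.1.2
  have hp2 := hm D hD1 (max N R₁) (by linarith) _ _ hz2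
  have him := (im_normChart_of_mem_petalInter hk (hM2.trans (by linarith : M ≤ M + 2))
    (by linarith) hρM hz).2
  have hDN : N ≤ D := by linarith [le_max_left N R₁]
  have hDR : R₁ ≤ D := by linarith [le_max_right N R₁]
  have e1 := abs_le.1 ((Complex.abs_im_le_norm _).trans (hN _ _ (petal_anti hDN hz2)))
  have e2 := abs_le.1 ((Complex.abs_im_le_norm _).trans (hN _ _ (petal_anti (le_max_left _ _) hp2)))
  have e3 := S.fatou.conjugate j hjk z (petal_anti hDR hz2) (petal_anti (le_max_right _ _) hp2)
  rw [e3] at e2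
  simp only [Complex.sub_im, Complex.conj_im, Complex.add_im] at e1 e2
  norm_num at e2
  -- Since `p` acts as `Σ ∘ T (1/2)`, it reverses the imaginary part. The margin `2` in the lower
  -- bound on `ρ` pays for the two unit errors between charts and Fatou coordinates.
  have hpz : p z ∈ petalInter k b ρ₀ (1 - j) := by
    refine mem_petalInter_of_im hk hM2 hM1 (Or.inl ⟨?_, ?_⟩) (R := max N R₁)
    · rw [show 1 - j - 1 = -j by ring]; exact hp2
    · rw [show 1 - j - 1 = -j by ring]
      simp only [normChart, Complex.im_ofReal_mul, sgn_neg] at him ⊢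
      rcases abs_eq (zero_le_one' ℝ) |>.1 (abs_sgn j) with h6 | h6 <;> rw [h6] at him ⊢ <;> linarith
  have h4 := hρ₀ (1 - j) ⟨by omega, by have := hj.1; omega⟩ _ hpz
  have e4 := hρ₀p j hjk z (petal_anti hD0 hz2)
  have e5 := hρ₀p (j - 1) hjk' z (petal_anti hD0 hz1)
  rw [show 1 - j - 1 = -j by ring, show 1 - j = -(j - 1) by ring, ← e4, ← e5] at h4
  have h5 := hinj (y := conj (halfBack φ Θ j z)) (by
    simpa using hB _ _ (h2 j z hz.1.2).2.1)
  have h6 := hinj (y := conj (halfBack φ Θ (j - 1) z)) (by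
    simpa using hB _ _ (h2 (j - 1) z hz.1.1).2.1)
  rw [Complex.conj_conj] at h5 h6
  refine (starRingEnd ℂ).injective ?_
  rw [← h5, ← h6, h4]

/-- Petals with a common point have indices that are equal or consecutive modulo `2 * k`. The
consecutive case is the previous lemma, except across the cut `±k`, where the identification of
`S_{-k}` with `S_k` is used. -/
theorem eventually_halfBack_eq (hk : 1 ≤ k) (hp : IsPrenormalized p k b)
    (S : IsStandardFatou p k b R₁ R₂ φ Θ)
    (hcomm : ∀ j ∈ Set.Icc (1 : ℤ) k, CommutesWithHalf j (transition φ Θ j)) :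
    ∀ᶠ ρ in atTop, ∀ i ∈ Set.Icc (-(k : ℤ)) k, ∀ j ∈ Set.Icc (-(k : ℤ)) k,
      ∀ z ∈ petal k b ρ i ∩ petal k b ρ j, halfBack φ Θ i z = halfBack φ Θ j z := by
  filter_upwards [S.eventually_halfBack_eq_succ hk hp hcomm, S.eventually_halfBack_glue hk]
    with ρ h1 h2
  have hglue : ∀ {z : ℂ}, z ∈ petal k b ρ (-(k : ℤ)) → halfBack φ Θ (-(k : ℤ)) z = halfBack φ Θ k z :=
    fun hz => h2 _ (by rwa [petal_glue hk] at hz)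
  have key : ∀ i ∈ Set.Icc (-(k : ℤ)) k, ∀ j ∈ Set.Icc (-(k : ℤ)) k, ∀ m : ℤ,
      ∀ z ∈ petal k b ρ i ∩ petal k b ρ j, i - j = 2 * k * m + 1 →
      Complex.arg (rot k j z) = Complex.arg (rot k i z) + π / k →
      halfBack φ Θ i z = halfBack φ Θ j z := by
    intro i hi j hj m z ⟨hzi, hzj⟩ hm ha
    have ha0 : 0 < Complex.arg (rot k j z) := by
      have := (abs_lt.1 hzi.2.2.1).1; linarith
    have ha1 := (abs_lt.1 hzj.2.2.1).2
    rw [Set.mem_Icc] at hi hj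
    have hm0 : m < 1 := by nlinarith
    have hm1 : -2 < m := by nlinarith
    obtain rfl | rfl : m = 0 ∨ m = -1 := by omega
    · obtain rfl : j = i - 1 := by omega
      exact (h1 i ⟨by omega, hi.2⟩ z ⟨⟨hzj, hzi⟩, ha0, ha1⟩).symm
    · obtain ⟨rfl, rfl⟩ | ⟨rfl, rfl⟩ : (i = -k ∧ j = k - 1) ∨ (i = -k + 1 ∧ j = k) := by omega
      · rw [hglue hzi]
        exact (h1 k ⟨by omega, le_rfl⟩ z ⟨⟨hzj, by rwa [petal_glue hk] at hzi⟩, ha0, ha1⟩).symm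
      · rw [← petal_glue hk] at hzj
        rw [← rot_glue hk] at ha0 ha1
        rw [← hglue hzj]
        have e : (-(k : ℤ) + 1) - 1 = -k := by ring
        have := h1 (-k + 1) ⟨le_rfl, by omega⟩ z ⟨⟨by rwa [e], hzi⟩, by rwa [e], by rwa [e]⟩
        rw [e] at this
        exact this.symm
  rintro i hi j hj z ⟨hzi, hzj⟩
  obtain ⟨m, n, hmn, hn1, hn2, ha⟩ := exists_arg_rot_eq hk hzi.1 hzi.2.2.1 hzj.2.2.1
  obtain rfl | rfl | rfl : n = 1 ∨ n = -1 ∨ n = 0 := by omega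
  · exact key i hi j hj m z ⟨hzi, hzj⟩ hmn (by rw [ha]; push_cast; ring)
  · refine (key j hj i hi (-m) z ⟨hzj, hzi⟩ (by linear_combination -hmn) ?_).symm
    rw [ha]; push_cast; ring
  · rw [Set.mem_Icc] at hi hj
    have hm0 : m < 2 := by nlinarith
    have hm1 : -2 < m := by nlinarith
    obtain rfl | rfl | rfl : m = 0 ∨ m = -1 ∨ m = 1 := by omega
    · obtain rfl : i = j := by omega
      rfl
    · obtain ⟨rfl, rfl⟩ : i = -k ∧ j = k := by omega
      exact hglue hzi
    · obtain ⟨rfl, rfl⟩ : j = -k ∧ i = k := by omega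
      exact (hglue hzj).symm

theorem exists_halfBack (hk : 1 ≤ k) (hp : IsPrenormalized p k b)
    (S : IsStandardFatou p k b R₁ R₂ φ Θ)
    (hcomm : ∀ j ∈ Set.Icc (1 : ℤ) k, CommutesWithHalf j (transition φ Θ j)) :
    ∃ μ : ℂ → ℂ, μ 0 = 0 ∧ ∀ᶠ ρ in atTop, ∀ j ∈ Set.Icc (-(k : ℤ)) k, ∀ z ∈ petal k b ρ j,
      μ z = halfBack φ Θ j z := by
  classical
  obtain ⟨ρ₀, hρ₀⟩ := (S.eventually_halfBack_eq hk hp hcomm).exists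
  refine ⟨fun z => if h : ∃ j ∈ Set.Icc (-(k : ℤ)) k, z ∈ petal k b ρ₀ j then
    halfBack φ Θ h.choose z else 0, dif_neg ?_, ?_⟩
  · rintro ⟨j, -, hj⟩
    exact hj.1 rfl
  · filter_upwards [eventually_ge_atTop ρ₀] with ρ hρ j hj z hz
    have h : ∃ j ∈ Set.Icc (-(k : ℤ)) k, z ∈ petal k b ρ₀ j := ⟨j, hj, petal_anti hρ hz⟩
    simp only [dif_pos h]
    exact hρ₀ _ h.choose_spec.1 j hj z ⟨h.choose_spec.2, petal_anti hρ hz⟩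

end IsStandardFatou

theorem eventually_exists_mem_petal (hk : 1 ≤ k) (b R : ℝ) :
    ∀ᶠ z in 𝓝[≠] (0 : ℂ), ∃ j ∈ Set.Icc (-(k : ℤ)) k, z ∈ petal k b R j := by
  obtain ⟨r, hr, h⟩ := exists_mem_petal hk b R
  filter_upwards [self_mem_nhdsWithin, nhdsWithin_le_nhds (Metric.ball_mem_nhds (0 : ℂ) hr)]
    with z hz hzr
  obtain ⟨j, hj, hja⟩ := exists_abs_arg_rot_le hk hz
  exact ⟨j, hj, h j z hz (by simpa using hzr) hja⟩

/-- If the transition functions commute with `T_{1/2}` then the square of `p` has an inverse with a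
square root commuting with `p`. -/
theorem IsStandardFatou.exists_half_inverse (hk : 1 ≤ k) (hp : IsPrenormalized p k b)
    (S : IsStandardFatou p k b R₁ R₂ φ Θ)
    (hcomm : ∀ j ∈ Set.Icc (1 : ℤ) k, CommutesWithHalf j (transition φ Θ j)) :
    ∃ μ : ℂ → ℂ, AnalyticAt ℂ μ 0 ∧ OrderGE (k + 1) (fun z => μ z - z) ∧
      (∀ᶠ z in 𝓝 0, p (μ z) = μ (p z)) ∧ ∀ᶠ z in 𝓝 0, p (p (μ (μ z))) = z := by
  obtain ⟨μ, hμ0, hμ⟩ := S.exists_halfBack hk hp hcomm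
  have hp0 : p 0 = 0 := hp.1.1
  obtain ⟨ρ₀, hρ₀, hρ₀d, hρ₀n⟩ := (hμ.and ((S.eventually_differentiableAt_halfBack hk).and
    (S.eventually_norm_halfBack_sub_le hk))).exists
  have hpunct : ∀ {Q : ℂ → Prop}, Q 0 → (∀ᶠ z in 𝓝[≠] 0, Q z) → ∀ᶠ z in 𝓝 0, Q z := by
    intro Q h0 h
    rw [← nhdsNE_sup_pure, eventually_sup]
    exact ⟨h, h0⟩
  have hO : OrderGE (k + 1) (fun z => μ z - z) := by
    refine IsBigO.of_bound (32 * k) (hpunct (by simp [hμ0]) ?_)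
    filter_upwards [eventually_exists_mem_petal hk b ρ₀] with z ⟨j, hj, hz⟩
    rw [hρ₀ j hj z hz, norm_pow]
    exact hρ₀n j z hz
  have hcont : ContinuousAt μ 0 := by
    have h1 : Tendsto (fun z => μ z - z + z) (𝓝 0) (𝓝 (0 + 0)) := by
      refine Tendsto.add (hO.trans_tendsto ?_) tendsto_id
      exact (continuous_pow (k + 1)).tendsto' 0 0 (by simp)
    simpa [ContinuousAt, hμ0] using h1
  -- The petals cover a punctured neighbourhood, and the estimate gives continuity at `0`, so the
  -- singularity is removable.
  have han : AnalyticAt ℂ μ 0 := by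
    refine Complex.analyticAt_of_differentiable_on_punctured_nhds_of_continuousAt ?_ hcont
    filter_upwards [eventually_exists_mem_petal hk b ρ₀] with z ⟨j, hj, hz⟩
    refine (hρ₀d j hj z hz).congr_of_eventuallyEq ?_
    filter_upwards [(isOpen_petal hk b ρ₀ j).mem_nhds hz] with y hy
    exact hρ₀ j hj y hy
  obtain ⟨A, hA, K, hK, hm⟩ := exists_mem_petal_neg_of_orderGE hk b (orderGE_of_isPrenormalized hp)
  obtain ⟨A', hA'⟩ := (S.eventually_halfBack_mem ρ₀).exists
  obtain ⟨N, hN, hcomp⟩ := S.fatou.exists_comp_self hk hp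
  refine ⟨μ, han, hO, hpunct (by simp [hμ0, hp0]) ?_, hpunct (by simp [hμ0, hp0]) ?_⟩
  · obtain ⟨ρ₁, h1, h2⟩ := ((S.eventually_map_halfBack hk hp).and
      (eventually_ge_atTop (max A (ρ₀ + K)))).exists
    filter_upwards [eventually_exists_mem_petal hk b ρ₁] with z ⟨j, hj, hz⟩
    have h3 := hm ρ₁ ((le_max_left _ _).trans h2) ρ₀ (by linarith [le_max_right A (ρ₀ + K)]) j z hz
    rw [hρ₀ j hj z (petal_anti (by linarith [le_max_right A (ρ₀ + K)]) hz), h1 j hj z hz,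
      hρ₀ _ (neg_mem_Icc hj) _ h3]
  · obtain ⟨B, hB, hBρ⟩ := ((S.eventually_halfBack_mem (max N ρ₀)).and
      (eventually_ge_atTop (max N ρ₀))).exists
    obtain ⟨D, hD, hDB⟩ := ((S.eventually_halfBack_mem B).and (eventually_ge_atTop B)).exists
    filter_upwards [eventually_exists_mem_petal hk b D] with z ⟨j, hj, hz⟩
    obtain ⟨-, h1, h2⟩ := hD j z hz
    obtain ⟨-, h3, h4⟩ := hB j _ h1
    have hBρ₀ := (le_max_right _ _).trans hBρ
    rw [hρ₀ j hj z (petal_anti (hBρ₀.trans hDB) hz), hρ₀ j hj _ (petal_anti hBρ₀ h1)]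
    obtain ⟨-, h5, h6⟩ := hcomp j hj _ (petal_anti (le_max_left _ _) h3)
    refine S.fatou.injective j hj h5 (petal_anti (hN.trans ((le_max_left _ _).trans
      (hBρ.trans hDB))) hz) ?_
    rw [h6, h4, h2]; ring

end
end AntiParabolic

namespace AntiParabolic
section

/-! ### Real models and invariant curves -/

variable {k : ℕ} {b : ℝ} {p P h f : ℂ → ℂ} {γ : ℝ → ℂ} {A : ℕ → ℝ}

theorem Conjugates.deriv_mul_dbar (hc : Conjugates h f P) (hf : IsAntiholomorphicGerm f)
    (hP : IsAntiholomorphicGerm P) : deriv h 0 * dbar f = dbar P * conj (deriv h 0) := by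
  obtain ⟨hh, hcomm⟩ := hc
  have e1 : HasDerivAt (fun z => h (f (conj z))) (deriv h 0 * dbar f) 0 :=
    hasDerivAt_comp_zero hh.hasDerivAt hf.hasDerivAt (by simp [hf.1])
  have e2 : HasDerivAt (fun z => P (conj (conjGerm h z))) (dbar P * conj (deriv h 0)) 0 :=
    hasDerivAt_comp_zero (F := fun z => P (conj z)) hP.hasDerivAt (hasDerivAt_conjGerm hh.hasDerivAt)
      (by simp [conjGerm, hh.map_zero])
  have e3 := e2.congr_of_eventuallyEq (f₁ := fun z => h (f (conj z))) (by
    filter_upwards [eventually_conj hcomm] with z hz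
    simp [hz, conjGerm])
  exact e1.unique e3

/-- As `μ` is a half iterate of the inverse of `p ∘ p`, the germ `p ∘ μ` is an antiholomorphic
involution commuting with `p`. Straightening it to the conjugation makes `p` real. -/
theorem exists_realExpansion_of_commutesWithHalf (hk : 1 ≤ k) (hp : IsPrenormalized p k b)
    (hcomm : ∀ R₁ R₂ φ Θ, IsStandardFatou p k b R₁ R₂ φ Θ →
      ∀ j ∈ Set.Icc (1 : ℤ) k, CommutesWithHalf j (transition φ Θ j)) :
    ∃ (h P : ℂ → ℂ) (A : ℕ → ℝ), Conjugates h p P ∧ HasRealExpansion P A ∧ A 1 = 1 := by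
  obtain ⟨R₁, R₂, φ, Θ, S⟩ := exists_isStandardFatou hk hp
  obtain ⟨μ, hμa, hμ1, hpμ, hμμ⟩ := S.exists_half_inverse hk hp (hcomm R₁ R₂ φ Θ S)
  have hμ0 : μ 0 = 0 := by simpa using hμ1.eq_zero (by omega)
  have hμt : Tendsto μ (𝓝 0) (𝓝 0) := by simpa [hμ0] using hμa.continuousAt.tendsto
  set σ : ℂ → ℂ := fun z => p (μ z) with hσ
  have hσa : IsAntiholomorphicGerm σ := hp.1.comp_holomorphic hμa hμ0
  have hσσ : ∀ᶠ z in 𝓝 0, σ (σ z) = z := by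
    filter_upwards [hμμ, hμt.eventually hpμ] with z h1 h2
    simp only [hσ]
    rw [← h2, h1]
  have hσp : ∀ᶠ z in 𝓝 0, σ (p z) = p (σ z) := by
    filter_upwards [hpμ] with z h1
    simp only [hσ, h1]
  have hpd : dbar p = 1 := (OrderGE.hasDerivAt (((orderGE_of_isPrenormalized hp).mono
    (by omega : 2 ≤ k + 1)).congr fun z => by ring)).deriv
  have hμd : HasDerivAt μ 1 0 := OrderGE.hasDerivAt ((hμ1.mono
    (by omega : 2 ≤ k + 1)).congr fun z => by ring)
  have hσd : HasDerivAt (fun z => conj (σ z)) 1 0 := by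
    have h1 : HasDerivAt (fun z => p (conj (conjGerm μ z))) (1 * conj 1) 0 :=
      hasDerivAt_comp_zero (F := fun z => p (conj z)) (hpd ▸ hp.1.hasDerivAt)
        (hasDerivAt_conjGerm hμd) (by simp [conjGerm, hμ0])
    have h2 := hasDerivAt_conjGerm h1
    have h3 : (conjGerm fun z => p (conj (conjGerm μ z))) = fun z => conj (σ z) := by
      ext z; simp [conjGerm, hσ]
    rwa [h3, one_mul, map_one, map_one] at h2
  -- The average satisfies `h ∘ σ = conj ∘ h` because `σ` is an involution. It is invertible because
  -- `conj ∘ σ` has derivative `1`, not `-1`.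
  set h : ℂ → ℂ := fun z => (z + conj (σ z)) / 2 with hh
  have hhd : HasDerivAt h 1 0 := by
    have := ((hasDerivAt_id (0 : ℂ)).add hσd).div_const 2
    norm_num at this
    exact this
  have hhb : IsBiholomorphicGerm h := .of_hasDerivAt
    ((analyticAt_id.add hσa.analyticAt_conj).div_const) (by simp [hh, hσa.1]) hhd one_ne_zero
  obtain ⟨h', hh', -, hl, hr⟩ := hhb.exists_inverse
  have hc : Conjugates h p fun z => h (p (h' z)) := Conjugates.of_inverse hhb hl
  have hPa : IsAntiholomorphicGerm fun z => h (p (h' z)) :=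
    (hp.1.comp_holomorphic hh'.analytic hh'.map_zero).holomorphic_comp hhb.analytic hhb.map_zero
  have hhσ : ∀ᶠ z in 𝓝 0, h (σ z) = conj (h z) := by
    filter_upwards [hσσ] with z h1
    simp only [hh, h1, map_div₀, map_add, Complex.conj_conj, Complex.conj_ofNat]
    ring
  have hPc : ∀ᶠ z in 𝓝 0, (fun z => h (p (h' z))) (conj z) = conj ((fun z => h (p (h' z))) z) := by
    refine eventually_of_comp hh' hr ?_
    filter_upwards [hhσ, hp.1.tendsto.eventually hhσ, hσa.tendsto.eventually hl, hl, hσp]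
      with z h1 h2 h3 h4 h5
    rw [← h1, h3, h4, ← h2, h5]
  obtain ⟨A, hA, hA1⟩ := exists_hasRealExpansion hPa hPc
  refine ⟨h, _, A, hc, hA, ?_⟩
  have h1 := hc.deriv_mul_dbar hp.1 hPa
  rw [hpd, ← hA1, hhd.deriv] at h1
  simp only [map_one, mul_one] at h1
  exact_mod_cast h1.symm

/-- A real analytic germ extends to a holomorphic germ. -/
theorem exists_complexification (hγ : AnalyticAt ℝ γ 0) :
    ∃ g : ℂ → ℂ, AnalyticAt ℂ g 0 ∧ ∀ᶠ t : ℝ in 𝓝 0, g t = γ t := by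
  obtain ⟨q, hq⟩ := hγ
  set Q : FormalMultilinearSeries ℂ ℂ ℂ := FormalMultilinearSeries.ofScalars ℂ fun n => q.coeff n
  obtain ⟨r, hr0, hr⟩ := ENNReal.lt_iff_exists_nnreal_btwn.1 hq.radius_pos
  have hQ : (r : ENNReal) ≤ Q.radius := by
    obtain ⟨C, -, hC⟩ := q.norm_mul_pow_le_of_lt_radius hr
    refine Q.le_radius_of_bound C fun n => ?_
    rw [FormalMultilinearSeries.ofScalars_norm]
    have h1 : ‖q n‖ = ‖q.coeff n‖ := FormalMultilinearSeries.norm_apply_eq_norm_coef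
    exact h1 ▸ hC n
  have hQ' := (Q.hasFPowerSeriesOnBall (hr0.trans_le hQ)).hasFPowerSeriesAt
  refine ⟨Q.sum, hQ'.analyticAt, ?_⟩
  have ht : Tendsto (fun t : ℝ => (t : ℂ)) (𝓝 0) (𝓝 0) :=
    Complex.continuous_ofReal.tendsto' 0 0 (by simp)
  filter_upwards [ht.eventually (hasFPowerSeriesAt_iff.1 hQ'), hasFPowerSeriesAt_iff.1 hq]
    with t h1 h2
  rw [zero_add] at h1 h2
  refine h1.unique ?_
  simpa [Q] using h2

theorem exists_realExpansion_of_curve (hf : IsAntiholomorphicGerm f) (hγ : IsRealAnalyticCurve γ)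
    (hfγ : PreservesCurve f γ) : ∃ (h P : ℂ → ℂ) (A : ℕ → ℝ), Conjugates h f P ∧
      HasRealExpansion P A ∧ (TangentToSymmetryAxis f γ → A 1 = 1) := by
  obtain ⟨g, hga, hg⟩ := exists_complexification hγ.analytic
  have ht : Tendsto (fun t : ℝ => (t : ℂ)) (𝓝 0) (𝓝 0) :=
    Complex.continuous_ofReal.tendsto' 0 0 (by simp)
  have hg0 : g 0 = 0 := by simpa [hγ.map_zero] using hg.self_of_nhds
  have hgd : deriv g 0 = deriv γ 0 := by
    have h1 : HasDerivAt (fun t : ℝ => g t) (deriv g 0) 0 := by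
      refine HasDerivAt.comp_ofReal ?_
      simpa using hga.differentiableAt.hasDerivAt
    exact (h1.congr_of_eventuallyEq (hg.mono fun t h => h.symm)).deriv.symm
  have hgb : IsBiholomorphicGerm g := ⟨hga, hg0, by rw [hgd]; exact hγ.deriv_ne_zero⟩
  obtain ⟨h, hh, hd, hl, hr⟩ := hgb.exists_inverse
  set P : ℂ → ℂ := fun z => h (f (g z)) with hP
  have hc : Conjugates h f P := Conjugates.of_inverse hh hr
  have hPa : IsAntiholomorphicGerm P :=
    (hf.comp_holomorphic hga hg0).holomorphic_comp hh.analytic hh.map_zero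
  -- The equality of filters says in particular that points of the curve near `0` are sent to points
  -- with a small real parameter; that parameter is the value of `P`.
  have hreal : ∀ᶠ t : ℝ in 𝓝 0, conj (P t) = P t := by
    obtain ⟨U, hU, hUh⟩ := (hg.and (ht.eventually hl)).exists_mem
    have h1 : γ '' U ∈ map f (map γ (𝓝 0)) := by rw [hfγ]; exact image_mem_map hU
    filter_upwards [h1, hg] with t h2 h3
    obtain ⟨s, hs, hst⟩ := h2
    obtain ⟨h4, h5⟩ := hUh s hs
    have : P t = s := by rw [hP]; simp only; rw [h3, ← hst, ← h4, h5]
    rw [this, Complex.conj_ofReal]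
  have hPc : ∀ᶠ z in 𝓝 0, P (conj z) = conj (P z) := by
    have h1 : ∀ᶠ z in 𝓝 (0 : ℂ), P (conj z) = conjGerm (fun z => P (conj z)) z := by
      refine (hPa.2.frequently_eq_iff_eventually_eq (analyticAt_conjGerm hPa.2)).1 ?_
      have h2 : Tendsto (fun t : ℝ => (t : ℂ)) (𝓝[≠] 0) (𝓝[≠] 0) :=
        tendsto_nhdsWithin_of_tendsto_nhds_of_eventually_within _
          (ht.mono_left nhdsWithin_le_nhds) (by
            filter_upwards [self_mem_nhdsWithin] with t h3
            simpa using h3)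
      refine h2.frequently (Eventually.frequently ?_)
      filter_upwards [nhdsWithin_le_nhds hreal] with t h3
      simp [conjGerm, h3]
    filter_upwards [h1] with z h2
    simpa [conjGerm] using h2
  obtain ⟨A, hA, hA1⟩ := exists_hasRealExpansion hPa hPc
  refine ⟨h, P, A, hc, hA, fun hT => ?_⟩
  have h1 := hc.deriv_mul_dbar hf hPa
  rw [hd.deriv, ← hA1, hgd, map_inv₀] at h1
  have h2 := hγ.deriv_ne_zero
  have h3 : conj (deriv γ 0) ≠ 0 := by simpa using h2
  have h4 : (A 1 : ℂ) = 1 := by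
    field_simp at h1
    unfold TangentToSymmetryAxis at hT
    refine mul_right_cancel₀ h2 ?_
    linear_combination -h1 + hT
  exact_mod_cast h4

theorem exists_curve_of_realExpansion (hf : IsAntiholomorphicGerm f) (hfd : ‖dbar f‖ = 1)
    (hc : Conjugates h f P) (hP : HasRealExpansion P A) : ∃ γ : ℝ → ℂ, IsRealAnalyticCurve γ ∧
      PreservesCurve f γ ∧ (A 1 = 1 → TangentToSymmetryAxis f γ) := by
  obtain ⟨g, hg, hgd, hl, hr⟩ := hc.1.exists_inverse
  have hc' := hc.symm_of_inverse hf.tendsto hg hl hr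
  have hPa := hP.isAntiholomorphicGerm
  have ht : Tendsto (fun t : ℝ => (t : ℂ)) (𝓝 0) (𝓝 0) :=
    Complex.continuous_ofReal.tendsto' 0 0 (by simp)
  have hγd : HasDerivAt (fun t : ℝ => g t) (deriv h 0)⁻¹ 0 :=
    HasDerivAt.comp_ofReal (by simpa using hgd)
  have hrel := hc.deriv_mul_dbar hf hPa
  have hPd : dbar P = A 1 := hP.hasDerivAt.deriv
  rw [hPd] at hrel
  have hA1 : A 1 ≠ 0 := by
    intro h0
    rw [h0, Complex.ofReal_zero, zero_mul] at hrel
    rcases mul_eq_zero.1 hrel with h1 | h1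
    · exact hc.1.deriv_ne_zero h1
    · rw [h1, norm_zero] at hfd; exact zero_ne_one hfd
  have hPr : AnalyticAt ℝ (fun t : ℝ => (P (conj (t : ℂ))).re) 0 := by
    have h1 : AnalyticAt ℝ (fun z : ℂ => P (conj z)) ((0 : ℝ) : ℂ) := by
      simpa using hPa.2.restrictScalars (𝕜 := ℝ)
    exact (Complex.reCLM.analyticAt _).comp (h1.comp (Complex.ofRealCLM.analyticAt 0))
  have hPrd : HasDerivAt (fun t : ℝ => (P (conj (t : ℂ))).re) (A 1) 0 := by
    have h1 : HasDerivAt (fun z : ℂ => P (conj z)) (A 1) ((0 : ℝ) : ℂ) := by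
      simpa using hP.hasDerivAt
    simpa using h1.real_of_complex
  -- Preservation is an equality of germs of sets, so `P` must map the real line locally onto
  -- itself; this holds because `A 1 ≠ 0`.
  have hmap : map (fun t : ℝ => (P (conj (t : ℂ))).re) (𝓝 0) = 𝓝 0 := by
    have h1 := hPr.hasStrictDerivAt
    rw [hPrd.deriv] at h1
    have h2 := h1.map_nhds_eq hA1
    simpa [hPa.1] using h2
  refine ⟨fun t => g t, ⟨?_, by simp [hg.map_zero], ?_⟩, ?_, fun h1 => ?_⟩
  · have h1 : AnalyticAt ℝ g ((0 : ℝ) : ℂ) := by simpa using hg.analytic.restrictScalars (𝕜 := ℝ)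
    exact h1.comp (Complex.ofRealCLM.analyticAt 0)
  · rw [hγd.deriv]; exact inv_ne_zero hc.1.deriv_ne_zero
  · unfold PreservesCurve
    conv_rhs => rw [← hmap]
    rw [map_map, map_map]
    refine Filter.map_congr ?_
    filter_upwards [ht.eventually hc'.2, ht.eventually hP.eventually_conj_eq] with t h1 h2
    simp only [Function.comp, Complex.conj_ofReal] at h2 ⊢
    rw [← h1, Complex.conj_eq_iff_re.1 h2.symm]
  · unfold TangentToSymmetryAxis
    rw [hγd.deriv]
    rw [h1, Complex.ofReal_one, one_mul] at hrel
    have h2 := hc.1.deriv_ne_zero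
    have h3 : conj (deriv h 0) ≠ 0 := by simpa using h2
    rw [map_inv₀]
    field_simp
    linear_combination hrel

end
end AntiParabolic

/-! ### ### The equivalence of the four statements -/

theorem mainTheorem5 (f : ℂ → ℂ) (hf : AntiParabolic.IsParabolicGerm f)
    (k : ℕ) (hk : AntiParabolic.HasCodimension f k)
    (hpos : Even k → AntiParabolic.IsPositiveType f k)
    (b : ℂ) (hb : AntiParabolic.HasFormalInvariant f k b) :
    List.TFAE [
      ∃ γ : ℝ → ℂ, AntiParabolic.IsRealAnalyticCurve γ ∧ AntiParabolic.PreservesCurve f γ ∧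
        (Even k → AntiParabolic.TangentToSymmetryAxis f γ),
      ∃ (h p : ℂ → ℂ) (A : ℕ → ℝ), AntiParabolic.Conjugates h f p ∧
        AntiParabolic.HasRealExpansion p A ∧ (Even k → A 1 = 1),
      ∀ Ψ ∈ AntiParabolic.analyticInvariant f k b, ∀ j ∈ Set.Icc (1 : ℤ) k,
        Ψ j ∘ AntiParabolic.T (1 / 2) =ᶠ[AntiParabolic.hornEnd j] AntiParabolic.T (1 / 2) ∘ Ψ j,
      ∀ Ψ ∈ AntiParabolic.analyticInvariant f k b, ∀ j ∈ Set.Icc (1 : ℤ) k,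
        Ψ j ∘ AntiParabolic.Sig =ᶠ[AntiParabolic.hornEnd (-j)]
          AntiParabolic.Sig ∘ AntiParabolic.opposite (Ψ j)] := by
  obtain ⟨hbim, h₀, p, hc, hp⟩ := AntiParabolic.exists_prenormalization hf hk hpos hb
  obtain ⟨b, rfl⟩ : ∃ β : ℝ, b = β := ⟨b.re, Complex.ext rfl (by simpa using hbim)⟩
  have hfa := hf.antiholomorphic
  tfae_have 1 → 2 := by
    rintro ⟨γ, hγ, hfγ, hT⟩
    obtain ⟨h, P, A, h1, h2, h3⟩ := AntiParabolic.exists_realExpansion_of_curve hfa hγ hfγ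
    exact ⟨h, P, A, h1, h2, fun he => h3 (hT he)⟩
  tfae_have 2 → 1 := by
    rintro ⟨h, P, A, h1, h2, h3⟩
    obtain ⟨γ, hγ, hfγ, hT⟩ :=
      AntiParabolic.exists_curve_of_realExpansion hfa hf.norm_dbar h1 h2
    exact ⟨γ, hγ, hfγ, fun he => hT (h3 he)⟩
  tfae_have 2 → 3 := by
    rintro ⟨h, P, A, h1, h2, h3⟩ Ψ hΨ
    exact AntiParabolic.commutesWithHalf_of_realExpansion hfa hk.1 h1 h2 h3 hΨ
  -- The hypothesis is used only for the transition functions of standard Fatou coordinates in the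
  -- prenormalized coordinate `h₀`.
  tfae_have 3 → 2 := by
    intro h3
    obtain ⟨h, P, A, h1, h2, hA⟩ :=
      AntiParabolic.exists_realExpansion_of_commutesWithHalf hk.1 hp fun _ _ _ _ S =>
        h3 _ (S.transition_mem_analyticInvariant hk.1 hc hp)
    exact ⟨_, P, A, hc.trans h1, h2, fun _ => hA⟩
  tfae_have 3 ↔ 4 := by
    refine forall₂_congr fun Ψ _ => forall₂_congr fun j hj => ?_
    exact AntiParabolic.commutesWithHalf_iff_sig hj (Ψ j)
  tfae_finish
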